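/- **Setting.** Consider a two-player discounted Markov game with finite nonempty state space $\mathcal S$, finite nonempty action sets $\mathcal A_1,\mathcal A_2$ ($\mathcal A=\mathcal A_1\times\mathcal A_2$), rewards $r_i:\mathcal S\times\mathcal A\to[0,1]$, discount $\gamma\in[0,1)$, transition kernel $P$ and initial law $\rho_0$. Let $\tau_i,\epsilon_i>0$, let $D_i(p_i,\pi_{-i})$ be penalty functions and $\nu_i(\pi_i)$ regularizers. For payoff matrices $\mathbf R=(R_1,R_2)$ let $$J_i(\pi_i,\pi_{-i},p_i;R_i)=-\pi_i^TR_ip_i-\tfrac1{\tau_i}D_i(p_i,\pi_{-i})+\epsilon_i\nu_i(\pi_i),\qquad \pi_i\in\Delta_{\mathcal A_i},\ p_i\in\Delta_{\mathcal A_{-i}},$$ and $f_i(\pi_i,\pi_{-i};R_i)=\sup_{p_i}J_i$. A risk-averse quantal response equilibrium (RQE) of $\mathbf R$ is a pair $\pi$ in which each $\pi_i$ minimizes $f_i(\cdot,\pi_{-i};R_i)$; if it is unique, $\mathrm{RQE}_i(\mathbf R)$ denotes $f_i$ at it. In the four-player game, player $i$ minimizes $J_i$ over $\pi_i$ and adversary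 $i$ maximizes it over $p_i$; for $z=(\pi_1,\pi_2,p_1,p_2)$ its gradient operator $F(z;\mathbf R)$ has the blocks $-R_ip_i+\epsilon_i\nabla\nu_i(\pi_i)$ and $R_i^T\pi_i+\frac1{\tau_i}\nabla_{p}D_i(p_i,\pi_{-i})$. For $\mathbf Q=(Q_1,Q_2)$, $Q_i:\mathcal S\times\mathcal A\to\mathbb R$, the Bellman operator is $(\mathcal T\mathbf Q)_i(s,\mathbf a)=-r_i(s,\mathbf a)+\gamma\,\mathbb E_{s'\sim P(\cdot|s,\mathbf a)}[\mathrm{RQE}_i(-\mathbf Q(s',\cdot))]$. For Markov policies let $V_i^{\pi,p}(s)$ be the expected discounted sum from $s$ of $-r_i-\frac1{\tau_i}D_i(p_i,\pi_{-i};s_t)+\epsilon_i\nu_i(\pi_i;s_t)$ when $a_i\sim\pi_i$ and $a_{-i}\sim p_i$; in the four-player Markov game, player $i$ minimizes and adversary $i$ maximizes $V_i$ from every state. A Markov RQE is a pair $\pi$ such that, for each $i$ and $s$, $\pi_i$ minimizes $\max_{p_i}V_i(s)$ given $\pi_{-i}$. **Algorithm.** Start from $s\sim\rho_0$, uniform policies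 $z_0$ and $\mathbf Q_0=0$. In episode $t$, at every $s$ and for each $i$, put (with projections onto the simplices) $$\pi_{i,t+1}=\mathrm{Proj}\big(\pi_{i,t}-\beta_t\lambda_i[Q_{i,t}p_{i,t}+\epsilon_i\nabla\nu_i(\pi_{i,t})]\big),\quad p_{i,t+1}=\mathrm{Proj}\big(p_{i,t}-\beta_t\lambda_i[-Q_{i,t}^T\pi_{i,t}+\tfrac1{\tau_i}\nabla_pD_i(p_{i,t},\pi_{-i,t})]\big).$$ Then sample $K$ transitions $(s_k,\mathbf a_k,s_{k+1})$, continuing from the last state of the previous episode, with $\pi_t$ (on-policy) or with a fixed product Markov policy $\pi^r$ (off-policy), form the targets $$\hat q_{i,k}=-r_i(s_k,\mathbf a_k)+\gamma J_i\big(z_{t+1}(\cdot|s_{k+1});-\mathbf Q_t(s_{k+1},\cdot)\big),$$ and set $Q_{i,t+1}=Q_{i,t}+\alpha_t\hat\delta_i$ with $\hat\delta_i(s,\mathbf a)=\frac1K\sum_{k<K}(\hat q_{i,k}-Q_{i,t}(s_k,\mathbf a_k))\mathbf 1[(s_k,\mathbf a_k)=(s,\mathbf a)]$. **Assumptions.**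 1. There are $\mu,\lambda_1,\lambda_2>0$ (the $\lambda_i$ of the algorithm) such that for every $\mathbf Q$ and $s$ the stage game with payoffs $-\mathbf Q(s,\cdot)$ is $(\mu,\lambda)$-strongly monotone: $\langle z-z',F(z)-F(z')\rangle_\lambda\ge\mu\|z-z'\|_2^2$, where the $\pi_i$ and $p_i$ blocks have weight $\lambda_i$. 2. The $D_i$ and $\nu_i$ are $L$-smooth on (products of) simplices for some $L>0$. 3. There are $\underline\mu>0$, $C$ and $\rho\in(0,1)$ such that for every product Markov policy $\pi$ the state chain has a law $\mu_\pi\ge\underline\mu$ with $\|P_\pi^t(s,\cdot)-\mu_\pi\|_{TV}\le C\rho^t$ for all $s,t$. 4. The policies used for sampling in the run give, almost surely, every joint action in every state probability at least $\underline\pi>0$. 5. $\mathcal T$ is a $\gamma_0$-contraction in the max-norm, $\gamma_0\in[0,1)$. 6. With $\underline d=\underline\mu\,\underline\pi$, $K\ge1$ and $K\ge\dfrac{4\sqrt2\,C}{(1-\rho)(1-\gamma_0)\underline d}$. **Theorem.** Let $z^*=(\pi^*,p^*)$ be a Nash equilibrium of the four-player Markov game. Then $\pi^*$ is a Markov RQE,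 and there are $\kappa,b>0$ and constants $D_3,D_4$, depending only on the game, the regularizers and the constants in Assumptions 1–5, such that for step sizes with $0<\alpha_t\le\kappa\beta_t$ and $\beta_t\le b$ for all $t$ (i.e. $\alpha_t\ll\beta_t\ll1$), both on-policy and off-policy: 1. For constant step sizes $\alpha_t=\alpha$, $\beta_t=\beta$, for all $t$ and $s$, $$\mathbb E\|z_t(\cdot|s)-z^*(\cdot|s)\|_2^2\le\Big(1-\tfrac{1-\gamma_0}2\underline d\,\alpha\Big)^tD_3+\alpha D_4 .$$ 2. For all $\alpha>0$ and $h\ge1$ with $\frac{1-\gamma_0}2\underline d\,\alpha<1$ there is a $D_5$, which does not depend on $\beta$ or $K$, such that for diminishing step sizes $\alpha_t=\frac\alpha{t+h}$, $\beta_t=\frac\beta{t+h}$, for all $t$ and $s$, $$\mathbb E\|z_t(\cdot|s)-z^*(\cdot|s)\|_2^2\le D_5\Big(\frac{h+1}{h+t}\Big)^{\frac{1-\gamma_0}2\underline d\,\alpha}.$$ -/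

import Mathlib

open scoped ENNReal

noncomputable section

namespace RiskGame

universe u v

/-! ### Mixed strategies -/

/-- The Euclidean space of real vectors indexed by the finite type `X`. -/
abbrev Vec (X : Type v) : Type v := EuclideanSpace ℝ X

/-- The probability simplex, as a subset of Euclidean space. -/
def simplex (X : Type v) [Fintype X] : Set (Vec X) :=
  {x | (∀ a, 0 ≤ x a) ∧ ∑ a, x a = 1}

/-- The uniform mixed strategy. -/
def uniform (X : Type v) [Fintype X] [Nonempty X] : simplex X :=
  ⟨WithLp.toLp 2 fun _ => (Fintype.card X : ℝ)⁻¹, by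
    refine ⟨fun a => by simp, ?_⟩
    simp⟩

theorem isClosed_simplex (X : Type v) [Fintype X] : IsClosed (simplex X) := by
  have h : simplex X = (⋂ a : X, {x : Vec X | 0 ≤ x a}) ∩ {x : Vec X | ∑ a, x a = 1} := by
    ext x; simp [simplex]
  rw [h]
  refine IsClosed.inter (isClosed_iInter fun a => ?_) ?_
  · exact isClosed_le continuous_const (by fun_prop)
  · exact isClosed_eq (by fun_prop) continuous_const

theorem exists_nearest (X : Type v) [Fintype X] [Nonempty X] (x : Vec X) :
    ∃ y : simplex X, ∀ w : simplex X, ‖x - y‖ ≤ ‖x - w‖ := by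
  obtain ⟨y, hy, hxy⟩ :=
    (isClosed_simplex X).exists_infDist_eq_dist ⟨_, (uniform X).2⟩ x
  refine ⟨⟨y, hy⟩, fun w => ?_⟩
  rw [← dist_eq_norm, ← dist_eq_norm, ← hxy]
  exact Metric.infDist_le_dist_of_mem w.2

/-- Euclidean projection onto the probability simplex (the nearest point; it is unique, since
the simplex is convex). -/
def proj {X : Type v} [Fintype X] [Nonempty X] (x : Vec X) : simplex X :=
  Classical.choose (exists_nearest X x)

/-! ### Players and joint actions

The two players are `0, 1 : Fin 2`, and player `i` has the finite action set `A i`.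
A joint action is an element of `∀ i, A i`. -/

/-- The opponent `-i` of player `i`. -/
def opp (i : Fin 2) : Fin 2 := 1 - i

/-- A joint mixed strategy of the two players at one state. -/
abbrev Mixed (A : Fin 2 → Type v) [∀ i, Fintype (A i)] : Type v := ∀ i, simplex (A i)

theorem sum_prod_mixed {A : Fin 2 → Type v} [∀ i, Fintype (A i)] (x : Mixed A) :
    ∑ a : (∀ i, A i), ∏ i, ENNReal.ofReal ((x i : Vec (A i)) (a i)) = 1 := by
  classical
  have h := Finset.prod_univ_sum (fun i : Fin 2 => (Finset.univ : Finset (A i)))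
    (fun i b => ENNReal.ofReal ((x i : Vec (A i)) b))
  rw [Fintype.piFinset_univ] at h
  rw [← h]
  refine Finset.prod_eq_one fun i _ => ?_
  rw [← ENNReal.ofReal_sum_of_nonneg fun b _ => (x i).2.1 b, (x i).2.2, ENNReal.ofReal_one]

/-- The product law: the players draw their actions independently. -/
def jointLaw {A : Fin 2 → Type v} [∀ i, Fintype (A i)] (x : Mixed A) : PMF (∀ i, A i) :=
  PMF.ofFintype (fun a => ∏ i, ENNReal.ofReal ((x i : Vec (A i)) (a i))) (sum_prod_mixed x)

/-- A strategy profile `z = (π, p)` of the four-player game (two players, two adversaries) at one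
state. The adversary of player `i` plays on the action set of the opponent of `i`. -/
structure Profile (A : Fin 2 → Type v) [∀ i, Fintype (A i)] where
  π : ∀ i, simplex (A i)
  p : ∀ i, simplex (A (opp i))

/-- The squared Euclidean distance of two profiles. -/
def Profile.sqDist {A : Fin 2 → Type v} [∀ i, Fintype (A i)] (z w : Profile A) : ℝ :=
  ∑ i, (‖(z.π i : Vec (A i)) - w.π i‖ ^ 2 + ‖(z.p i : Vec (A (opp i))) - w.p i‖ ^ 2)

/-- `f` is differentiable at the points of `X` and its gradient is `L`-Lipschitz on `X`. -/
def SmoothOn {E : Type v} [NormedAddCommGroup E] [InnerProductSpace ℝ E] [CompleteSpace E]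
    (L : ℝ) (f : E → ℝ) (X : Set E) : Prop :=
  (∀ x ∈ X, DifferentiableAt ℝ f x) ∧
    ∀ x ∈ X, ∀ y ∈ X, ‖gradient f x - gradient f y‖ ≤ L * ‖x - y‖

/-- Regularizers and parameters: `D i p π₋ᵢ` is the penalty of adversary `i`, `ν i` the regularizer
of player `i`, `τ i` the degree of risk aversion and `ε i` the temperature. -/
structure Risk (A : Fin 2 → Type v) where
  D : ∀ i, Vec (A (opp i)) → Vec (A (opp i)) → ℝ
  ν : ∀ i, Vec (A i) → ℝ
  τ : Fin 2 → ℝ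
  ε : Fin 2 → ℝ
  τ_pos : ∀ i, 0 < τ i
  ε_pos : ∀ i, 0 < ε i

/-- All regularizers are `L`-smooth on (products of) simplices; `D i` is smooth jointly in its two
arguments. -/
def Risk.Smooth {A : Fin 2 → Type v} [∀ i, Fintype (A i)] (G : Risk A) (L : ℝ) : Prop :=
  ∀ i, SmoothOn L (G.ν i) (simplex (A i)) ∧
    SmoothOn L (fun w : WithLp 2 (Vec (A (opp i)) × Vec (A (opp i))) => G.D i w.fst w.snd)
      {w | w.fst ∈ simplex (A (opp i)) ∧ w.snd ∈ simplex (A (opp i))}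

section NormalForm

variable {A : Fin 2 → Type v} [∀ i, Fintype (A i)] [∀ i, DecidableEq (A i)]

/-- `xᵀ M y` for `x` on the actions of `i` and `y` on those of `-i`; `M` is a matrix indexed by
joint actions. -/
def bilin (i : Fin 2) (M : (∀ j, A j) → ℝ) (x : Vec (A i)) (y : Vec (A (opp i))) : ℝ :=
  ∑ a, x (a i) * M a * y (a (opp i))

/-- The vector `M y`, indexed by the actions of `i`. -/
def mulR (i : Fin 2) (M : (∀ j, A j) → ℝ) (y : Vec (A (opp i))) : Vec (A i) :=
  WithLp.toLp 2 fun b => ∑ a, if a i = b then M a * y (a (opp i)) else 0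

/-- The vector `Mᵀ x`, indexed by the actions of `-i`. -/
def mulL (i : Fin 2) (M : (∀ j, A j) → ℝ) (x : Vec (A i)) : Vec (A (opp i)) :=
  WithLp.toLp 2 fun b => ∑ a, if a (opp i) = b then x (a i) * M a else 0

/-- The cost `J_i(π_i, π_{-i}, p_i; R_i)` of player `i` in the four-player game; its adversary has
the cost `-J_i`. -/
def Risk.J (G : Risk A) (i : Fin 2) (x : simplex (A i)) (y q : simplex (A (opp i)))
    (M : (∀ j, A j) → ℝ) : ℝ :=
  -bilin i M x q - G.D i q y / G.τ i + G.ε i * G.ν i x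

/-- The risk-averse regularized objective `f_i(π_i, π_{-i}; R_i)`. -/
def Risk.f (G : Risk A) (i : Fin 2) (x : simplex (A i)) (y : simplex (A (opp i)))
    (M : (∀ j, A j) → ℝ) : ℝ :=
  ⨆ q : simplex (A (opp i)), G.J i x y q M

/-- Risk-averse quantal response equilibria of the bimatrix game with payoffs `R`. -/
def Risk.IsRQE (G : Risk A) (R : Fin 2 → (∀ j, A j) → ℝ) (x : Mixed A) : Prop :=
  ∀ i, ∀ x' : simplex (A i), G.f i (x i) (x (opp i)) (R i) ≤ G.f i x' (x (opp i)) (R i)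

open Classical in
/-- The value of player `i` at the RQE, when the RQE is unique. -/
def Risk.rqe (G : Risk A) (R : Fin 2 → (∀ j, A j) → ℝ) (i : Fin 2) : ℝ :=
  if h : ∃! x : Mixed A, G.IsRQE R x then
    G.f i (h.choose i) (h.choose (opp i)) (R i)
  else 0

/-- The block `∇_{π_i} J_i` of the gradient operator of the four-player game. -/
def Risk.Fπ (G : Risk A) (R : Fin 2 → (∀ j, A j) → ℝ) (z : Profile A) (i : Fin 2) : Vec (A i) :=
  -mulR i (R i) (z.p i) + G.ε i • gradient (G.ν i) (z.π i : Vec (A i))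

/-- The block `∇_{p_i} (-J_i)` of the gradient operator of the four-player game. -/
def Risk.Fp (G : Risk A) (R : Fin 2 → (∀ j, A j) → ℝ) (z : Profile A) (i : Fin 2) :
    Vec (A (opp i)) :=
  mulL i (R i) (z.π i) +
    (1 / G.τ i) • gradient (fun q => G.D i q (z.π (opp i))) (z.p i : Vec (A (opp i)))

/-- `(m, l)`-strong monotonicity of the gradient operator of the four-player game with payoffs `R`,
where `l i` weighs the blocks of player `i` and of its adversary. -/
def Risk.StronglyMonotone (G : Risk A) (m : ℝ) (l : Fin 2 → ℝ)
    (R : Fin 2 → (∀ j, A j) → ℝ) : Prop :=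
  ∀ z w : Profile A, m * z.sqDist w ≤
    ∑ i, l i * (inner ℝ ((z.π i : Vec (A i)) - w.π i) (G.Fπ R z i - G.Fπ R w i) +
      inner ℝ ((z.p i : Vec (A (opp i))) - w.p i) (G.Fp R z i - G.Fp R w i))

end NormalForm

/-! ### Markov games -/

/-- A discounted two-player general-sum Markov game. -/
structure MarkovGame (S : Type u) (A : Fin 2 → Type v) where
  r : Fin 2 → S → (∀ j, A j) → ℝ
  r_mem : ∀ i s a, r i s a ∈ Set.Icc (0 : ℝ) 1
  γ : ℝ
  γ_nonneg : 0 ≤ γ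
  γ_lt_one : γ < 1
  P : S → (∀ j, A j) → PMF S
  ρ₀ : PMF S

/-- Pairs of `Q` functions. On this type `‖·‖` is the max-norm. -/
abbrev QFun (S : Type u) (A : Fin 2 → Type v) : Type (max u v) := Fin 2 → S → (∀ j, A j) → ℝ

/-- Product Markov policies of the two players. -/
abbrev Policy (S : Type u) (A : Fin 2 → Type v) [∀ i, Fintype (A i)] : Type (max u v) :=
  S → Mixed A

section Markov

variable {S : Type u} [Fintype S] [DecidableEq S]
  {A : Fin 2 → Type v} [∀ i, Fintype (A i)] [∀ i, DecidableEq (A i)]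

/-- The transition matrix on states when joint action `a` is taken at `s` with probability
`k s a`. -/
def MarkovGame.trans (M : MarkovGame S A) (k : S → (∀ j, A j) → ℝ) : Matrix S S ℝ :=
  fun s s' => ∑ a, k s a * (M.P s a s').toReal

/-- The stage game at state `s` for given `Q` functions: payoffs `-Q(s, ·)`. -/
def stage (Q : QFun S A) (s : S) : Fin 2 → (∀ j, A j) → ℝ := fun i a => -Q i s a

/-- The risk-averse quantal-response Bellman optimality operator. -/
def MarkovGame.bellman (M : MarkovGame S A) (G : Risk A) (Q : QFun S A) : QFun S A :=
  fun i s a => -M.r i s a + M.γ * ∑ s', (M.P s a s').toReal * G.rqe (stage Q s') i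

/-- The value function `V_i^{π,p}(s)`: the expected discounted sum of
`-r_i - D_i / τ_i + ε_i ν_i` from `s`, where `a_i ∼ x` and `a_{-i} ∼ q`, and `y` is the actual
policy of the opponent. -/
def MarkovGame.V (M : MarkovGame S A) (G : Risk A) (i : Fin 2) (x : S → simplex (A i))
    (y q : S → simplex (A (opp i))) (s : S) : ℝ :=
  ∑' t : ℕ, M.γ ^ t * ∑ s',
    (M.trans (fun s a => (x s : Vec (A i)) (a i) * (q s : Vec (A (opp i))) (a (opp i))) ^ t) s s' *
      G.J i (x s') (y s') (q s') (M.r i s')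

/-- Nash equilibria of the four-player Markov game: player `i` minimizes and its adversary maximizes
`V_i` from every state. -/
def MarkovGame.IsNash (M : MarkovGame S A) (G : Risk A) (z : S → Profile A) : Prop :=
  ∀ i s,
    (∀ x' : S → simplex (A i),
      M.V G i (fun s => (z s).π i) (fun s => (z s).π (opp i)) (fun s => (z s).p i) s ≤
        M.V G i x' (fun s => (z s).π (opp i)) (fun s => (z s).p i) s) ∧
    (∀ q' : S → simplex (A (opp i)),
      M.V G i (fun s => (z s).π i) (fun s => (z s).π (opp i)) q' s ≤
        M.V G i (fun s => (z s).π i) (fun s => (z s).π (opp i)) (fun s => (z s).p i) s)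

/-- The risk-adjusted objective `f_i(π_i, π_{-i}; s)` of the Markov game. -/
def MarkovGame.f (M : MarkovGame S A) (G : Risk A) (i : Fin 2) (x : S → simplex (A i))
    (y : S → simplex (A (opp i))) (s : S) : ℝ :=
  ⨆ q : S → simplex (A (opp i)), M.V G i x y q s

/-- Stationary Markov RQE. -/
def MarkovGame.IsRQE (M : MarkovGame S A) (G : Risk A) (x : Policy S A) : Prop :=
  ∀ i s, ∀ x' : S → simplex (A i),
    M.f G i (fun s => x s i) (fun s => x s (opp i)) s ≤ M.f G i x' (fun s => x s (opp i)) s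

/-- Probability of the joint action `a` at state `s` under a product Markov policy. -/
def actProb (x : Policy S A) (s : S) (a : ∀ j, A j) : ℝ := ∏ i, (x s i : Vec (A i)) (a i)

/-- Uniform geometric ergodicity: for every product Markov policy there is a state distribution `d`,
bounded below by `low`, to which the chain converges in total variation at the rate `C * ρ ^ t`.
(For `0 < low` and `ρ < 1` this makes the chain irreducible and `d` its only stationary law.) -/
def MarkovGame.Ergodic (M : MarkovGame S A) (low C ρ : ℝ) : Prop :=
  ∀ x : Policy S A, ∃ d : S → ℝ, (∀ s, low ≤ d s) ∧ ∑ s, d s = 1 ∧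
    ∀ (t : ℕ) (s : S), (1 / 2) * ∑ s', |(M.trans (actProb x) ^ t) s s' - d s'| ≤ C * ρ ^ t

/-! ### The algorithm: multi-agent risk-averse actor-critic -/

/-- How transitions are sampled: with the current policies or with a fixed behavior policy. -/
inductive Sampling (S : Type u) (A : Fin 2 → Type v) [∀ i, Fintype (A i)] where
  | onPolicy : Sampling S A
  | offPolicy (b : Policy S A) : Sampling S A

/-- The policy used for sampling when the current profile is `z`. -/
def Sampling.policy (m : Sampling S A) (z : S → Profile A) : Policy S A :=
  match m with
  | .onPolicy => fun s => (z s).π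
  | .offPolicy b => b

/-- The state of the algorithm at the start of an episode. -/
structure AlgState (S : Type u) (A : Fin 2 → Type v) [∀ i, Fintype (A i)] where
  env : S
  z : S → Profile A
  Q : QFun S A

/-- Actor and adversary update: one projected preconditioned gradient step at every state. -/
def Risk.actor [∀ i, Nonempty (A i)] (G : Risk A) (l : Fin 2 → ℝ) (β : ℝ) (z : S → Profile A)
    (Q : QFun S A) (s : S) : Profile A where
  π i := proj ((z s).π i - (β * l i) • G.Fπ (stage Q s) (z s) i)
  p i := proj ((z s).p i - (β * l i) • G.Fp (stage Q s) (z s) i)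

/-- The law of `n` successive transitions `(s_k, a_k, s_{k+1})` from state `s` under the policy `x`,
together with the final state. -/
def MarkovGame.rollout (M : MarkovGame S A) (x : Policy S A) :
    (n : ℕ) → S → PMF ((Fin n → S × (∀ j, A j) × S) × S)
  | 0, s => PMF.pure (Fin.elim0, s)
  | n + 1, s => (jointLaw (x s)).bind fun a => (M.P s a).bind fun s' =>
      (M.rollout x n s').map fun w => (Fin.cons (s, a, s') w.1, w.2)

/-- The target `q̂_i` built from a transition `(s, a, s')`, the new profile `z` and the
current `Q`. -/
def MarkovGame.target (M : MarkovGame S A) (G : Risk A) (z : S → Profile A) (Q : QFun S A)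
    (i : Fin 2) (w : S × (∀ j, A j) × S) : ℝ :=
  -M.r i w.1 w.2.1 + M.γ *
    (bilin i (Q i w.2.2) ((z w.2.2).π i) ((z w.2.2).p i)
      - (G.D i ((z w.2.2).p i) ((z w.2.2).π (opp i)) / G.τ i
        - G.ε i * G.ν i ((z w.2.2).π i)))

/-- The averaged temporal-difference update `δ̂_i(s, a)` from `K` transitions. -/
def MarkovGame.delta (M : MarkovGame S A) (G : Risk A) (z : S → Profile A) (Q : QFun S A) {K : ℕ}
    (w : Fin K → S × (∀ j, A j) × S) : QFun S A :=
  fun i s a => (1 / (K : ℝ)) * ∑ k,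
    if (w k).1 = s ∧ (w k).2.1 = a then M.target G z Q i (w k) - Q i s a else 0

/-- One episode: actor and adversary update, `K` sampled transitions, critic update. On-policy
sampling uses the policies held at the start of the episode. -/
def MarkovGame.episode [∀ i, Nonempty (A i)] (M : MarkovGame S A) (G : Risk A) (l : Fin 2 → ℝ)
    (K : ℕ) (m : Sampling S A) (α β : ℝ) (x : AlgState S A) : PMF (AlgState S A) :=
  (M.rollout (m.policy x.z) K x.env).map fun w =>
    { env := w.2
      z := G.actor l β x.z x.Q
      Q := x.Q + α • M.delta G (G.actor l β x.z x.Q) x.Q w.1 }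

/-- The law of the state of the algorithm after `t` episodes with step sizes `α`, `β`. -/
def MarkovGame.algLaw [∀ i, Nonempty (A i)] (M : MarkovGame S A) (G : Risk A) (l : Fin 2 → ℝ)
    (K : ℕ) (m : Sampling S A) (α β : ℕ → ℝ) : ℕ → PMF (AlgState S A)
  | 0 => M.ρ₀.map fun s =>
      { env := s, z := fun _ => { π := fun i => uniform (A i), p := fun i => uniform (A (opp i)) },
        Q := 0 }
  | t + 1 => (M.algLaw G l K m α β t).bind fun x => M.episode G l K m (α t) (β t) x

/-- Almost surely, all policies used for sampling give every joint action at least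
probability `low`. -/
def MarkovGame.SamplingBoundedBelow [∀ i, Nonempty (A i)] (M : MarkovGame S A) (G : Risk A)
    (l : Fin 2 → ℝ) (K : ℕ) (m : Sampling S A) (α β : ℕ → ℝ) (low : ℝ) : Prop :=
  ∀ t, ∀ x ∈ (M.algLaw G l K m α β t).support, ∀ s a, low ≤ actProb (m.policy x.z) s a

end Markov

/-- The expectation of a nonnegative function under a discrete law. -/
def expect {X : Type u} (q : PMF X) (g : X → ℝ≥0∞) : ℝ≥0∞ := ∑' x, q x * g x

/-- The mean squared error `𝔼 ‖z_t(·|s) - z*(·|s)‖²` of the algorithm after `t` episodes. -/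
def MarkovGame.mse {S : Type u} [Fintype S] [DecidableEq S] {A : Fin 2 → Type v}
    [∀ i, Fintype (A i)] [∀ i, DecidableEq (A i)] [∀ i, Nonempty (A i)]
    (M : MarkovGame S A) (G : Risk A) (l : Fin 2 → ℝ) (K : ℕ) (m : Sampling S A) (α β : ℕ → ℝ)
    (zstar : S → Profile A) (t : ℕ) (s : S) : ℝ≥0∞ :=
  expect (M.algLaw G l K m α β t) fun x => ENNReal.ofReal ((x.z s).sqDist (zstar s))

/-- Step sizes with `0 < α_t ≤ κ β_t` and `β_t ≤ b` for all `t`: for small `κ` and `b`, the regime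
`α_t ≪ β_t ≪ 1`. -/
def StepSizes (κ b : ℝ) (α β : ℕ → ℝ) : Prop :=
  ∀ t, 0 < α t ∧ α t ≤ κ * β t ∧ β t ≤ b

end RiskGame

end

/-!
The proof rests on four ideas.

*The equilibrium.* Improving a Markov strategy at one state improves its discounted value there
(`discounted_lt`), so at every state `z*` is an equilibrium of the stage game whose payoffs are
minus the Q-function `Q*` of `z*` (`MarkovGame.IsNash.isEq`). Equilibria are described by the
first-order variational inequality `Risk.IsEq`. Strong monotonicity makes its solution unique and
a Lipschitz function of the payoffs (`Risk.IsEq.norm_emb_sub_le`); it also makes each `J_i` convex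
in the strategy of the player and strongly concave in that of the adversary, so that solutions of
the inequality are risk-averse quantal response equilibria. Conversely, the best response of the
adversary is Lipschitz, so it may be held fixed in the first-order condition of the player, and
every such equilibrium comes from a solution (`Risk.IsRQE.exists_isEq`). It is therefore unique,
with value `Risk.IsEq.rqe_eq`, and `Q*` is the fixed point of the Bellman operator
(`MarkovGame.IsNash.bellman_eq`).

*The noise of the critic.* The trajectory of an episode starts where the previous one ended, so it
is far from stationary, but this does no harm: given the past, the expected update of the critic
at a pair is its expected visit frequency times the exact one-step lookahead error
(`MarkovGame.fmean_delta`), and ergodicity with the bound on `K` keeps these frequencies above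
`3 / 5` of the product of the two lower bounds (`MarkovGame.Ergodic.le_visitFreq`). The remaining
noise is centred. Let `N` be its sum, discounted by `N ↦ (1 - α) N + α ξ`. Its second moment
satisfies `E |N'|² ≤ (1 - α) E |N|² + O(α²)` (`fmean_sumSq_le`), and `Q - N` follows a recursion
without noise (`MarkovGame.noisyNext_sub`), in which `N` enters only as a perturbation. This makes
it possible to work throughout in the max-norm, in which the Bellman operator contracts.

*Two time scales.* One step of the actor contracts towards the stage equilibria of `Q - N`
(`norm_actor_sub_sq_le`), and these move by `O(α)` only. Let `e` be the max-norm distance from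
`Q - N` to `Q*` and `ζ` the distance of the actor from those equilibria. If `α ≤ κ β`, then for
suitable `a` and `D` the Lyapunov function `e² + a (α / β) ζ² + D |N|²` contracts in expectation
by the factor `1 - (1 - γ₀) / 2 * d * α`, with `d` the product of the two lower bounds, up to an
error `O(α²)` (`exists_lyapunov_step`, `MarkovGame.exists_episode_bounds`). The weight `α / β` is
needed because `N` enters `ζ²` at rate `β` but decays at rate `α`.

*The rates.* The weighted function does not control `ζ²` uniformly in `α / β`, but `ζ²` satisfies
a recursion of its own, driven by `e² + |N|²` at rate `β`, and so is dominated by a constant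
multiple of the same bound (`MarkovGame.exists_mse_le`). For constant steps the scalar recursion
is solved explicitly; for steps `α / (t + h)` it decays like `(t + h) ^ (-r)` with `r < 1`,
because the errors `O((t + h)⁻²)` are summable after division by that rate
(`exists_dominating_sequence`).
-/

/-! ### First-order conditions on convex sets -/

namespace RiskGame

universe u v

section FirstOrder

variable {E : Type v} [NormedAddCommGroup E] [InnerProductSpace ℝ E] [CompleteSpace E]
  {C : Set E} {g : E → ℝ} {x y : E}

theorem hasDerivAt_comp_segment {G : E} (x y : E) (t : ℝ)
    (hg : HasGradientAt g G (x + t • (y - x))) :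
    HasDerivAt (fun t : ℝ => g (x + t • (y - x))) (inner ℝ G (y - x)) t := by
  have h1 : HasDerivAt (fun t : ℝ => x + t • (y - x)) (y - x) t := by
    simpa using ((hasDerivAt_id t).smul_const (y - x)).const_add x
  have h2 := hg.hasFDerivAt.comp_hasDerivAt t h1
  exact HasDerivAt.congr_deriv h2 (by simp)

theorem inner_gradient_nonneg {G : E} (hC : Convex ℝ C) (hg : HasGradientAt g G x) (hx : x ∈ C)
    (hmin : ∀ y ∈ C, g x ≤ g y) (hy : y ∈ C) : 0 ≤ inner ℝ G (y - x) := by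
  have h : IsLocalMinOn g C x := Filter.eventually_of_mem self_mem_nhdsWithin hmin
  have h2 := h.hasFDerivWithinAt_nonneg hg.hasFDerivAt.hasFDerivWithinAt
    (sub_mem_posTangentConeAt_of_segment_subset (hC.segment_subset hx hy))
  simpa using h2

/-- A function with monotone gradient on a convex set is convex there, so that first-order
stationary points are minimizers. -/
theorem le_of_inner_gradient_nonneg {g' : E → E} (hC : Convex ℝ C)
    (hg : ∀ x ∈ C, HasGradientAt g (g' x) x)
    (hm : ∀ x ∈ C, ∀ y ∈ C, 0 ≤ inner ℝ (x - y) (g' x - g' y)) (hx : x ∈ C) (hy : y ∈ C)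
    (h : 0 ≤ inner ℝ (g' x) (y - x)) : g x ≤ g y := by
  have hd : ∀ t ∈ Set.Icc (0 : ℝ) 1, HasDerivAt (fun t : ℝ => g (x + t • (y - x)))
      (inner ℝ (g' (x + t • (y - x))) (y - x)) t := fun t ht =>
    hasDerivAt_comp_segment x y t (hg _ (hC.add_smul_sub_mem hx hy ht))
  obtain ⟨c, hc, hc'⟩ := exists_hasDerivAt_eq_slope (fun t : ℝ => g (x + t • (y - x)))
    (fun t => inner ℝ (g' (x + t • (y - x))) (y - x)) zero_lt_one
    (fun t ht => (hd t ht).continuousAt.continuousWithinAt)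
    (fun t ht => hd t (Set.Ioo_subset_Icc_self ht))
  have h1 := hm _ (hC.add_smul_sub_mem hx hy (Set.Ioo_subset_Icc_self hc)) x hx
  rw [add_sub_cancel_left, real_inner_smul_left, real_inner_comm, inner_sub_left] at h1
  have h2 := nonneg_of_mul_nonneg_right h1 hc.1
  simp at hc'
  linarith

theorem SmoothOn.hasGradientAt {L : ℝ} (h : SmoothOn L g C) (hx : x ∈ C) :
    HasGradientAt g (gradient g x) x := (h.1 x hx).hasGradientAt

theorem SmoothOn.continuousOn {L : ℝ} (h : SmoothOn L g C) : ContinuousOn g C :=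
  fun x hx => (h.1 x hx).continuousAt.continuousWithinAt

/-- A smooth function is Lipschitz on a bounded convex set. -/
theorem SmoothOn.exists_lipschitz {L : ℝ} (hL : 0 ≤ L) (h : SmoothOn L g C) (hC : Convex ℝ C)
    (hb : Bornology.IsBounded C) :
    ∃ c : ℝ, 0 ≤ c ∧ ∀ x ∈ C, ∀ y ∈ C, |g x - g y| ≤ c * ‖x - y‖ := by
  rcases C.eq_empty_or_nonempty with rfl | ⟨x₀, hx₀⟩
  · exact ⟨0, le_rfl, by simp⟩
  obtain ⟨R, hR⟩ := hb.exists_norm_le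
  have hR0 : 0 ≤ R := (norm_nonneg _).trans (hR x₀ hx₀)
  refine ⟨‖gradient g x₀‖ + L * (R + R), by positivity, fun x hx y hy => ?_⟩
  have key := hC.norm_image_sub_le_of_norm_hasFDerivWithin_le (f := g)
    (f' := fun x => InnerProductSpace.toDual ℝ E (gradient g x))
    (C := ‖gradient g x₀‖ + L * (R + R))
    (fun z hz => (h.hasGradientAt hz).hasFDerivAt.hasFDerivWithinAt) (fun z hz => ?_) hy hx
  · simpa using key
  · rw [LinearIsometryEquiv.norm_map]
    have h1 := h.2 z hz x₀ hx₀
    have h2 : ‖z - x₀‖ ≤ R + R := (norm_sub_le _ _).trans (add_le_add (hR z hz) (hR x₀ hx₀))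
    have h3 := norm_sub_norm_le (gradient g z) (gradient g x₀)
    nlinarith

end FirstOrder

/-! ### The simplex and the projection -/

section Simplex

variable {X : Type v} [Fintype X]

theorem convex_simplex : Convex ℝ (simplex X) := by
  rintro x ⟨hx, hx1⟩ y ⟨hy, hy1⟩ a b ha hb hab
  refine ⟨fun i => ?_, ?_⟩
  · have := mul_nonneg ha (hx i)
    have := mul_nonneg hb (hy i)
    simp; linarith
  · simp [Finset.sum_add_distrib, ← Finset.mul_sum, hx1, hy1, hab]

theorem simplex_apply_le_one {x : Vec X} (hx : x ∈ simplex X) (a : X) : x a ≤ 1 :=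
  hx.2 ▸ Finset.single_le_sum (f := fun a => x a) (fun i _ => hx.1 i) (Finset.mem_univ a)

theorem norm_le_one_of_mem_simplex {x : Vec X} (hx : x ∈ simplex X) : ‖x‖ ≤ 1 := by
  rw [← sq_le_one_iff₀ (norm_nonneg _), EuclideanSpace.norm_sq_eq, ← hx.2]
  refine Finset.sum_le_sum fun a _ => ?_
  rw [Real.norm_eq_abs, sq_abs, sq]
  exact mul_le_of_le_one_left (hx.1 a) (simplex_apply_le_one hx a)

theorem isBounded_simplex : Bornology.IsBounded (simplex X) :=
  isBounded_iff_forall_norm_le.2 ⟨1, fun _ hx => norm_le_one_of_mem_simplex hx⟩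

theorem isCompact_simplex : IsCompact (simplex X) :=
  Metric.isCompact_of_isClosed_isBounded (isClosed_simplex X) isBounded_simplex

instance [Nonempty X] : Nonempty (simplex X) := ⟨uniform X⟩

theorem norm_le_sum_abs (x : Vec X) : ‖x‖ ≤ ∑ a, |x a| := by
  classical
  conv_lhs => rw [← (EuclideanSpace.basisFun X ℝ).sum_repr x]
  refine (norm_sum_le _ _).trans (Finset.sum_le_sum fun a _ => ?_)
  simp [norm_smul]

theorem abs_apply_le_norm (x : Vec X) (a : X) : |x a| ≤ ‖x‖ := by
  simpa using PiLp.norm_apply_le x a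

variable [Nonempty X]

theorem norm_sub_proj_le (x : Vec X) (w : simplex X) : ‖x - proj x‖ ≤ ‖x - w‖ :=
  Classical.choose_spec (exists_nearest X x) w

theorem inner_sub_proj_le_zero (x : Vec X) (w : simplex X) :
    inner ℝ (x - proj x) ((w : Vec X) - proj x) ≤ 0 := by
  refine (norm_eq_iInf_iff_real_inner_le_zero convex_simplex (proj x).2).1 ?_ w w.2
  refine le_antisymm (le_ciInf fun w => norm_sub_proj_le x w) ?_
  exact ciInf_le ⟨0, by rintro _ ⟨w, rfl⟩; exact norm_nonneg _⟩ (proj x)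

/-- The projection is nonexpansive. -/
theorem norm_proj_sub_proj_le (x y : Vec X) : ‖(proj x : Vec X) - proj y‖ ≤ ‖x - y‖ := by
  have h1 := inner_sub_proj_le_zero x (proj y)
  have h2 := inner_sub_proj_le_zero y (proj x)
  set a : Vec X := (proj x : Vec X)
  set b : Vec X := (proj y : Vec X)
  have h3 : ‖a - b‖ ^ 2 ≤ inner ℝ (x - y) (a - b) := by
    rw [← real_inner_self_eq_norm_sq]
    have : inner ℝ (x - a) (b - a) + inner ℝ (y - b) (a - b)
        = inner ℝ (a - b) (a - b) - inner ℝ (x - y) (a - b) := by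
      simp only [inner_sub_left, inner_sub_right]; ring
    linarith
  have h4 := real_inner_le_norm (x - y) (a - b)
  by_contra hlt
  push Not at hlt
  nlinarith [norm_nonneg (x - y)]

/-- If `x = proj (x - c G)` then `G` satisfies the variational inequality at `x`. -/
theorem inner_nonneg_of_proj_eq {x : simplex X} {G : Vec X} {c : ℝ} (hc : 0 < c)
    (h : proj ((x : Vec X) - c • G) = x) (w : simplex X) : 0 ≤ inner ℝ G ((w : Vec X) - x) := by
  have h1 := inner_sub_proj_le_zero ((x : Vec X) - c • G) w
  rw [h, sub_sub_cancel_left, inner_neg_left, real_inner_smul_left] at h1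
  by_contra hlt
  push Not at hlt
  nlinarith

theorem proj_eq_of_inner_nonneg {x : simplex X} {G : Vec X} {c : ℝ} (hc : 0 ≤ c)
    (h : ∀ w : simplex X, 0 ≤ inner ℝ G ((w : Vec X) - x)) : proj ((x : Vec X) - c • G) = x := by
  have h1 := inner_sub_proj_le_zero ((x : Vec X) - c • G) x
  have h2 := mul_nonneg hc (h (proj ((x : Vec X) - c • G)))
  set a : Vec X := (proj ((x : Vec X) - c • G) : Vec X) with ha
  have h3 : ‖(x : Vec X) - a‖ ^ 2 ≤ 0 := by
    rw [← real_inner_self_eq_norm_sq]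
    have e : inner ℝ ((x : Vec X) - c • G - a) ((x : Vec X) - a)
        = inner ℝ ((x : Vec X) - a) ((x : Vec X) - a) + c * inner ℝ G (a - x) := by
      simp only [inner_sub_left, inner_sub_right, real_inner_smul_left]; ring
    linarith
  have h4 : (x : Vec X) - a = 0 := by
    rw [← norm_eq_zero]; nlinarith [norm_nonneg ((x : Vec X) - a)]
  exact Subtype.ext (sub_eq_zero.1 h4).symm

end Simplex

end RiskGame

/-! ### The gradient operator on the Euclidean space of profiles -/

namespace RiskGame

universe u v

section Embedding

variable {A : Fin 2 → Type v} [∀ i, Fintype (A i)]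

/-- The Euclidean space in which the strategy profiles at one state live: one block for each player
and one for its adversary. -/
abbrev PVec (A : Fin 2 → Type v) [∀ i, Fintype (A i)] : Type v :=
  PiLp 2 fun i : Fin 2 => WithLp 2 (Vec (A i) × Vec (A (opp i)))

/-- A profile as a point of Euclidean space. -/
def Profile.emb (z : Profile A) : PVec A :=
  WithLp.toLp 2 fun i => WithLp.toLp 2 ((z.π i : Vec (A i)), (z.p i : Vec (A (opp i))))

theorem PVec.norm_sq (u : PVec A) : ‖u‖ ^ 2 = ∑ i, (‖(u i).fst‖ ^ 2 + ‖(u i).snd‖ ^ 2) := by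
  rw [PiLp.norm_sq_eq_of_L2]
  exact Finset.sum_congr rfl fun i _ => WithLp.prod_norm_sq_eq_of_L2 _

theorem PVec.inner_eq (u w : PVec A) : inner ℝ u w =
    ∑ i, (inner ℝ (u i).fst (w i).fst + inner ℝ (u i).snd (w i).snd) := by
  rw [PiLp.inner_apply]
  exact Finset.sum_congr rfl fun i _ => WithLp.prod_inner_apply _ _

theorem PVec.norm_fst_le (u : PVec A) (i : Fin 2) : ‖(u i).fst‖ ≤ ‖u‖ := by
  have h := PVec.norm_sq u
  have h2 := Finset.single_le_sum (f := fun i => ‖(u i).fst‖ ^ 2 + ‖(u i).snd‖ ^ 2)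
    (fun i _ => by positivity) (Finset.mem_univ i)
  refine abs_le_of_sq_le_sq' ?_ (norm_nonneg _) |>.2
  simp only at h2
  nlinarith [sq_nonneg ‖(u i).snd‖]

theorem PVec.norm_snd_le (u : PVec A) (i : Fin 2) : ‖(u i).snd‖ ≤ ‖u‖ := by
  have h := PVec.norm_sq u
  have h2 := Finset.single_le_sum (f := fun i => ‖(u i).fst‖ ^ 2 + ‖(u i).snd‖ ^ 2)
    (fun i _ => by positivity) (Finset.mem_univ i)
  refine abs_le_of_sq_le_sq' ?_ (norm_nonneg _) |>.2
  simp only at h2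
  nlinarith [sq_nonneg ‖(u i).fst‖]

theorem PVec.norm_le_of_blocks {u : PVec A} {b : ℝ} (hb : 0 ≤ b) (h1 : ∀ i, ‖(u i).fst‖ ≤ b)
    (h2 : ∀ i, ‖(u i).snd‖ ≤ b) : ‖u‖ ≤ 2 * b := by
  refine abs_le_of_sq_le_sq' ?_ (by positivity) |>.2
  rw [PVec.norm_sq, Fin.sum_univ_two]
  nlinarith [pow_le_pow_left₀ (norm_nonneg _) (h1 0) 2, pow_le_pow_left₀ (norm_nonneg _) (h1 1) 2,
    pow_le_pow_left₀ (norm_nonneg _) (h2 0) 2, pow_le_pow_left₀ (norm_nonneg _) (h2 1) 2]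

theorem Profile.sqDist_eq (z w : Profile A) : z.sqDist w = ‖z.emb - w.emb‖ ^ 2 := by
  rw [PVec.norm_sq]; rfl

theorem Profile.norm_π_sub_le (z w : Profile A) (i : Fin 2) :
    ‖(z.π i : Vec (A i)) - w.π i‖ ≤ ‖z.emb - w.emb‖ := PVec.norm_fst_le (z.emb - w.emb) i

theorem Profile.norm_p_sub_le (z w : Profile A) (i : Fin 2) :
    ‖(z.p i : Vec (A (opp i))) - w.p i‖ ≤ ‖z.emb - w.emb‖ := PVec.norm_snd_le (z.emb - w.emb) i

theorem Profile.emb_injective : Function.Injective (Profile.emb (A := A)) := by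
  rintro ⟨π, p⟩ ⟨π', p'⟩ h
  have h1 : π = π' := funext fun i => Subtype.ext (congrArg (fun u : PVec A => (u i).fst) h)
  have h2 : p = p' := funext fun i => Subtype.ext (congrArg (fun u : PVec A => (u i).snd) h)
  rw [h1, h2]

theorem Profile.norm_emb_le (z : Profile A) : ‖z.emb‖ ≤ 2 := by
  have := PVec.norm_le_of_blocks (u := z.emb) zero_le_one
    (fun i => norm_le_one_of_mem_simplex (z.π i).2) (fun i => norm_le_one_of_mem_simplex (z.p i).2)
  linarith

theorem isClosed_range_emb : IsClosed (Set.range (Profile.emb (A := A))) := by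
  have h : Set.range (Profile.emb (A := A)) =
      ⋂ i, {u : PVec A | (u i).fst ∈ simplex (A i)} ∩ {u : PVec A | (u i).snd ∈ simplex _} := by
    ext u
    simp only [Set.mem_range, Set.mem_iInter, Set.mem_inter_iff, Set.mem_ofPred_eq]
    constructor
    · rintro ⟨z, rfl⟩ i
      exact ⟨(z.π i).2, (z.p i).2⟩
    · intro hu
      exact ⟨⟨fun i => ⟨_, (hu i).1⟩, fun i => ⟨_, (hu i).2⟩⟩, rfl⟩
  rw [h]
  refine isClosed_iInter fun i => IsClosed.inter ?_ ?_
  · exact (isClosed_simplex _).preimage (by fun_prop)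
  · exact (isClosed_simplex _).preimage (by fun_prop)

end Embedding

section Operator

variable {A : Fin 2 → Type v} [∀ i, Fintype (A i)]

theorem bilin_sub_left (i : Fin 2) (M N : (∀ j, A j) → ℝ) (x : Vec (A i)) (y : Vec (A (opp i))) :
    bilin i (M - N) x y = bilin i M x y - bilin i N x y := by
  simp only [bilin, ← Finset.sum_sub_distrib, Pi.sub_apply]
  exact Finset.sum_congr rfl fun a _ => by ring

theorem bilin_neg (i : Fin 2) (M : (∀ j, A j) → ℝ) (x : Vec (A i)) (y : Vec (A (opp i))) :
    bilin i (-M) x y = -bilin i M x y := by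
  simp only [bilin, ← Finset.sum_neg_distrib, Pi.neg_apply]
  exact Finset.sum_congr rfl fun a _ => by ring

variable {G : Risk A} {L : ℝ}

/-- The set of pairs of mixed strategies on which the penalty `D i` is smooth. -/
def simplexPairs (X : Type v) [Fintype X] : Set (WithLp 2 (Vec X × Vec X)) :=
  {w | w.fst ∈ simplex X ∧ w.snd ∈ simplex X}

theorem convex_simplexPairs {X : Type v} [Fintype X] : Convex ℝ (simplexPairs X) :=
  fun _ hx _ hy _ _ ha hb hab =>
    ⟨convex_simplex hx.1 hy.1 ha hb hab, convex_simplex hx.2 hy.2 ha hb hab⟩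

theorem isBounded_simplexPairs {X : Type v} [Fintype X] :
    Bornology.IsBounded (simplexPairs X) := by
  refine isBounded_iff_forall_norm_le.2 ⟨2, fun w hw => ?_⟩
  refine abs_le_of_sq_le_sq' ?_ (by norm_num) |>.2
  rw [WithLp.prod_norm_sq_eq_of_L2]
  nlinarith [norm_le_one_of_mem_simplex hw.1, norm_le_one_of_mem_simplex hw.2,
    norm_nonneg w.fst, norm_nonneg w.snd]

theorem Risk.Smooth.hasGradientAt_ν (h : G.Smooth L) (i : Fin 2) {x : Vec (A i)}
    (hx : x ∈ simplex (A i)) : HasGradientAt (G.ν i) (gradient (G.ν i) x) x :=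
  (h i).1.hasGradientAt hx

/-- The partial gradient is the first block of the joint gradient. -/
theorem hasGradientAt_partial {E : Type v} [NormedAddCommGroup E] [InnerProductSpace ℝ E]
    [CompleteSpace E] {f : WithLp 2 (E × E) → ℝ} {x y : E} {g : WithLp 2 (E × E)}
    (h : HasGradientAt f g (WithLp.toLp 2 (x, y))) :
    HasGradientAt (fun q => f (WithLp.toLp 2 (q, y))) g.fst x := by
  have h1 : HasFDerivAt (fun q : E => (WithLp.toLp 2 (q, y) : WithLp 2 (E × E)))
      ((WithLp.prodContinuousLinearEquiv 2 ℝ E E).symm.toContinuousLinearMap.comp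
        (ContinuousLinearMap.inl ℝ E E)) x :=
    (WithLp.prodContinuousLinearEquiv 2 ℝ E E).symm.toContinuousLinearMap.hasFDerivAt.comp x
      (hasFDerivAt_prodMk_left x y)
  have h2 := h.hasFDerivAt.comp x h1
  rw [hasGradientAt_iff_hasFDerivAt]
  refine h2.congr_fderiv ?_
  ext v
  simp [WithLp.prod_inner_apply]

theorem Risk.Smooth.gradient_D (h : G.Smooth L) (i : Fin 2) {q y : Vec (A (opp i))}
    (hq : q ∈ simplex (A (opp i))) (hy : y ∈ simplex (A (opp i))) :
    HasGradientAt (fun q => G.D i q y) (gradient (fun w : WithLp 2 (Vec (A (opp i)) × Vec _) =>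
      G.D i w.fst w.snd) (WithLp.toLp 2 (q, y))).fst q :=
  hasGradientAt_partial (f := fun w => G.D i w.fst w.snd)
    ((h i).2.hasGradientAt (x := WithLp.toLp 2 (q, y)) ⟨hq, hy⟩)

theorem Risk.Smooth.hasGradientAt_D (h : G.Smooth L) (i : Fin 2) {q y : Vec (A (opp i))}
    (hq : q ∈ simplex (A (opp i))) (hy : y ∈ simplex (A (opp i))) :
    HasGradientAt (fun q => G.D i q y) (gradient (fun q => G.D i q y) q) q :=
  (h.gradient_D i hq hy).differentiableAt.hasGradientAt

theorem norm_toLp_pair_le {E : Type v} [NormedAddCommGroup E] [InnerProductSpace ℝ E] (x y : E) :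
    ‖(WithLp.toLp 2 (x, y) : WithLp 2 (E × E))‖ ≤ ‖x‖ + ‖y‖ := by
  refine abs_le_of_sq_le_sq' ?_ (by positivity) |>.2
  rw [WithLp.prod_norm_sq_eq_of_L2]
  change ‖x‖ ^ 2 + ‖y‖ ^ 2 ≤ _
  nlinarith [norm_nonneg x, norm_nonneg y, mul_nonneg (norm_nonneg x) (norm_nonneg y)]

theorem Risk.Smooth.norm_gradient_D_sub_le (hL : 0 ≤ L) (h : G.Smooth L) (i : Fin 2)
    {q y q' y' : Vec (A (opp i))}
    (hq : q ∈ simplex (A (opp i))) (hy : y ∈ simplex (A (opp i)))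
    (hq' : q' ∈ simplex (A (opp i))) (hy' : y' ∈ simplex (A (opp i))) :
    ‖gradient (fun q => G.D i q y) q - gradient (fun q => G.D i q y') q'‖
      ≤ L * (‖q - q'‖ + ‖y - y'‖) := by
  rw [(h.gradient_D i hq hy).gradient, (h.gradient_D i hq' hy').gradient]
  have h1 := (h i).2.2 (WithLp.toLp 2 (q, y)) ⟨hq, hy⟩ (WithLp.toLp 2 (q', y')) ⟨hq', hy'⟩
  rw [← WithLp.sub_fst]
  refine (WithLp.norm_fst_le _ _).trans (h1.trans ?_)
  exact mul_le_mul_of_nonneg_left (norm_toLp_pair_le (q - q') (y - y')) hL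

variable [∀ i, DecidableEq (A i)]

theorem bilin_eq_inner_mulR (i : Fin 2) (M : (∀ j, A j) → ℝ) (x : Vec (A i)) (y : Vec (A (opp i))) :
    bilin i M x y = inner ℝ (mulR i M y) x := by
  simp only [bilin, mulR, PiLp.inner_apply, RCLike.inner_apply, conj_trivial, Finset.mul_sum]
  rw [Finset.sum_comm]
  refine Finset.sum_congr rfl fun a _ => ?_
  rw [Finset.sum_eq_single (a i) (fun b _ hb => by simp [hb.symm]) (by simp)]
  simp; ring

theorem bilin_eq_inner_mulL (i : Fin 2) (M : (∀ j, A j) → ℝ) (x : Vec (A i)) (y : Vec (A (opp i))) :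
    bilin i M x y = inner ℝ (mulL i M x) y := by
  simp only [bilin, mulL, PiLp.inner_apply, RCLike.inner_apply, conj_trivial, Finset.mul_sum]
  rw [Finset.sum_comm]
  refine Finset.sum_congr rfl fun a _ => ?_
  rw [Finset.sum_eq_single (a (opp i)) (fun b _ hb => by simp [hb.symm]) (by simp)]
  simp; ring

theorem mulR_sub_right (i : Fin 2) (M : (∀ j, A j) → ℝ) (x y : Vec (A (opp i))) :
    mulR i M (x - y) = mulR i M x - mulR i M y := by
  ext b
  simp only [mulR, PiLp.sub_apply, ← Finset.sum_sub_distrib]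
  exact Finset.sum_congr rfl fun a _ => by split_ifs <;> ring

theorem mulL_sub_right (i : Fin 2) (M : (∀ j, A j) → ℝ) (x y : Vec (A i)) :
    mulL i M (x - y) = mulL i M x - mulL i M y := by
  ext b
  simp only [mulL, PiLp.sub_apply, ← Finset.sum_sub_distrib]
  exact Finset.sum_congr rfl fun a _ => by split_ifs <;> ring

theorem mulR_sub_left (i : Fin 2) (M N : (∀ j, A j) → ℝ) (y : Vec (A (opp i))) :
    mulR i (M - N) y = mulR i M y - mulR i N y := by
  ext b
  simp only [mulR, PiLp.sub_apply, ← Finset.sum_sub_distrib, Pi.sub_apply]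
  exact Finset.sum_congr rfl fun a _ => by split_ifs <;> ring

theorem mulL_sub_left (i : Fin 2) (M N : (∀ j, A j) → ℝ) (y : Vec (A i)) :
    mulL i (M - N) y = mulL i M y - mulL i N y := by
  ext b
  simp only [mulL, PiLp.sub_apply, ← Finset.sum_sub_distrib, Pi.sub_apply]
  exact Finset.sum_congr rfl fun a _ => by split_ifs <;> ring

/-- The number of joint actions, used as a crude bound for the norms of matrices. -/
def numActions (A : Fin 2 → Type v) [∀ i, Fintype (A i)] [∀ i, DecidableEq (A i)] : ℝ :=
  Fintype.card (∀ j, A j)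

theorem numActions_nonneg : 0 ≤ numActions A := Nat.cast_nonneg _

theorem norm_mulR_le (i : Fin 2) (M : (∀ j, A j) → ℝ) (y : Vec (A (opp i))) :
    ‖mulR i M y‖ ≤ numActions A * ‖M‖ * ‖y‖ := by
  refine (norm_le_sum_abs _).trans ?_
  calc ∑ b, |mulR i M y b| ≤ ∑ b, ∑ a : (∀ j, A j), if a i = b then ‖M‖ * ‖y‖ else 0 := by
        refine Finset.sum_le_sum fun b _ => (Finset.abs_sum_le_sum_abs _ _).trans ?_
        refine Finset.sum_le_sum fun a _ => ?_
        split_ifs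
        · rw [abs_mul]
          exact mul_le_mul (norm_le_pi_norm M a) (abs_apply_le_norm y _) (abs_nonneg _)
            (norm_nonneg _)
        · simp
    _ = numActions A * ‖M‖ * ‖y‖ := by
        rw [Finset.sum_comm]; simp [numActions, mul_assoc]

theorem norm_mulL_le (i : Fin 2) (M : (∀ j, A j) → ℝ) (x : Vec (A i)) :
    ‖mulL i M x‖ ≤ numActions A * ‖M‖ * ‖x‖ := by
  refine (norm_le_sum_abs _).trans ?_
  calc ∑ b, |mulL i M x b| ≤ ∑ b, ∑ a : (∀ j, A j), if a (opp i) = b then ‖M‖ * ‖x‖ else 0 := by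
        refine Finset.sum_le_sum fun b _ => (Finset.abs_sum_le_sum_abs _ _).trans ?_
        refine Finset.sum_le_sum fun a _ => ?_
        split_ifs
        · rw [abs_mul, mul_comm]
          exact mul_le_mul (norm_le_pi_norm M a) (abs_apply_le_norm x _) (abs_nonneg _)
            (norm_nonneg _)
        · simp
    _ = numActions A * ‖M‖ * ‖x‖ := by
        rw [Finset.sum_comm]; simp [numActions, mul_assoc]

/-- The gradient operator with the blocks of player `i` and its adversary weighted by `l i`. -/
noncomputable def Risk.grad (G : Risk A) (l : Fin 2 → ℝ) (R : Fin 2 → (∀ j, A j) → ℝ)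
    (z : Profile A) : PVec A :=
  WithLp.toLp 2 fun i => WithLp.toLp 2 (l i • G.Fπ R z i, l i • G.Fp R z i)

theorem Risk.StronglyMonotone.le_inner {G : Risk A} {m : ℝ} {l : Fin 2 → ℝ}
    {R : Fin 2 → (∀ j, A j) → ℝ} (h : G.StronglyMonotone m l R) (z w : Profile A) :
    m * ‖z.emb - w.emb‖ ^ 2 ≤ inner ℝ (z.emb - w.emb) (G.grad l R z - G.grad l R w) := by
  rw [← Profile.sqDist_eq, PVec.inner_eq]
  refine (h z w).trans_eq (Finset.sum_congr rfl fun i _ => ?_)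
  change _ = inner ℝ ((z.π i : Vec (A i)) - w.π i) (l i • G.Fπ R z i - l i • G.Fπ R w i) +
    inner ℝ ((z.p i : Vec (A (opp i))) - w.p i) (l i • G.Fp R z i - l i • G.Fp R w i)
  simp only [inner_sub_right, real_inner_smul_right]
  ring

end Operator

end RiskGame

/-! ### Equilibria of the stage games -/

namespace RiskGame

universe u v

section Stage

variable {A : Fin 2 → Type v} [∀ i, Fintype (A i)] [∀ i, DecidableEq (A i)]
  {G : Risk A} {L m : ℝ} {l : Fin 2 → ℝ} {R R' : Fin 2 → (∀ j, A j) → ℝ}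

theorem exists_norm_grad_sub_le (hL : 0 ≤ L) (h : G.Smooth L) (hl : ∀ i, 0 < l i) :
    ∃ c : ℝ, 0 ≤ c ∧ ∀ (R : Fin 2 → (∀ j, A j) → ℝ) (z w : Profile A),
      ‖G.grad l R z - G.grad l R w‖ ≤ c * (1 + ‖R‖) * ‖z.emb - w.emb‖ := by
  have hN := numActions_nonneg (A := A)
  have hε := G.ε_pos
  have hτ := G.τ_pos
  set c : Fin 2 → ℝ := fun i => l i * (numActions A + G.ε i * L + 1 / G.τ i * (2 * L)) with hc
  have hc0 : ∀ i, 0 ≤ c i := fun i => by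
    have := hl i; have := hε i; have := hτ i; positivity
  have hcs : ∀ i, c i ≤ ∑ i, c i := fun i =>
    Finset.single_le_sum (fun i _ => hc0 i) (Finset.mem_univ i)
  have hcs0 : 0 ≤ ∑ i, c i := Finset.sum_nonneg fun i _ => hc0 i
  refine ⟨2 * ∑ i, c i, by positivity, fun R z w => ?_⟩
  set d := ‖z.emb - w.emb‖ with hd
  have hd0 : 0 ≤ d := norm_nonneg _
  have hcd : ∀ i, c i * (1 + ‖R‖) * d ≤ (∑ i, c i) * (1 + ‖R‖) * d := fun i => by
    gcongr; exact hcs i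
  have hR : ∀ i, ‖R i‖ ≤ ‖R‖ := fun i => norm_le_pi_norm R i
  refine (PVec.norm_le_of_blocks (b := (∑ i, c i) * (1 + ‖R‖) * d) (by positivity)
    (fun i => ?_) fun i => ?_).trans_eq (by ring)
  · refine le_trans ?_ (hcd i)
    change ‖l i • G.Fπ R z i - l i • G.Fπ R w i‖ ≤ _
    rw [← smul_sub, norm_smul, Real.norm_of_nonneg (hl i).le]
    have e : G.Fπ R z i - G.Fπ R w i = -mulR i (R i) ((z.p i : Vec (A (opp i))) - w.p i) +
        G.ε i • (gradient (G.ν i) (z.π i : Vec (A i)) - gradient (G.ν i) (w.π i : Vec (A i))) := by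
      rw [mulR_sub_right, smul_sub, Risk.Fπ, Risk.Fπ]; abel
    have h1 := norm_mulR_le i (R i) ((z.p i : Vec (A (opp i))) - w.p i)
    have h2 := (h i).1.2 _ (z.π i).2 _ (w.π i).2
    have h3 : ‖G.Fπ R z i - G.Fπ R w i‖ ≤ numActions A * ‖R‖ * d + G.ε i * (L * d) := by
      rw [e]
      refine (norm_add_le _ _).trans (add_le_add ?_ ?_)
      · rw [norm_neg]
        refine h1.trans ?_
        gcongr
        · exact hR i
        · exact z.norm_p_sub_le w i
      · rw [norm_smul, Real.norm_of_nonneg (hε i).le]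
        refine mul_le_mul_of_nonneg_left (h2.trans ?_) (hε i).le
        gcongr
        exact z.norm_π_sub_le w i
    rw [hc]; simp only [mul_assoc]
    refine mul_le_mul_of_nonneg_left (h3.trans ?_) (hl i).le
    have : 0 ≤ G.ε i * L * ‖R‖ * d := by have := hε i; positivity
    have : 0 ≤ 1 / G.τ i * (2 * L) * (1 + ‖R‖) * d := by have := hτ i; positivity
    have : 0 ≤ numActions A * d := by positivity
    linarith
  · refine le_trans ?_ (hcd i)
    change ‖l i • G.Fp R z i - l i • G.Fp R w i‖ ≤ _
    rw [← smul_sub, norm_smul, Real.norm_of_nonneg (hl i).le]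
    have e : G.Fp R z i - G.Fp R w i = mulL i (R i) ((z.π i : Vec (A i)) - w.π i) +
        (1 / G.τ i) • (gradient (fun q => G.D i q (z.π (opp i))) (z.p i : Vec (A (opp i))) -
          gradient (fun q => G.D i q (w.π (opp i))) (w.p i : Vec (A (opp i)))) := by
      rw [mulL_sub_right, smul_sub, Risk.Fp, Risk.Fp]; abel
    have h1 := norm_mulL_le i (R i) ((z.π i : Vec (A i)) - w.π i)
    have h2 := h.norm_gradient_D_sub_le hL i (z.p i).2 (z.π (opp i)).2 (w.p i).2 (w.π (opp i)).2
    have h3 : ‖G.Fp R z i - G.Fp R w i‖ ≤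
        numActions A * ‖R‖ * d + (1 / G.τ i) * (L * (d + d)) := by
      rw [e]
      refine (norm_add_le _ _).trans (add_le_add ?_ ?_)
      · refine h1.trans ?_
        gcongr
        · exact hR i
        · exact z.norm_π_sub_le w i
      · have hτ' : 0 ≤ 1 / G.τ i := one_div_nonneg.2 (hτ i).le
        rw [norm_smul, Real.norm_of_nonneg hτ']
        refine mul_le_mul_of_nonneg_left (h2.trans ?_) hτ'
        gcongr
        · exact z.norm_p_sub_le w i
        · exact z.norm_π_sub_le w (opp i)
    rw [hc]; simp only [mul_assoc]
    refine mul_le_mul_of_nonneg_left (h3.trans ?_) (hl i).le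
    have : 0 ≤ G.ε i * L * (1 + ‖R‖) * d := by have := hε i; positivity
    have : 0 ≤ 1 / G.τ i * (2 * L) * ‖R‖ * d := by have := hτ i; positivity
    have : 0 ≤ numActions A * d := by positivity
    linarith

theorem exists_norm_grad_sub_payoff_le (G : Risk A) (hl : ∀ i, 0 < l i) :
    ∃ c : ℝ, 0 ≤ c ∧ ∀ (R R' : Fin 2 → (∀ j, A j) → ℝ) (z : Profile A),
      ‖G.grad l R z - G.grad l R' z‖ ≤ c * ‖R - R'‖ := by
  have hN := numActions_nonneg (A := A)
  have hls : ∀ i, l i ≤ ∑ i, l i := fun i =>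
    Finset.single_le_sum (fun i _ => (hl i).le) (Finset.mem_univ i)
  have hls0 : 0 ≤ ∑ i, l i := Finset.sum_nonneg fun i _ => (hl i).le
  refine ⟨2 * ((∑ i, l i) * numActions A), by positivity, fun R R' z => ?_⟩
  have hR : ∀ i, ‖R i - R' i‖ ≤ ‖R - R'‖ := fun i => norm_le_pi_norm (R - R') i
  refine (PVec.norm_le_of_blocks (b := (∑ i, l i) * (numActions A * ‖R - R'‖)) (by positivity)
    (fun i => ?_) fun i => ?_).trans_eq (by ring)
  · change ‖l i • G.Fπ R z i - l i • G.Fπ R' z i‖ ≤ _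
    have e : G.Fπ R z i - G.Fπ R' z i = -mulR i (R i - R' i) (z.p i) := by
      rw [mulR_sub_left, Risk.Fπ, Risk.Fπ]; abel
    rw [← smul_sub, norm_smul, Real.norm_of_nonneg (hl i).le, e, norm_neg]
    refine mul_le_mul (hls i) ((norm_mulR_le _ _ _).trans ?_) (norm_nonneg _) hls0
    have h1 := norm_le_one_of_mem_simplex (z.p i).2
    have h2 := hR i
    calc numActions A * ‖R i - R' i‖ * ‖(z.p i : Vec (A (opp i)))‖
        ≤ numActions A * ‖R - R'‖ * 1 := by gcongr
      _ = _ := mul_one _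
  · change ‖l i • G.Fp R z i - l i • G.Fp R' z i‖ ≤ _
    have e : G.Fp R z i - G.Fp R' z i = mulL i (R i - R' i) (z.π i) := by
      rw [mulL_sub_left, Risk.Fp, Risk.Fp]; abel
    rw [← smul_sub, norm_smul, Real.norm_of_nonneg (hl i).le, e]
    refine mul_le_mul (hls i) ((norm_mulL_le _ _ _).trans ?_) (norm_nonneg _) hls0
    have h1 := norm_le_one_of_mem_simplex (z.π i).2
    have h2 := hR i
    calc numActions A * ‖R i - R' i‖ * ‖(z.π i : Vec (A i))‖
        ≤ numActions A * ‖R - R'‖ * 1 := by gcongr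
      _ = _ := mul_one _

/-- Stage-game equilibria, as solutions of the variational inequality of the gradient operator. -/
def Risk.IsEq (G : Risk A) (R : Fin 2 → (∀ j, A j) → ℝ) (z : Profile A) : Prop :=
  ∀ i, (∀ x : simplex (A i), 0 ≤ inner ℝ (G.Fπ R z i) ((x : Vec (A i)) - z.π i)) ∧
    ∀ q : simplex (A (opp i)), 0 ≤ inner ℝ (G.Fp R z i) ((q : Vec (A (opp i))) - z.p i)

theorem Risk.IsEq.inner_nonneg {z : Profile A} (h : G.IsEq R z) (hl : ∀ i, 0 < l i)
    (w : Profile A) : 0 ≤ inner ℝ (w.emb - z.emb) (G.grad l R z) := by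
  rw [PVec.inner_eq]
  refine Finset.sum_nonneg fun i _ => ?_
  change 0 ≤ inner ℝ ((w.π i : Vec (A i)) - z.π i) (l i • G.Fπ R z i) +
    inner ℝ ((w.p i : Vec (A (opp i))) - z.p i) (l i • G.Fp R z i)
  rw [real_inner_smul_right, real_inner_smul_right, real_inner_comm,
    real_inner_comm (G.Fp R z i)]
  exact add_nonneg (mul_nonneg (hl i).le ((h i).1 _)) (mul_nonneg (hl i).le ((h i).2 _))

/-- Equilibria depend on the payoffs in a Lipschitz way. -/
theorem Risk.IsEq.norm_emb_sub_le (hm : 0 < m) (hl : ∀ i, 0 < l i) {c : ℝ}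
    (hc : ∀ (R R' : Fin 2 → (∀ j, A j) → ℝ) (z : Profile A),
      ‖G.grad l R z - G.grad l R' z‖ ≤ c * ‖R - R'‖)
    (hmono : G.StronglyMonotone m l R) {z w : Profile A} (hz : G.IsEq R z) (hw : G.IsEq R' w) :
    ‖z.emb - w.emb‖ ≤ c / m * ‖R - R'‖ := by
  have h1 := hmono.le_inner z w
  have h2 := hz.inner_nonneg hl w
  have h3 := hw.inner_nonneg hl z
  have h4 := real_inner_le_norm (z.emb - w.emb) (G.grad l R' w - G.grad l R w)
  have h5 := hc R' R w
  rw [norm_sub_rev R'] at h5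
  have h6 : m * ‖z.emb - w.emb‖ ^ 2 ≤ ‖z.emb - w.emb‖ * (c * ‖R - R'‖) := by
    have h7 := mul_le_mul_of_nonneg_left h5 (norm_nonneg (z.emb - w.emb))
    rw [← neg_sub, inner_neg_left] at h2
    simp only [inner_sub_right] at h1 h4
    linarith
  rw [div_mul_eq_mul_div, le_div_iff₀ hm]
  rcases (norm_nonneg (z.emb - w.emb)).eq_or_lt with h0 | h0
  · rw [← h0, zero_mul]
    exact (norm_nonneg _).trans h5
  · refine le_of_mul_le_mul_left ?_ h0
    nlinarith

theorem Risk.IsEq.unique (hm : 0 < m) (hl : ∀ i, 0 < l i)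
    (hmono : G.StronglyMonotone m l R) {z w : Profile A} (hz : G.IsEq R z) (hw : G.IsEq R w) :
    z = w := by
  obtain ⟨c, -, hc⟩ := exists_norm_grad_sub_payoff_le G hl
  have h := hz.norm_emb_sub_le hm hl hc hmono hw
  rw [sub_self, norm_zero, mul_zero] at h
  exact Profile.emb_injective (sub_eq_zero.1 (norm_le_zero_iff.1 h))

section Step

variable [∀ i, Nonempty (A i)]

/-- One projected gradient step in the stage game with payoffs `R`. -/
noncomputable def Risk.step (G : Risk A) (l : Fin 2 → ℝ) (β : ℝ) (R : Fin 2 → (∀ j, A j) → ℝ)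
    (z : Profile A) : Profile A where
  π i := proj ((z.π i : Vec (A i)) - (β * l i) • G.Fπ R z i)
  p i := proj ((z.p i : Vec (A (opp i))) - (β * l i) • G.Fp R z i)

theorem Risk.norm_step_sub_step_le (G : Risk A) (l : Fin 2 → ℝ) (β : ℝ)
    (R R' : Fin 2 → (∀ j, A j) → ℝ) (z w : Profile A) :
    ‖(G.step l β R z).emb - (G.step l β R' w).emb‖ ≤
      ‖(z.emb - w.emb) - β • (G.grad l R z - G.grad l R' w)‖ := by
  refine abs_le_of_sq_le_sq' ?_ (norm_nonneg _) |>.2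
  rw [PVec.norm_sq, PVec.norm_sq]
  refine Finset.sum_le_sum fun i _ => add_le_add ?_ ?_
  · refine pow_le_pow_left₀ (norm_nonneg _) ((norm_proj_sub_proj_le _ _).trans_eq ?_) 2
    change _ = ‖((z.π i : Vec (A i)) - w.π i) - β • (l i • G.Fπ R z i - l i • G.Fπ R' w i)‖
    congr 1
    simp only [smul_sub, smul_smul]; abel
  · refine pow_le_pow_left₀ (norm_nonneg _) ((norm_proj_sub_proj_le _ _).trans_eq ?_) 2
    change _ = ‖((z.p i : Vec (A (opp i))) - w.p i) - β • (l i • G.Fp R z i - l i • G.Fp R' w i)‖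
    congr 1
    simp only [smul_sub, smul_smul]; abel

theorem Risk.IsEq.step_eq (hl : ∀ i, 0 < l i) {β : ℝ} (hβ : 0 ≤ β) {z : Profile A}
    (hz : G.IsEq R z) : G.step l β R z = z := by
  have h1 : (G.step l β R z).π = z.π := funext fun i =>
    proj_eq_of_inner_nonneg (mul_nonneg hβ (hl i).le) (hz i).1
  have h2 : (G.step l β R z).p = z.p := funext fun i =>
    proj_eq_of_inner_nonneg (mul_nonneg hβ (hl i).le) (hz i).2
  exact Profile.emb_injective (by simp only [Profile.emb, h1, h2])

theorem Risk.isEq_of_step_eq (hl : ∀ i, 0 < l i) {β : ℝ} (hβ : 0 < β) {z : Profile A}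
    (hz : G.step l β R z = z) : G.IsEq R z := fun i =>
  ⟨fun w => inner_nonneg_of_proj_eq (mul_pos hβ (hl i)) (congrArg (fun z => z.π i) hz) w,
    fun w => inner_nonneg_of_proj_eq (mul_pos hβ (hl i)) (congrArg (fun z => z.p i) hz) w⟩

/-- A gradient step for a strongly monotone Lipschitz operator contracts, up to a perturbation. -/
theorem norm_sub_smul_sq_le {E : Type v} [NormedAddCommGroup E] [InnerProductSpace ℝ E]
    {a g r : E} {Λ ρ β : ℝ} (hm : 0 < m) (hβ : 0 ≤ β) (h1 : m * ‖a‖ ^ 2 ≤ inner ℝ a g)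
    (h2 : ‖g‖ ≤ Λ * ‖a‖) (h3 : ‖r‖ ≤ ρ) (h4 : 4 * β * Λ ^ 2 ≤ m) :
    ‖a - β • (g + r)‖ ^ 2 ≤ (1 - β * m) * ‖a‖ ^ 2 + β * (2 / m + 2 * β) * ρ ^ 2 := by
  have hρ : 0 ≤ ρ := (norm_nonneg _).trans h3
  have e1 : ‖a - β • (g + r)‖ ^ 2 = ‖a‖ ^ 2 - 2 * β * inner ℝ a g - 2 * β * inner ℝ a r +
      β ^ 2 * ‖g + r‖ ^ 2 := by
    rw [norm_sub_sq_real, real_inner_smul_right, inner_add_right, norm_smul, mul_pow,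
      Real.norm_eq_abs, sq_abs]
    ring
  have e2 : -inner ℝ a r ≤ ‖a‖ * ρ := by
    have := neg_le_of_abs_le (abs_real_inner_le_norm a r)
    nlinarith [mul_le_mul_of_nonneg_left h3 (norm_nonneg a)]
  have e3 : 2 * (‖a‖ * ρ) ≤ m / 2 * ‖a‖ ^ 2 + 2 / m * ρ ^ 2 := by
    have h5 : 0 ≤ (2 / m) * (m / 2 * ‖a‖ - ρ) ^ 2 := by positivity
    have h6 : (2 / m) * (m / 2 * ‖a‖ - ρ) ^ 2 =
        m / 2 * ‖a‖ ^ 2 + 2 / m * ρ ^ 2 - 2 * (‖a‖ * ρ) := by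
      field_simp; ring
    linarith
  have e4 : ‖g + r‖ ^ 2 ≤ 2 * Λ ^ 2 * ‖a‖ ^ 2 + 2 * ρ ^ 2 := by
    have h5 : ‖g + r‖ ≤ Λ * ‖a‖ + ρ := (norm_add_le _ _).trans (add_le_add h2 h3)
    have h6 := pow_le_pow_left₀ (norm_nonneg _) h5 2
    nlinarith [sq_nonneg (Λ * ‖a‖ - ρ)]
  have e5 := mul_le_mul_of_nonneg_left e4 (sq_nonneg β)
  have e6 := mul_le_mul_of_nonneg_left h1 hβ
  have e7 := mul_le_mul_of_nonneg_left e2 hβ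
  have e8 := mul_le_mul_of_nonneg_left e3 hβ
  have e9 := mul_le_mul_of_nonneg_right h4 (mul_nonneg hβ (sq_nonneg ‖a‖))
  rw [e1]
  nlinarith

theorem Risk.StronglyMonotone.norm_step_sub_sq_le {c : ℝ} (hm : 0 < m)
    (hmono : G.StronglyMonotone m l R)
    (hc : ∀ (R : Fin 2 → (∀ j, A j) → ℝ) (z w : Profile A),
      ‖G.grad l R z - G.grad l R w‖ ≤ c * (1 + ‖R‖) * ‖z.emb - w.emb‖) {c' : ℝ}
    (hc' : ∀ (R R' : Fin 2 → (∀ j, A j) → ℝ) (z : Profile A),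
      ‖G.grad l R z - G.grad l R' z‖ ≤ c' * ‖R - R'‖) {β : ℝ} (hβ : 0 ≤ β)
    (h4 : 4 * β * (c * (1 + ‖R‖)) ^ 2 ≤ m) (R' : Fin 2 → (∀ j, A j) → ℝ) (z w : Profile A) :
    ‖(G.step l β R z).emb - (G.step l β R' w).emb‖ ^ 2 ≤ (1 - β * m) * ‖z.emb - w.emb‖ ^ 2 +
      β * (2 / m + 2 * β) * (c' * ‖R - R'‖) ^ 2 := by
  have h := norm_sub_smul_sq_le (a := z.emb - w.emb) (g := G.grad l R z - G.grad l R w)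
    (r := G.grad l R w - G.grad l R' w) hm hβ (hmono.le_inner z w) (hc R z w) (hc' R R' w) h4
  refine (pow_le_pow_left₀ (norm_nonneg _) (G.norm_step_sub_step_le l β R R' z w) 2).trans ?_
  rwa [sub_add_sub_cancel] at h

/-- Every stage game has an equilibrium: a small projected gradient step is a contraction. -/
theorem Risk.StronglyMonotone.exists_isEq (hm : 0 < m) (hl : ∀ i, 0 < l i) (hL : 0 ≤ L)
    (hs : G.Smooth L) (hmono : G.StronglyMonotone m l R) : ∃ z, G.IsEq R z := by
  obtain ⟨c, hc0, hc⟩ := exists_norm_grad_sub_le hL hs hl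
  obtain ⟨c', -, hc'⟩ := exists_norm_grad_sub_payoff_le G hl
  set k := 4 * (c * (1 + ‖R‖)) ^ 2 with hk
  have hk0 : 0 ≤ k := by positivity
  set β := min (m / (k + 1)) (1 / (2 * m)) with hβ
  have hβ0 : 0 < β := lt_min (by positivity) (by positivity)
  have hβ1 : β * k ≤ m := by
    have h1 : β * (k + 1) ≤ m := (le_div_iff₀ (by positivity)).1 (min_le_left _ _)
    nlinarith
  have hβ2 : β * m ≤ 1 / 2 := by
    have h1 : β * (2 * m) ≤ 1 := (le_div_iff₀ (by positivity)).1 (min_le_right _ _)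
    linarith
  let _ : MetricSpace (Profile A) := 
    MetricSpace.induced Profile.emb Profile.emb_injective inferInstance
  have hd : ∀ z w : Profile A, dist z w = ‖z.emb - w.emb‖ := fun z w => dist_eq_norm z.emb w.emb
  have hiso : Isometry (Profile.emb (A := A)) := Isometry.of_dist_eq fun z w => rfl
  have : CompleteSpace (Profile A) :=
    hiso.isUniformInducing.completeSpace isClosed_range_emb.isComplete
  have : Nonempty (Profile A) := ⟨⟨fun i => uniform _, fun i => uniform _⟩⟩
  have hcontr : ContractingWith (Real.toNNReal (Real.sqrt (1 - β * m))) (G.step l β R) := by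
    constructor
    · rw [← NNReal.coe_lt_coe, Real.coe_toNNReal _ (Real.sqrt_nonneg _), NNReal.coe_one,
        Real.sqrt_lt' one_pos]
      nlinarith [mul_pos hβ0 hm]
    · refine LipschitzWith.of_dist_le_mul fun z w => ?_
      rw [Real.coe_toNNReal _ (Real.sqrt_nonneg _), hd, hd]
      refine abs_le_of_sq_le_sq' ?_ (by positivity) |>.2
      rw [mul_pow, Real.sq_sqrt (by linarith)]
      have h := hmono.norm_step_sub_sq_le hm hc hc' hβ0.le (by linarith) R z w
      simpa using h
  exact ⟨_, G.isEq_of_step_eq hl hβ0 hcontr.fixedPoint_isFixedPt⟩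

end Step

end Stage

end RiskGame

/-! ### Costs and risk-averse quantal response equilibria -/

namespace RiskGame

universe u v

section Cost

variable {A : Fin 2 → Type v} [∀ i, Fintype (A i)]

theorem sum_mul_opp_eq [∀ i, DecidableEq (A i)] (i : Fin 2) (f : A i → ℝ) (g : A (opp i) → ℝ) :
    ∑ a : (∀ j, A j), f (a i) * g (a (opp i)) = (∑ b, f b) * ∑ b, g b := by
  have key : ∀ (f : A 0 → ℝ) (g : A 1 → ℝ), ∑ a : (∀ j, A j), f (a 0) * g (a 1) =
      (∑ b, f b) * ∑ b, g b := fun f g => by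
    rw [← (piFinTwoEquiv A).symm.sum_comp, Fintype.sum_prod_type, Finset.sum_mul_sum]
    rfl
  match i with
  | 0 => exact key f g
  | 1 =>
    rw [mul_comm]
    exact (Finset.sum_congr rfl fun a _ => mul_comm _ _).trans (key g f)

theorem Risk.f_eq_of_forall_le {G : Risk A} {i : Fin 2} {x : simplex (A i)}
    {y q : simplex (A (opp i))}
    {M : (∀ j, A j) → ℝ} (h : ∀ q', G.J i x y q' M ≤ G.J i x y q M) :
    G.f i x y M = G.J i x y q M :=
  have : Nonempty (simplex (A (opp i))) := ⟨q⟩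
  le_antisymm (ciSup_le h) (le_ciSup (f := fun q => G.J i x y q M)
    ⟨G.J i x y q M, by rintro _ ⟨q', rfl⟩; exact h q'⟩ q)

/-- The mass of a product law is one, for either order of the two players. -/
theorem sum_mul_opp [∀ i, DecidableEq (A i)] (i : Fin 2) (x : simplex (A i))
    (q : simplex (A (opp i))) :
    ∑ a : (∀ j, A j), (x : Vec (A i)) (a i) * (q : Vec (A (opp i))) (a (opp i)) = 1 := by
  rw [sum_mul_opp_eq i (fun b => (x : Vec (A i)) b) fun b => (q : Vec (A (opp i))) b, x.2.2, q.2.2,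
    mul_one]

variable [∀ i, DecidableEq (A i)]

theorem abs_bilin_le (i : Fin 2) (M : (∀ j, A j) → ℝ) (x : simplex (A i))
    (q : simplex (A (opp i))) :
    |bilin i M x q| ≤ ‖M‖ := by
  refine (Finset.abs_sum_le_sum_abs _ _).trans ?_
  calc ∑ a, |(x : Vec (A i)) (a i) * M a * (q : Vec (A (opp i))) (a (opp i))|
      ≤ ∑ a : (∀ j, A j), (x : Vec (A i)) (a i) * (q : Vec (A (opp i))) (a (opp i)) * ‖M‖ := by
        refine Finset.sum_le_sum fun a _ => ?_
        have h1 := x.2.1 (a i)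
        have h2 := q.2.1 (a (opp i))
        rw [abs_mul, abs_mul, abs_of_nonneg h1, abs_of_nonneg h2, mul_right_comm]
        exact mul_le_mul_of_nonneg_left (norm_le_pi_norm M a) (mul_nonneg h1 h2)
    _ = ‖M‖ := by rw [← Finset.sum_mul, sum_mul_opp, one_mul]

variable {G : Risk A} {L m : ℝ} {l : Fin 2 → ℝ} {R R' : Fin 2 → (∀ j, A j) → ℝ}

/-- The cost `J_i` at a strategy profile. -/
noncomputable def Risk.cost (G : Risk A) (i : Fin 2) (z : Profile A) (M : (∀ j, A j) → ℝ) : ℝ :=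
  G.J i (z.π i) (z.π (opp i)) (z.p i) M

theorem Risk.abs_cost_sub_payoff_le (G : Risk A) (i : Fin 2) (z : Profile A)
    (M N : (∀ j, A j) → ℝ) : |G.cost i z M - G.cost i z N| ≤ ‖M - N‖ := by
  have h := abs_bilin_le i (M - N) (z.π i) (z.p i)
  rw [bilin_sub_left] at h
  have e : G.cost i z M - G.cost i z N =
      -(bilin i M (z.π i) (z.p i) - bilin i N (z.π i) (z.p i)) := by
    simp only [Risk.cost, Risk.J]; ring
  rwa [e, abs_neg]

/-- The regularizing part of the costs is bounded. -/
theorem Risk.Smooth.exists_abs_J_le [∀ i, Nonempty (A i)] (hL : 0 ≤ L) (hs : G.Smooth L) :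
    ∃ c : ℝ, 0 ≤ c ∧ ∀ (i : Fin 2) (x : simplex (A i)) (y q : simplex (A (opp i)))
      (M : (∀ j, A j) → ℝ), |G.J i x y q M| ≤ ‖M‖ + c := by
  have h1 : ∀ i, ∃ c : ℝ, ∀ x ∈ simplex (A i), ‖G.ν i x‖ ≤ c := fun i =>
    isCompact_simplex.exists_bound_of_continuousOn (hs i).1.continuousOn
  have h2 : ∀ i, ∃ c : ℝ, ∀ w ∈ simplexPairs (A (opp i)), |G.D i w.fst w.snd| ≤ c := fun i => by
    obtain ⟨c, -, hc⟩ := (hs i).2.exists_lipschitz hL convex_simplexPairs isBounded_simplexPairs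
    obtain ⟨b, hb⟩ := (isBounded_simplexPairs (X := A (opp i))).exists_norm_le
    have hu := (uniform (A (opp i))).2
    set w₀ : WithLp 2 (Vec (A (opp i)) × Vec (A (opp i))) :=
      WithLp.toLp 2 ((uniform (A (opp i)) : Vec _), (uniform (A (opp i)) : Vec _))
    have hw₀ : w₀ ∈ simplexPairs (A (opp i)) := ⟨hu, hu⟩
    refine ⟨|G.D i w₀.fst w₀.snd| + |c| * (b + b), fun w hw => ?_⟩
    have h3 := hc w hw w₀ hw₀
    have h4 : ‖w - w₀‖ ≤ b + b := (norm_sub_le _ _).trans (add_le_add (hb w hw) (hb w₀ hw₀))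
    have h5 : |G.D i w.fst w.snd - G.D i w₀.fst w₀.snd| ≤ |c| * (b + b) :=
      h3.trans (mul_le_mul (le_abs_self c) h4 (norm_nonneg _) (abs_nonneg _))
    have := abs_sub_abs_le_abs_sub (G.D i w.fst w.snd) (G.D i w₀.fst w₀.snd)
    linarith
  choose c₁ hc₁ using h1
  choose c₂ hc₂ using h2
  have hτ := G.τ_pos
  have hε := G.ε_pos
  have hnn : ∀ i, 0 ≤ |c₂ i| / G.τ i + G.ε i * |c₁ i| := fun i => by
    have := hτ i; have := hε i; positivity
  refine ⟨∑ i, (|c₂ i| / G.τ i + G.ε i * |c₁ i|), Finset.sum_nonneg fun i _ => hnn i,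
    fun i x y q M => ?_⟩
  have h3 := Finset.single_le_sum (fun i _ => hnn i) (Finset.mem_univ i)
  have h4 := abs_bilin_le i M x q
  have h5 := (hc₁ i x x.2).trans (le_abs_self _)
  have h6 := (hc₂ i (WithLp.toLp 2 (q, y)) ⟨q.2, y.2⟩).trans (le_abs_self _)
  have h7 : |G.D i q y / G.τ i| ≤ |c₂ i| / G.τ i := by
    rw [abs_div, abs_of_pos (hτ i)]
    exact div_le_div_of_nonneg_right h6 (hτ i).le
  have h8 : |G.ε i * G.ν i x| ≤ G.ε i * |c₁ i| := by
    rw [abs_mul, abs_of_pos (hε i)]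
    exact mul_le_mul_of_nonneg_left h5 (hε i).le
  rw [Risk.J]
  have h9 := abs_le.1 h4
  have h10 := abs_le.1 h7
  have h11 := abs_le.1 h8
  exact abs_le.2 ⟨by linarith, by linarith⟩

/-- The costs are Lipschitz in the strategy profile. -/
theorem Risk.Smooth.exists_abs_cost_sub_le (hL : 0 ≤ L) (hs : G.Smooth L) :
    ∃ c : ℝ, 0 ≤ c ∧ ∀ (i : Fin 2) (z w : Profile A) (M : (∀ j, A j) → ℝ),
      |G.cost i z M - G.cost i w M| ≤ c * (1 + ‖M‖) * ‖z.emb - w.emb‖ := by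
  have h1 : ∀ i, ∃ c : ℝ, 0 ≤ c ∧ ∀ x ∈ simplex (A i), ∀ y ∈ simplex (A i),
      |G.ν i x - G.ν i y| ≤ c * ‖x - y‖ := fun i =>
    (hs i).1.exists_lipschitz hL convex_simplex isBounded_simplex
  have h2 : ∀ i, ∃ c : ℝ, 0 ≤ c ∧ ∀ w ∈ simplexPairs (A (opp i)), ∀ w' ∈ simplexPairs (A (opp i)),
      |G.D i w.fst w.snd - G.D i w'.fst w'.snd| ≤ c * ‖w - w'‖ := fun i =>
    (hs i).2.exists_lipschitz hL convex_simplexPairs isBounded_simplexPairs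
  choose c₁ hc₁0 hc₁ using h1
  choose c₂ hc₂0 hc₂ using h2
  have hτ := G.τ_pos
  have hε := G.ε_pos
  have hN := numActions_nonneg (A := A)
  have hnn : ∀ i, 0 ≤ c₂ i * 2 / G.τ i + G.ε i * c₁ i := fun i => by
    have := hτ i; have := hε i; have := hc₁0 i; have := hc₂0 i; positivity
  have hS := Finset.sum_nonneg (s := Finset.univ) fun i _ => hnn i
  refine ⟨2 * numActions A + ∑ i, (c₂ i * 2 / G.τ i + G.ε i * c₁ i), by positivity,
    fun i z w M => ?_⟩
  set d := ‖z.emb - w.emb‖ with hd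
  have hd0 : 0 ≤ d := norm_nonneg _
  have h3 := Finset.single_le_sum (fun i _ => hnn i) (Finset.mem_univ i)
  have hπ := z.norm_π_sub_le w i
  have hπ' := z.norm_π_sub_le w (opp i)
  have hp := z.norm_p_sub_le w i
  have h4 : |bilin i M (z.π i) (z.p i) - bilin i M (w.π i) (w.p i)| ≤
      2 * numActions A * ‖M‖ * d := by
    have e : bilin i M (z.π i) (z.p i) - bilin i M (w.π i) (w.p i) =
        inner ℝ (mulR i M ((z.p i : Vec (A (opp i))) - w.p i)) (z.π i : Vec (A i)) +
        inner ℝ (mulL i M ((z.π i : Vec (A i)) - w.π i)) (w.p i : Vec (A (opp i))) := by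
      rw [mulR_sub_right, mulL_sub_right, inner_sub_left, inner_sub_left, ← bilin_eq_inner_mulR,
        ← bilin_eq_inner_mulR, ← bilin_eq_inner_mulL, ← bilin_eq_inner_mulL]
      ring
    have e1 : |inner ℝ (mulR i M ((z.p i : Vec (A (opp i))) - w.p i)) (z.π i : Vec (A i))| ≤
        numActions A * ‖M‖ * d * 1 := by
      refine (abs_real_inner_le_norm _ _).trans ?_
      refine mul_le_mul ((norm_mulR_le _ _ _).trans ?_) (norm_le_one_of_mem_simplex (z.π i).2)
        (norm_nonneg _) (by positivity)
      gcongr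
    have e2 : |inner ℝ (mulL i M ((z.π i : Vec (A i)) - w.π i)) (w.p i : Vec (A (opp i)))| ≤
        numActions A * ‖M‖ * d * 1 := by
      refine (abs_real_inner_le_norm _ _).trans ?_
      refine mul_le_mul ((norm_mulL_le _ _ _).trans ?_) (norm_le_one_of_mem_simplex (w.p i).2)
        (norm_nonneg _) (by positivity)
      gcongr
    rw [e]
    refine (abs_add_le _ _).trans ?_
    linarith
  have h5 : |G.ε i * (G.ν i (z.π i) - G.ν i (w.π i))| ≤ G.ε i * c₁ i * d := by
    rw [abs_mul, abs_of_pos (hε i), mul_assoc]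
    refine mul_le_mul_of_nonneg_left ((hc₁ i _ (z.π i).2 _ (w.π i).2).trans ?_) (hε i).le
    exact mul_le_mul_of_nonneg_left hπ (hc₁0 i)
  have h6 : |(G.D i (z.p i) (z.π (opp i)) - G.D i (w.p i) (w.π (opp i))) / G.τ i| ≤
      c₂ i * 2 / G.τ i * d := by
    rw [abs_div, abs_of_pos (hτ i), div_mul_eq_mul_div, mul_assoc]
    refine div_le_div_of_nonneg_right ?_ (hτ i).le
    refine (hc₂ i (WithLp.toLp 2 (z.p i, z.π (opp i))) ⟨(z.p i).2, (z.π (opp i)).2⟩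
      (WithLp.toLp 2 (w.p i, w.π (opp i))) ⟨(w.p i).2, (w.π (opp i)).2⟩).trans ?_
    refine mul_le_mul_of_nonneg_left ?_ (hc₂0 i)
    refine (norm_toLp_pair_le ((z.p i : Vec (A (opp i))) - w.p i)
      ((z.π (opp i) : Vec (A (opp i))) - w.π (opp i))).trans ?_
    linarith
  have h7 : G.cost i z M - G.cost i w M =
      -(bilin i M (z.π i) (z.p i) - bilin i M (w.π i) (w.p i)) -
      (G.D i (z.p i) (z.π (opp i)) - G.D i (w.p i) (w.π (opp i))) / G.τ i +
      G.ε i * (G.ν i (z.π i) - G.ν i (w.π i)) := by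
    simp only [Risk.cost, Risk.J]; ring
  have h8 : |G.cost i z M - G.cost i w M| ≤
      2 * numActions A * ‖M‖ * d + c₂ i * 2 / G.τ i * d + G.ε i * c₁ i * d := by
    rw [h7]
    have h9 := abs_le.1 h4
    have h10 := abs_le.1 h5
    have h11 := abs_le.1 h6
    exact abs_le.2 ⟨by linarith, by linarith⟩
  have h9 := mul_le_mul_of_nonneg_right h3 hd0
  have h10 : 0 ≤ (∑ i, (c₂ i * 2 / G.τ i + G.ε i * c₁ i)) * ‖M‖ * d := by positivity
  have h11 : 0 ≤ 2 * numActions A * d := by positivity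
  nlinarith

end Cost

section RQE

variable {A : Fin 2 → Type v} [∀ i, Fintype (A i)] [∀ i, DecidableEq (A i)]
  {G : Risk A} {L m : ℝ} {l : Fin 2 → ℝ} {R : Fin 2 → (∀ j, A j) → ℝ}

theorem hasGradientAt_bilin_left (i : Fin 2) (M : (∀ j, A j) → ℝ) (q : Vec (A (opp i)))
    (x : Vec (A i)) : HasGradientAt (fun x => bilin i M x q) (mulR i M q) x := by
  simp only [bilin_eq_inner_mulR]
  exact (InnerProductSpace.toDual ℝ (Vec (A i)) (mulR i M q)).hasFDerivAt

theorem hasGradientAt_bilin_right (i : Fin 2) (M : (∀ j, A j) → ℝ) (x : Vec (A i))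
    (q : Vec (A (opp i))) : HasGradientAt (fun q => bilin i M x q) (mulL i M x) q := by
  simp only [bilin_eq_inner_mulL]
  exact (InnerProductSpace.toDual ℝ (Vec (A (opp i))) (mulL i M x)).hasFDerivAt

theorem Risk.Smooth.hasGradientAt_player (hs : G.Smooth L) (i : Fin 2) (M : (∀ j, A j) → ℝ)
    (q : Vec (A (opp i))) {x : Vec (A i)} (hx : x ∈ simplex (A i)) :
    HasGradientAt (fun x => -bilin i M x q + G.ε i * G.ν i x)
      (-mulR i M q + G.ε i • gradient (G.ν i) x) x := by
  rw [hasGradientAt_iff_hasFDerivAt, map_add, map_neg, map_smul]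
  exact (hasGradientAt_bilin_left i M q x).hasFDerivAt.neg.add
    ((hs.hasGradientAt_ν i hx).hasFDerivAt.const_mul (G.ε i))

theorem Risk.Smooth.hasGradientAt_adversary (hs : G.Smooth L) (i : Fin 2) (M : (∀ j, A j) → ℝ)
    (x : Vec (A i)) {q y : Vec (A (opp i))} (hq : q ∈ simplex (A (opp i)))
    (hy : y ∈ simplex (A (opp i))) :
    HasGradientAt (fun q => bilin i M x q + (1 / G.τ i) * G.D i q y)
      (mulL i M x + (1 / G.τ i) • gradient (fun q => G.D i q y) q) q := by
  rw [hasGradientAt_iff_hasFDerivAt, map_add, map_smul]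
  exact (hasGradientAt_bilin_right i M x q).hasFDerivAt.add
    ((hs.hasGradientAt_D i hq hy).hasFDerivAt.const_mul (1 / G.τ i))

/-- First-order conditions characterize equilibria; this is one half. -/
theorem Risk.isEq_of_forall_le (hs : G.Smooth L) {z : Profile A}
    (h1 : ∀ i, ∀ x, G.cost i z (R i) ≤ G.J i x (z.π (opp i)) (z.p i) (R i))
    (h2 : ∀ i, ∀ q, G.J i (z.π i) (z.π (opp i)) q (R i) ≤ G.cost i z (R i)) : G.IsEq R z := by
  refine fun i => ⟨fun x => ?_, fun q => ?_⟩
  · refine inner_gradient_nonneg convex_simplex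
      (hs.hasGradientAt_player i (R i) (z.p i) (z.π i).2) (z.π i).2 (fun y hy => ?_) x.2
    have := h1 i ⟨y, hy⟩
    simp only [Risk.cost, Risk.J] at this
    linarith
  · refine inner_gradient_nonneg convex_simplex
      (hs.hasGradientAt_adversary i (R i) (z.π i) (z.p i).2 (z.π (opp i)).2) (z.p i).2
      (fun y hy => ?_) q.2
    have := h2 i ⟨y, hy⟩
    simp only [Risk.cost, Risk.J] at this
    simp only [one_div_mul_eq_div]
    linarith

variable [∀ i, Nonempty (A i)]

/-- Strong monotonicity along profiles that differ in the strategy of one player only: the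
bilinear part cancels, so the regularizer is convex on the simplex. -/
theorem Risk.StronglyMonotone.gradient_ν_mono (hm : 0 < m) (hl : ∀ i, 0 < l i)
    (hmono : G.StronglyMonotone m l R) (i : Fin 2) (x x' : simplex (A i)) :
    0 ≤ inner ℝ ((x : Vec (A i)) - x') (gradient (G.ν i) x - gradient (G.ν i) x') := by
  let p : ∀ i, simplex (A (opp i)) := fun i => uniform _
  let π : ∀ i, simplex (A i) := fun i => uniform _
  have h := hmono ⟨Function.update π i x, p⟩ ⟨Function.update π i x', p⟩
  have h0 : 0 ≤ m * Profile.sqDist ⟨Function.update π i x, p⟩ ⟨Function.update π i x', p⟩ := by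
    rw [Profile.sqDist_eq]; positivity
  rw [Finset.sum_eq_single i (fun j _ hj => by simp [Function.update_of_ne hj]) (by simp)] at h
  simp only [sub_self, inner_zero_left, add_zero, Function.update_self, Risk.Fπ] at h
  have e : -mulR i (R i) (p i) + G.ε i • gradient (G.ν i) (x : Vec (A i)) -
      (-mulR i (R i) (p i) + G.ε i • gradient (G.ν i) (x' : Vec (A i))) =
      G.ε i • (gradient (G.ν i) (x : Vec (A i)) - gradient (G.ν i) x') := by
    rw [smul_sub]; abel
  rw [e, real_inner_smul_right] at h
  have h1 := h0.trans h
  exact nonneg_of_mul_nonneg_right (nonneg_of_mul_nonneg_right h1 (hl i)) (G.ε_pos i)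

/-- Strong monotonicity along profiles that differ in the strategy of one adversary only: the
penalty is strongly convex in the strategy of the adversary. -/
theorem Risk.StronglyMonotone.gradient_D_strongMono (hm : 0 < m) (hl : ∀ i, 0 < l i)
    (hmono : G.StronglyMonotone m l R) (i : Fin 2) (y q q' : simplex (A (opp i))) :
    m / l i * ‖(q : Vec (A (opp i))) - q'‖ ^ 2 ≤ inner ℝ ((q : Vec (A (opp i))) - q')
      ((1 / G.τ i) • gradient (fun q => G.D i q y) q -
        (1 / G.τ i) • gradient (fun q => G.D i q y) q') := by
  let p : ∀ i, simplex (A (opp i)) := fun i => uniform _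
  let π : ∀ i, simplex (A i) := Function.update (fun i => uniform _) (opp i) y
  have h := hmono ⟨π, Function.update p i q⟩ ⟨π, Function.update p i q'⟩
  have h0 : m * ‖(q : Vec (A (opp i))) - q'‖ ^ 2 ≤
      m * Profile.sqDist ⟨π, Function.update p i q⟩ ⟨π, Function.update p i q'⟩ := by
    rw [Profile.sqDist_eq]
    refine mul_le_mul_of_nonneg_left (pow_le_pow_left₀ (norm_nonneg _) ?_ 2) hm.le
    simpa using Profile.norm_p_sub_le
      ⟨π, Function.update p i q⟩ ⟨π, Function.update p i q'⟩ i
  rw [Finset.sum_eq_single i (fun j _ hj => by simp [Function.update_of_ne hj]) (by simp)] at h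
  simp only [sub_self, inner_zero_left, zero_add, Function.update_self, Risk.Fp] at h
  have hy : π (opp i) = y := Function.update_self _ _ _
  rw [hy, add_sub_add_left_eq_sub] at h
  rw [div_mul_eq_mul_div, div_le_iff₀ (hl i)]
  linarith

theorem Risk.IsEq.cost_le (hm : 0 < m) (hl : ∀ i, 0 < l i) (hs : G.Smooth L)
    (hmono : G.StronglyMonotone m l R) {z : Profile A} (hz : G.IsEq R z) (i : Fin 2)
    (x : simplex (A i)) : G.cost i z (R i) ≤ G.J i x (z.π (opp i)) (z.p i) (R i) := by
  have h := le_of_inner_gradient_nonneg convex_simplex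
    (fun x hx => hs.hasGradientAt_player i (R i) (z.p i) hx)
    (fun x hx y hy => ?_) (z.π i).2 x.2 ((hz i).1 x)
  · simp only [Risk.cost, Risk.J]; linarith
  · rw [add_sub_add_left_eq_sub, ← smul_sub, real_inner_smul_right]
    exact mul_nonneg (G.ε_pos i).le (hmono.gradient_ν_mono hm hl i ⟨x, hx⟩ ⟨y, hy⟩)

theorem Risk.IsEq.le_cost (hm : 0 < m) (hl : ∀ i, 0 < l i) (hs : G.Smooth L)
    (hmono : G.StronglyMonotone m l R) {z : Profile A} (hz : G.IsEq R z) (i : Fin 2)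
    (q : simplex (A (opp i))) : G.J i (z.π i) (z.π (opp i)) q (R i) ≤ G.cost i z (R i) := by
  have h := le_of_inner_gradient_nonneg convex_simplex
    (fun q hq => hs.hasGradientAt_adversary i (R i) (z.π i) hq (z.π (opp i)).2)
    (fun x hx y hy => ?_) (z.p i).2 q.2 ((hz i).2 q)
  · simp only [one_div_mul_eq_div] at h
    simp only [Risk.cost, Risk.J]; linarith
  · rw [add_sub_add_left_eq_sub]
    refine le_trans ?_ (hmono.gradient_D_strongMono hm hl i (z.π (opp i)) ⟨x, hx⟩ ⟨y, hy⟩)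
    have := hl i
    positivity

theorem Risk.Smooth.exists_forall_J_le (hs : G.Smooth L) (i : Fin 2) (x : simplex (A i))
    (y : simplex (A (opp i))) (M : (∀ j, A j) → ℝ) :
    ∃ q, ∀ q', G.J i x y q' M ≤ G.J i x y q M := by
  obtain ⟨q, hq, h⟩ := (isCompact_simplex (X := A (opp i))).exists_isMinOn
    ⟨_, (uniform _).2⟩ (f := fun q => bilin i M x q + (1 / G.τ i) * G.D i q y) (fun q hq =>
      (hs.hasGradientAt_adversary i M x hq y.2).continuousAt.continuousWithinAt)
  refine ⟨⟨q, hq⟩, fun q' => ?_⟩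
  have := h q'.2
  simp only [Set.mem_ofPred_eq, one_div_mul_eq_div] at this
  simp only [Risk.J]
  linarith

theorem Risk.Smooth.J_le_f (hs : G.Smooth L) (i : Fin 2) (x : simplex (A i))
    (y q : simplex (A (opp i))) (M : (∀ j, A j) → ℝ) : G.J i x y q M ≤ G.f i x y M := by
  obtain ⟨q₀, h⟩ := hs.exists_forall_J_le i x y M
  rw [Risk.f_eq_of_forall_le h]
  exact h q

theorem Risk.IsEq.f_eq (hm : 0 < m) (hl : ∀ i, 0 < l i) (hs : G.Smooth L)
    (hmono : G.StronglyMonotone m l R) {z : Profile A} (hz : G.IsEq R z) (i : Fin 2) :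
    G.f i (z.π i) (z.π (opp i)) (R i) = G.cost i z (R i) :=
  Risk.f_eq_of_forall_le (hz.le_cost hm hl hs hmono i)

theorem Risk.IsEq.isRQE (hm : 0 < m) (hl : ∀ i, 0 < l i) (hs : G.Smooth L)
    (hmono : G.StronglyMonotone m l R) {z : Profile A} (hz : G.IsEq R z) : G.IsRQE R z.π := by
  intro i x'
  rw [hz.f_eq hm hl hs hmono]
  exact (hz.cost_le hm hl hs hmono i x').trans (hs.J_le_f ..)

/-- A risk-averse quantal response equilibrium together with the best responses of the adversaries
is an equilibrium of the four-player game. The best response of the adversary is Lipschitz in the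
strategy of the player, so replacing it by a constant changes the objective of the player to second
order only. -/
theorem Risk.IsRQE.exists_isEq (hm : 0 < m) (hl : ∀ i, 0 < l i) (hs : G.Smooth L)
    (hmono : G.StronglyMonotone m l R) {x : Mixed A} (hx : G.IsRQE R x) :
    ∃ p, G.IsEq R ⟨x, p⟩ := by
  choose p hp using fun i => hs.exists_forall_J_le i (x i) (x (opp i)) (R i)
  have hFp : ∀ i (x' : simplex (A i)) (q q' : simplex (A (opp i))),
      (∀ q', G.J i x' (x (opp i)) q' (R i) ≤ G.J i x' (x (opp i)) q (R i)) →
      0 ≤ inner ℝ (mulL i (R i) x' + (1 / G.τ i) • gradient (fun q => G.D i q (x (opp i)))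
        (q : Vec (A (opp i)))) ((q' : Vec (A (opp i))) - q) := by
    intro i x' q q' h
    refine inner_gradient_nonneg convex_simplex
      (hs.hasGradientAt_adversary i (R i) x' q.2 (x (opp i)).2) q.2 (fun y hy => ?_) q'.2
    have := h ⟨y, hy⟩
    simp only [Risk.J] at this
    simp only [one_div_mul_eq_div]
    linarith
  refine ⟨p, fun i => ⟨fun x₁ => ?_, fun q => hFp i (x i) (p i) q (hp i)⟩⟩
  -- `x i` minimizes the cost against the fixed `p i` plus `c ‖y - x i‖ ^ 2`, whose gradient at
  -- `x i` is that of the cost; `c` is the Lipschitz constant of the best response times that of the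
  -- payoff
  set c := numActions A * ‖R i‖ * (l i / m * (numActions A * ‖R i‖)) with hc
  have hN := numActions_nonneg (A := A)
  have hgrad : HasGradientAt (fun y : Vec (A i) => -bilin i (R i) y (p i) + G.ε i * G.ν i y +
      c * ‖y - x i‖ ^ 2)
      (-mulR i (R i) (p i) + G.ε i • gradient (G.ν i) (x i : Vec (A i))) (x i) := by
    rw [hasGradientAt_iff_hasFDerivAt]
    have h1 := (hs.hasGradientAt_player i (R i) (p i) (x i).2).hasFDerivAt
    have h2 : HasFDerivAt (fun y : Vec (A i) => c * ‖y - x i‖ ^ 2)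
        (0 : Vec (A i) →L[ℝ] ℝ) (x i) := by
      have := (((hasFDerivAt_id (𝕜 := ℝ) (x i : Vec (A i))).sub_const
        (x i : Vec (A i))).norm_sq).const_mul c
      refine this.congr_fderiv ?_
      ext v; simp
    exact (h1.add h2).congr_fderiv (add_zero _)
  refine inner_gradient_nonneg convex_simplex hgrad (x i).2 (fun y hy => ?_) x₁.2
  obtain ⟨q, hq⟩ := hs.exists_forall_J_le i ⟨y, hy⟩ (x (opp i)) (R i)
  have h1 := hx i ⟨y, hy⟩
  rw [Risk.f_eq_of_forall_le (hp i), Risk.f_eq_of_forall_le hq] at h1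
  have h2 := (hp i q).trans h1
  simp only [Risk.J] at h2
  have h3 := hFp i (x i) (p i) q (hp i)
  have h4 := hFp i ⟨y, hy⟩ q (p i) hq
  have h5 := hmono.gradient_D_strongMono hm hl i (x (opp i)) q (p i)
  simp only at h4
  set δ : Vec (A (opp i)) := (q : Vec (A (opp i))) - p i with hδ
  have hδ0 := norm_nonneg δ
  -- the first-order conditions of the best responses `p i` to `x i` and `q` to `y`, added up
  have h6 : m / l i * ‖δ‖ ^ 2 ≤ numActions A * ‖R i‖ * ‖y - x i‖ * ‖δ‖ := by
    have e : (p i : Vec (A (opp i))) - q = -δ := by rw [hδ]; abel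
    rw [e, inner_neg_right] at h4
    have h7 : m / l i * ‖δ‖ ^ 2 ≤ -inner ℝ (mulL i (R i) (y - x i)) δ := by
      rw [mulL_sub_right]
      rw [real_inner_comm] at h5
      simp only [inner_sub_left, inner_add_left] at h3 h4 h5 ⊢
      linarith
    have h8 := neg_le_of_abs_le (abs_real_inner_le_norm (mulL i (R i) (y - x i)) δ)
    have h9 := mul_le_mul_of_nonneg_right (norm_mulL_le i (R i) (y - x i)) hδ0
    linarith
  have h7 : ‖δ‖ ≤ l i / m * (numActions A * ‖R i‖) * ‖y - x i‖ := by
    have hli := hl i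
    rcases hδ0.eq_or_lt with h0 | h0
    · rw [← h0]; positivity
    · have h8 : m / l i * ‖δ‖ ≤ numActions A * ‖R i‖ * ‖y - x i‖ := by
        refine le_of_mul_le_mul_right ?_ h0
        linarith
      calc ‖δ‖ = l i / m * (m / l i * ‖δ‖) := by field_simp
        _ ≤ l i / m * (numActions A * ‖R i‖ * ‖y - x i‖) :=
            mul_le_mul_of_nonneg_left h8 (by positivity)
        _ = _ := by ring
  have h8 : bilin i (R i) y (p i) - bilin i (R i) (x i) (p i) -
      (bilin i (R i) y q - bilin i (R i) (x i) q) ≤ c * ‖y - x i‖ ^ 2 := by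
    have e : bilin i (R i) y (p i) - bilin i (R i) (x i) (p i) -
      (bilin i (R i) y q - bilin i (R i) (x i) q) = -inner ℝ (mulR i (R i) δ) (y - x i) := by
      rw [hδ, mulR_sub_right]
      simp only [bilin_eq_inner_mulR, inner_sub_left, inner_sub_right]; ring
    rw [e]
    have h9 := neg_le_of_abs_le (abs_real_inner_le_norm (mulR i (R i) δ) (y - x i))
    have h10 : ‖mulR i (R i) δ‖ ≤
        numActions A * ‖R i‖ * (l i / m * (numActions A * ‖R i‖) * ‖y - x i‖) :=
      (norm_mulR_le _ _ _).trans (mul_le_mul_of_nonneg_left h7 (by positivity))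
    have h11 := mul_le_mul_of_nonneg_right h10 (norm_nonneg (y - (x i : Vec (A i))))
    calc _ ≤ ‖mulR i (R i) δ‖ * ‖y - x i‖ := by linarith
      _ ≤ _ := h11
      _ = _ := by rw [hc]; ring
  simp only [sub_self, norm_zero]
  linarith

/-- The value at the risk-averse quantal response equilibrium is the cost at the equilibrium of the
four-player game. -/
theorem Risk.IsEq.rqe_eq (hm : 0 < m) (hl : ∀ i, 0 < l i) (hs : G.Smooth L)
    (hmono : G.StronglyMonotone m l R) {z : Profile A} (hz : G.IsEq R z) (i : Fin 2) :
    G.rqe R i = G.cost i z (R i) := by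
  have huniq : ∀ x : Mixed A, G.IsRQE R x → x = z.π := fun x hx => by
    obtain ⟨p, hp⟩ := hx.exists_isEq hm hl hs hmono
    exact congrArg Profile.π (hp.unique hm hl hmono hz)
  have h : ∃! x : Mixed A, G.IsRQE R x := ⟨z.π, hz.isRQE hm hl hs hmono, huniq⟩
  have h1 : h.choose = z.π := huniq _ h.choose_spec.1
  rw [Risk.rqe, dif_pos h, h1, hz.f_eq hm hl hs hmono]

end RQE

end RiskGame

/-! ### Discounted values and the Nash equilibrium of the Markov game -/

namespace RiskGame

universe u v

section Discounted

variable {S : Type u} [Fintype S] [DecidableEq S] {T : Matrix S S ℝ} {γ : ℝ}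

/-- The discounted value of the state costs `c` along the chain with transition matrix `T`. -/
noncomputable def discounted (γ : ℝ) (T : Matrix S S ℝ) (c : S → ℝ) (s : S) : ℝ :=
  ∑' t : ℕ, γ ^ t * ∑ s', (T ^ t) s s' * c s'

theorem abs_sum_mul_le (hT : T ∈ Matrix.rowStochastic ℝ S) {c : S → ℝ} {b : ℝ}
    (hc : ∀ s, |c s| ≤ b) (s : S) : |∑ s', T s s' * c s'| ≤ b := by
  refine (Finset.abs_sum_le_sum_abs _ _).trans ?_
  calc ∑ s', |T s s' * c s'| ≤ ∑ s', T s s' * b := Finset.sum_le_sum fun s' _ => by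
        rw [abs_mul, abs_of_nonneg (hT.1 s s')]
        exact mul_le_mul_of_nonneg_left (hc s') (hT.1 s s')
    _ = b := by rw [← Finset.sum_mul, Matrix.sum_row_of_mem_rowStochastic hT, one_mul]

theorem abs_discounted_term_le (hT : T ∈ Matrix.rowStochastic ℝ S) (hγ : 0 ≤ γ) {c : S → ℝ} {b : ℝ}
    (hc : ∀ s, |c s| ≤ b) (s : S) (t : ℕ) :
    ‖γ ^ t * ∑ s', (T ^ t) s s' * c s'‖ ≤ γ ^ t * b := by
  rw [Real.norm_eq_abs, abs_mul, abs_of_nonneg (pow_nonneg hγ t)]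
  exact mul_le_mul_of_nonneg_left (abs_sum_mul_le (pow_mem hT t) hc s) (pow_nonneg hγ t)

theorem summable_discounted (hT : T ∈ Matrix.rowStochastic ℝ S) (hγ : 0 ≤ γ) (hγ1 : γ < 1)
    (c : S → ℝ) (s : S) : Summable fun t : ℕ => γ ^ t * ∑ s', (T ^ t) s s' * c s' := by
  exact Summable.of_norm_bounded ((summable_geometric_of_lt_one hγ hγ1).mul_right ‖c‖)
    (abs_discounted_term_le hT hγ (fun s => norm_le_pi_norm c s) s)

theorem abs_discounted_le (hT : T ∈ Matrix.rowStochastic ℝ S) (hγ : 0 ≤ γ) (hγ1 : γ < 1)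
    {c : S → ℝ} {b : ℝ} (hc : ∀ s, |c s| ≤ b) (s : S) : |discounted γ T c s| ≤ b / (1 - γ) := by
  have h := tsum_of_norm_bounded ((hasSum_geometric_of_lt_one hγ hγ1).mul_right b)
    (abs_discounted_term_le hT hγ hc s)
  rwa [inv_mul_eq_div] at h

/-- The Bellman equation. -/
theorem discounted_eq (hT : T ∈ Matrix.rowStochastic ℝ S) (hγ : 0 ≤ γ) (hγ1 : γ < 1) (c : S → ℝ)
    (s : S) : discounted γ T c s = c s + γ * ∑ s', T s s' * discounted γ T c s' := by
  have h0 := (summable_discounted hT hγ hγ1 c s).tsum_eq_zero_add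
  rw [discounted, h0]
  congr 1
  · simp [Matrix.one_apply]
  · simp only [discounted, ← tsum_mul_left]
    rw [← Summable.tsum_finsetSum fun s' _ => (summable_discounted hT hγ hγ1 c s').mul_left _,
      ← tsum_mul_left]
    refine tsum_congr fun t => ?_
    simp only [pow_succ' T, Matrix.mul_apply, Finset.sum_mul, Finset.mul_sum]
    rw [Finset.sum_comm]
    exact Finset.sum_congr rfl fun x _ => Finset.sum_congr rfl fun y _ => by ring

theorem nonpos_of_le_discounted (hT : T ∈ Matrix.rowStochastic ℝ S) (hγ : 0 ≤ γ) (hγ1 : γ < 1)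
    {d : S → ℝ} (h : ∀ s, d s ≤ γ * ∑ s', T s s' * d s') (s : S) : d s ≤ 0 := by
  obtain ⟨s₀, -, hs₀⟩ := Finset.exists_max_image Finset.univ d ⟨s, Finset.mem_univ s⟩
  have h1 : ∑ s', T s₀ s' * d s' ≤ d s₀ := by
    calc ∑ s', T s₀ s' * d s' ≤ ∑ s', T s₀ s' * d s₀ := Finset.sum_le_sum fun s' hs' =>
          mul_le_mul_of_nonneg_left (hs₀ s' hs') (hT.1 _ _)
      _ = d s₀ := by rw [← Finset.sum_mul, Matrix.sum_row_of_mem_rowStochastic hT, one_mul]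
  have h2 := (h s₀).trans (mul_le_mul_of_nonneg_left h1 hγ)
  have h3 := hs₀ s (Finset.mem_univ s)
  nlinarith

/-- Policy improvement: if the one-step lookahead with `U` is below `U`, and strictly so at `s₀`,
then the value is strictly below `U` at `s₀`. -/
theorem discounted_lt (hT : T ∈ Matrix.rowStochastic ℝ S) (hγ : 0 ≤ γ) (hγ1 : γ < 1)
    {c W U : S → ℝ} (hW : ∀ s, W s = c s + γ * ∑ s', T s s' * W s')
    (h : ∀ s, c s + γ * ∑ s', T s s' * U s' ≤ U s) {s₀ : S}
    (h₀ : c s₀ + γ * ∑ s', T s₀ s' * U s' < U s₀) : W s₀ < U s₀ := by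
  have e : ∀ s, γ * ∑ s', T s s' * (W s' - U s') =
      γ * ∑ s', T s s' * W s' - γ * ∑ s', T s s' * U s' := fun s => by
    simp only [mul_sub, Finset.sum_sub_distrib]
  have h1 := nonpos_of_le_discounted hT hγ hγ1 (d := fun s => W s - U s) (fun s => by
    rw [e]; linarith [hW s, h s])
  have h2 : γ * ∑ s', T s₀ s' * (W s' - U s') ≤ 0 := by
    refine mul_nonpos_of_nonneg_of_nonpos hγ (Finset.sum_nonpos fun s' _ => ?_)
    exact mul_nonpos_of_nonneg_of_nonpos (hT.1 _ _) (h1 s')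
  rw [e] at h2
  linarith [hW s₀]

theorem lt_discounted (hT : T ∈ Matrix.rowStochastic ℝ S) (hγ : 0 ≤ γ) (hγ1 : γ < 1)
    {c W U : S → ℝ} (hW : ∀ s, W s = c s + γ * ∑ s', T s s' * W s')
    (h : ∀ s, U s ≤ c s + γ * ∑ s', T s s' * U s') {s₀ : S}
    (h₀ : U s₀ < c s₀ + γ * ∑ s', T s₀ s' * U s') : U s₀ < W s₀ := by
  have := discounted_lt hT hγ hγ1 (c := fun s => -c s) (W := fun s => -W s) (U := fun s => -U s)
    (s₀ := s₀) (fun s => by simp only [mul_neg, Finset.sum_neg_distrib]; linarith [hW s])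
    (fun s => by simp only [mul_neg, Finset.sum_neg_distrib]; linarith [h s])
    (by simp only [mul_neg, Finset.sum_neg_distrib]; linarith)
  linarith

end Discounted

section Nash

variable {S : Type u} {A : Fin 2 → Type v} [∀ i, Fintype (A i)]
  {M : MarkovGame S A} {G : Risk A} {L m : ℝ} {l : Fin 2 → ℝ}

theorem MarkovGame.norm_r_le (M : MarkovGame S A) (i : Fin 2) (s : S) : ‖M.r i s‖ ≤ 1 := by
  refine (pi_norm_le_iff_of_nonneg zero_le_one).2 fun a => ?_
  rw [Real.norm_eq_abs, abs_of_nonneg (M.r_mem i s a).1]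
  exact (M.r_mem i s a).2

variable [Fintype S]

theorem sum_toReal_eq_one {X : Type u} [Fintype X] (p : PMF X) : ∑ x, (p x).toReal = 1 := by
  have h := p.tsum_coe
  rw [tsum_fintype] at h
  rw [← ENNReal.toReal_sum fun x _ => p.apply_ne_top x, h, ENNReal.toReal_one]

theorem MarkovGame.sum_trans_mul (M : MarkovGame S A) (k : S → (∀ j, A j) → ℝ) (U : S → ℝ) (s : S) :
    ∑ s', M.trans k s s' * U s' = ∑ a, k s a * ∑ s', (M.P s a s').toReal * U s' := by
  simp only [MarkovGame.trans, Finset.sum_mul, Finset.mul_sum]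
  rw [Finset.sum_comm]
  exact Finset.sum_congr rfl fun x _ => Finset.sum_congr rfl fun y _ => by ring

variable [DecidableEq S]

theorem MarkovGame.trans_mem (M : MarkovGame S A) {k : S → (∀ j, A j) → ℝ} (hk : ∀ s a, 0 ≤ k s a)
    (hk1 : ∀ s, ∑ a, k s a = 1) : M.trans k ∈ Matrix.rowStochastic ℝ S := by
  rw [Matrix.mem_rowStochastic_iff_sum]
  refine ⟨fun s s' => Finset.sum_nonneg fun a _ => mul_nonneg (hk s a) ENNReal.toReal_nonneg,
    fun s => ?_⟩
  have h := M.sum_trans_mul k 1 s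
  simpa [sum_toReal_eq_one, hk1] using h

/-- The law of the action of player `i` and the fictitious action of its opponent. -/
noncomputable def pairLaw (i : Fin 2) (x : S → simplex (A i)) (q : S → simplex (A (opp i))) (s : S)
    (a : ∀ j, A j) : ℝ :=
  (x s : Vec (A i)) (a i) * (q s : Vec (A (opp i))) (a (opp i))

/-- The Q-function of a Markov profile. -/
noncomputable def MarkovGame.qValue (M : MarkovGame S A) (G : Risk A) (z : S → Profile A) :
    QFun S A := fun i s a => -M.r i s a + M.γ * ∑ s', (M.P s a s').toReal *
  M.V G i (fun s => (z s).π i) (fun s => (z s).π (opp i)) (fun s => (z s).p i) s'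

/-- The cost in the stage game with payoffs `-qValue` is the one-step lookahead. -/
theorem MarkovGame.J_stage_qValue (M : MarkovGame S A) (G : Risk A) (z : S → Profile A) (i : Fin 2)
    (x : S → simplex (A i)) (y q : S → simplex (A (opp i))) (s : S) :
    G.J i (x s) (y s) (q s) (stage (M.qValue G z) s i) = G.J i (x s) (y s) (q s) (M.r i s) +
      M.γ * ∑ s', M.trans (pairLaw i x q) s s' *
        M.V G i (fun s => (z s).π i) (fun s => (z s).π (opp i)) (fun s => (z s).p i) s' := by
  rw [M.sum_trans_mul]
  have e : -bilin i (stage (M.qValue G z) s i) (x s) (q s) = -bilin i (M.r i s) (x s) (q s) +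
      M.γ * ∑ a, pairLaw i x q s a * ∑ s', (M.P s a s').toReal *
        M.V G i (fun s => (z s).π i) (fun s => (z s).π (opp i)) (fun s => (z s).p i) s' := by
    simp only [bilin, ← Finset.sum_neg_distrib]
    rw [Finset.mul_sum, ← Finset.sum_add_distrib]
    refine Finset.sum_congr rfl fun a _ => ?_
    simp only [stage, MarkovGame.qValue, pairLaw]
    ring
  simp only [Risk.J]
  rw [e]
  ring

variable [∀ i, DecidableEq (A i)]

theorem MarkovGame.trans_pairLaw_mem (M : MarkovGame S A) (i : Fin 2) (x : S → simplex (A i))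
    (q : S → simplex (A (opp i))) : M.trans (pairLaw i x q) ∈ Matrix.rowStochastic ℝ S :=
  M.trans_mem (fun s _ => mul_nonneg ((x s).2.1 _) ((q s).2.1 _)) fun s => sum_mul_opp i (x s) (q s)

theorem MarkovGame.V_eq (M : MarkovGame S A) (G : Risk A) (i : Fin 2)
    (x : S → simplex (A i)) (y q : S → simplex (A (opp i))) (s : S) :
    M.V G i x y q s = G.J i (x s) (y s) (q s) (M.r i s) +
      M.γ * ∑ s', M.trans (pairLaw i x q) s s' * M.V G i x y q s' :=
  discounted_eq (M.trans_pairLaw_mem i x q) M.γ_nonneg M.γ_lt_one _ s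

theorem MarkovGame.exists_abs_V_le [∀ i, Nonempty (A i)] (M : MarkovGame S A) (hL : 0 ≤ L)
    (hs : G.Smooth L) :
    ∃ b, ∀ i x y q s, |M.V G i x y q s| ≤ b := by
  obtain ⟨c, -, hc⟩ := hs.exists_abs_J_le hL
  refine ⟨(1 + c) / (1 - M.γ), fun i x y q s => ?_⟩
  refine abs_discounted_le (M.trans_pairLaw_mem i x q) M.γ_nonneg M.γ_lt_one (fun s => ?_) s
  have := hc i (x s) (y s) (q s) (M.r i s)
  have := M.norm_r_le i s
  linarith

/-- In a Nash equilibrium of the four-player game the players follow a Markov RQE. -/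
theorem MarkovGame.IsNash.isRQE [∀ i, Nonempty (A i)] (hL : 0 ≤ L) (hs : G.Smooth L)
    {z : S → Profile A} (hz : M.IsNash G z) : M.IsRQE G fun s => (z s).π := by
  intro i s x'
  obtain ⟨b, hb⟩ := M.exists_abs_V_le hL hs
  have hbdd : ∀ x : S → simplex (A i), BddAbove (Set.range fun q : S → simplex (A (opp i)) =>
      M.V G i x (fun s => (z s).π (opp i)) q s) := fun x =>
    ⟨b, by rintro _ ⟨q, rfl⟩; exact (abs_le.1 (hb i _ _ q s)).2⟩
  calc M.f G i (fun s => (z s).π i) (fun s => (z s).π (opp i)) s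
      ≤ M.V G i (fun s => (z s).π i) (fun s => (z s).π (opp i)) (fun s => (z s).p i) s :=
        ciSup_le fun q => (hz i s).2 q
    _ ≤ M.V G i x' (fun s => (z s).π (opp i)) (fun s => (z s).p i) s := (hz i s).1 x'
    _ ≤ M.f G i x' (fun s => (z s).π (opp i)) s := le_ciSup (hbdd x') _

theorem MarkovGame.cost_stage_qValue (M : MarkovGame S A) (G : Risk A) (z : S → Profile A)
    (i : Fin 2) (s : S) : G.cost i (z s) (stage (M.qValue G z) s i) =
      M.V G i (fun s => (z s).π i) (fun s => (z s).π (opp i)) (fun s => (z s).p i) s := by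
  rw [M.V_eq]
  exact M.J_stage_qValue G z i (fun s => (z s).π i) (fun s => (z s).π (opp i))
    (fun s => (z s).p i) s

/-- At every state a Nash equilibrium of the Markov game is an equilibrium of the stage game of its
Q-function: a profitable deviation at one state would improve the value there. -/
theorem MarkovGame.IsNash.isEq (hs : G.Smooth L) {z : S → Profile A} (hz : M.IsNash G z) (s : S) :
    G.IsEq (stage (M.qValue G z) s) (z s) := by
  refine Risk.isEq_of_forall_le hs (fun i x => ?_) (fun i q => ?_)
  · by_contra! hlt
    -- deviate at the state `s` only
    set x' : S → simplex (A i) := Function.update (fun s => (z s).π i) s x with hx'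
    have key := discounted_lt (M.trans_pairLaw_mem i x' fun s => (z s).p i) M.γ_nonneg M.γ_lt_one
      (M.V_eq G i x' (fun s => (z s).π (opp i)) fun s => (z s).p i)
      (U := M.V G i (fun s => (z s).π i) (fun s => (z s).π (opp i)) fun s => (z s).p i) (s₀ := s)
    simp only [← M.J_stage_qValue G z i x' (fun s => (z s).π (opp i)) fun s => (z s).p i] at key
    simp only [← M.cost_stage_qValue G z] at key
    refine (key (fun s₁ => ?_) ?_).not_ge ?_
    · by_cases h : s₁ = s
      · subst h
        rw [hx', Function.update_self]
        exact hlt.le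
      · rw [hx', Function.update_of_ne h]
        exact le_rfl
    · rw [hx', Function.update_self]
      exact hlt
    · rw [M.cost_stage_qValue]
      exact (hz i s).1 x'
  · by_contra! hlt
    set q' : S → simplex (A (opp i)) := Function.update (fun s => (z s).p i) s q with hq'
    have key := lt_discounted (M.trans_pairLaw_mem i (fun s => (z s).π i) q') M.γ_nonneg M.γ_lt_one
      (M.V_eq G i (fun s => (z s).π i) (fun s => (z s).π (opp i)) q')
      (U := M.V G i (fun s => (z s).π i) (fun s => (z s).π (opp i)) fun s => (z s).p i) (s₀ := s)
    simp only [← M.J_stage_qValue G z i (fun s => (z s).π i) (fun s => (z s).π (opp i)) q'] at key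
    simp only [← M.cost_stage_qValue G z] at key
    refine (key (fun s₁ => ?_) ?_).not_ge ?_
    · by_cases h : s₁ = s
      · subst h
        rw [hq', Function.update_self]
        exact hlt.le
      · rw [hq', Function.update_of_ne h]
        exact le_rfl
    · rw [hq', Function.update_self]
      exact hlt
    · rw [M.cost_stage_qValue]
      exact (hz i s).2 q'

/-- The Q-function of the Nash equilibrium is the fixed point of the Bellman operator. -/
theorem MarkovGame.IsNash.bellman_eq [∀ i, Nonempty (A i)] (hm : 0 < m) (hl : ∀ i, 0 < l i)
    (hs : G.Smooth L) (hmono : ∀ (Q : QFun S A) (s : S), G.StronglyMonotone m l (stage Q s))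
    {z : S → Profile A} (hz : M.IsNash G z) :
    M.bellman G (M.qValue G z) = M.qValue G z := by
  funext i s a
  simp only [MarkovGame.bellman]
  rw [MarkovGame.qValue]
  congr 2
  refine Finset.sum_congr rfl fun s' _ => ?_
  rw [(hz.isEq hs s').rqe_eq hm hl hs (hmono _ _), M.cost_stage_qValue]

end Nash

end RiskGame

/-! ### Deterministic estimates for one episode -/

namespace RiskGame

universe u v

section Episode

variable {S : Type u} {A : Fin 2 → Type v} [∀ i, Fintype (A i)]
  {M : MarkovGame S A} {G : Risk A} {L m : ℝ} {l : Fin 2 → ℝ} {Q Q' : QFun S A}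

/-- A Markov profile as a family of points of Euclidean space. On this type the norm is the maximum
over the states of the Euclidean norms. -/
def embAll (z : S → Profile A) : S → PVec A := fun s => (z s).emb

theorem MarkovGame.target_eq (M : MarkovGame S A) (G : Risk A) (z : S → Profile A) (Q : QFun S A)
    (i : Fin 2) (w : S × (∀ j, A j) × S) :
    M.target G z Q i w = -M.r i w.1 w.2.1 + M.γ * G.cost i (z w.2.2) (stage Q w.2.2 i) := by
  have e : stage Q w.2.2 i = -Q i w.2.2 := rfl
  rw [MarkovGame.target, Risk.cost, Risk.J, e, bilin_neg]
  ring

variable [Fintype S]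

theorem norm_stage_le (Q : QFun S A) (s : S) : ‖stage Q s‖ ≤ ‖Q‖ := by
  refine (pi_norm_le_iff_of_nonneg (norm_nonneg _)).2 fun i =>
    (pi_norm_le_iff_of_nonneg (norm_nonneg _)).2 fun a => ?_
  rw [stage, norm_neg]
  exact (norm_le_pi_norm (Q i s) a).trans ((norm_le_pi_norm (Q i) s).trans (norm_le_pi_norm Q i))

theorem norm_stage_sub_le (Q Q' : QFun S A) (s : S) : ‖stage Q s - stage Q' s‖ ≤ ‖Q - Q'‖ := by
  have e : stage Q s - stage Q' s = stage (Q - Q') s := by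
    funext i a; simp only [stage, Pi.sub_apply]; ring
  rw [e]
  exact norm_stage_le _ s

theorem abs_apply_le (Q : QFun S A) (i : Fin 2) (s : S) (a : ∀ j, A j) : |Q i s a| ≤ ‖Q‖ :=
  (norm_le_pi_norm (Q i s) a).trans ((norm_le_pi_norm (Q i) s).trans (norm_le_pi_norm Q i))

theorem QFun.norm_le {b : ℝ} (hb : 0 ≤ b) (h : ∀ i s a, |Q i s a| ≤ b) : ‖Q‖ ≤ b :=
  (pi_norm_le_iff_of_nonneg hb).2 fun i => (pi_norm_le_iff_of_nonneg hb).2 fun s =>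
    (pi_norm_le_iff_of_nonneg hb).2 fun a => h i s a

/-- The expected target: one-step lookahead with the profile `z` and continuation payoffs `-Q`. -/
noncomputable def MarkovGame.lookahead (M : MarkovGame S A) (G : Risk A) (z : S → Profile A)
    (Q : QFun S A) : QFun S A := fun i s a =>
  -M.r i s a + M.γ * ∑ s', (M.P s a s').toReal * G.cost i (z s') (stage Q s' i)

theorem abs_sum_toReal_mul_le (p : PMF S) {f : S → ℝ} {b : ℝ} (h : ∀ s, |f s| ≤ b) :
    |∑ s, (p s).toReal * f s| ≤ b := by
  refine (Finset.abs_sum_le_sum_abs _ _).trans ?_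
  calc ∑ s, |(p s).toReal * f s| ≤ ∑ s, (p s).toReal * b := Finset.sum_le_sum fun s _ => by
        rw [abs_mul, abs_of_nonneg ENNReal.toReal_nonneg]
        exact mul_le_mul_of_nonneg_left (h s) ENNReal.toReal_nonneg
    _ = b := by rw [← Finset.sum_mul, sum_toReal_eq_one, one_mul]

theorem MarkovGame.abs_target_le {c : ℝ}
    (hc : ∀ (i : Fin 2) (x : simplex (A i)) (y q : simplex (A (opp i))) (M : (∀ j, A j) → ℝ),
      |G.J i x y q M| ≤ ‖M‖ + c) (z : S → Profile A) (Q : QFun S A) (i : Fin 2)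
    (w : S × (∀ j, A j) × S) : |M.target G z Q i w| ≤ 1 + M.γ * (‖Q‖ + c) := by
  rw [M.target_eq]
  refine (abs_add_le _ _).trans (add_le_add ?_ ?_)
  · rw [abs_neg]
    exact (norm_le_pi_norm (M.r i w.1) w.2.1).trans (M.norm_r_le i w.1)
  · rw [abs_mul, abs_of_nonneg M.γ_nonneg]
    refine mul_le_mul_of_nonneg_left ?_ M.γ_nonneg
    have h1 := hc i ((z w.2.2).π i) ((z w.2.2).π (opp i)) ((z w.2.2).p i) (stage Q w.2.2 i)
    have h2 : ‖stage Q w.2.2 i‖ ≤ ‖Q‖ := (norm_le_pi_norm _ i).trans (norm_stage_le Q w.2.2)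
    exact h1.trans (by linarith)

variable [∀ i, DecidableEq (A i)]

theorem MarkovGame.norm_lookahead_sub_le {c : ℝ} (hc0 : 0 ≤ c)
    (hc : ∀ (i : Fin 2) (z w : Profile A) (M : (∀ j, A j) → ℝ),
      |G.cost i z M - G.cost i w M| ≤ c * (1 + ‖M‖) * ‖z.emb - w.emb‖)
    (z w : S → Profile A) (Q Q' : QFun S A) :
    ‖M.lookahead G z Q - M.lookahead G w Q'‖ ≤
      c * (1 + ‖Q‖) * ‖embAll z - embAll w‖ + ‖Q - Q'‖ := by
  refine QFun.norm_le (by positivity) fun i s a => ?_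
  have e : (M.lookahead G z Q - M.lookahead G w Q') i s a = M.γ * ∑ s', (M.P s a s').toReal *
      (G.cost i (z s') (stage Q s' i) - G.cost i (w s') (stage Q' s' i)) := by
    simp only [Pi.sub_apply, MarkovGame.lookahead, mul_sub, Finset.sum_sub_distrib]; ring
  rw [e, abs_mul, abs_of_nonneg M.γ_nonneg]
  refine (mul_le_of_le_one_left (abs_nonneg _) M.γ_lt_one.le).trans
    (abs_sum_toReal_mul_le _ fun s' => ?_)
  have h1 := hc i (z s') (w s') (stage Q s' i)
  have h2 := G.abs_cost_sub_payoff_le i (w s') (stage Q s' i) (stage Q' s' i)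
  have h3 : ‖stage Q s' i - stage Q' s' i‖ ≤ ‖Q - Q'‖ :=
    (norm_le_pi_norm (stage Q s' - stage Q' s') i).trans (norm_stage_sub_le Q Q' s')
  have h4 : ‖stage Q s' i‖ ≤ ‖Q‖ := (norm_le_pi_norm _ i).trans (norm_stage_le Q s')
  have h5 : ‖(z s').emb - (w s').emb‖ ≤ ‖embAll z - embAll w‖ :=
    norm_le_pi_norm (embAll z - embAll w) s'
  have h6 : c * (1 + ‖stage Q s' i‖) * ‖(z s').emb - (w s').emb‖ ≤
      c * (1 + ‖Q‖) * ‖embAll z - embAll w‖ := by gcongr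
  have h7 := abs_sub_le (G.cost i (z s') (stage Q s' i)) (G.cost i (w s') (stage Q s' i))
    (G.cost i (w s') (stage Q' s' i))
  linarith

theorem norm_embAll_sub_le_of_isEq (hm : 0 < m) (hl : ∀ i, 0 < l i) {c : ℝ} (hc0 : 0 ≤ c)
    (hc : ∀ (R R' : Fin 2 → (∀ j, A j) → ℝ) (z : Profile A),
      ‖G.grad l R z - G.grad l R' z‖ ≤ c * ‖R - R'‖)
    (hmono : ∀ (Q : QFun S A) (s : S), G.StronglyMonotone m l (stage Q s)) {z w : S → Profile A}
    (hz : ∀ s, G.IsEq (stage Q s) (z s)) (hw : ∀ s, G.IsEq (stage Q' s) (w s)) :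
    ‖embAll z - embAll w‖ ≤ c / m * ‖Q - Q'‖ := by
  refine (pi_norm_le_iff_of_nonneg (by positivity)).2 fun s => ?_
  refine ((hz s).norm_emb_sub_le hm hl hc (hmono Q s) (hw s)).trans ?_
  have := norm_stage_sub_le Q Q' s
  gcongr

variable [∀ i, Nonempty (A i)]

theorem MarkovGame.bellman_eq_lookahead (hm : 0 < m) (hl : ∀ i, 0 < l i) (hs : G.Smooth L)
    (hmono : ∀ (Q : QFun S A) (s : S), G.StronglyMonotone m l (stage Q s)) {z : S → Profile A}
    (hz : ∀ s, G.IsEq (stage Q s) (z s)) : M.bellman G Q = M.lookahead G z Q := by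
  funext i s a
  simp only [MarkovGame.bellman, MarkovGame.lookahead]
  congr 2
  exact Finset.sum_congr rfl fun s' _ => by rw [(hz s').rqe_eq hm hl hs (hmono _ _)]

/-- The actor contracts towards the equilibria of `Q'`, up to the distance from `Q` to `Q'`. -/
theorem norm_actor_sub_sq_le {c : ℝ} (hc0 : 0 ≤ c) (hm : 0 < m) (hl : ∀ i, 0 < l i)
    (hmono : ∀ (Q : QFun S A) (s : S), G.StronglyMonotone m l (stage Q s))
    (hc : ∀ (R : Fin 2 → (∀ j, A j) → ℝ) (z w : Profile A),
      ‖G.grad l R z - G.grad l R w‖ ≤ c * (1 + ‖R‖) * ‖z.emb - w.emb‖) {c' : ℝ} (hc0' : 0 ≤ c')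
    (hc' : ∀ (R R' : Fin 2 → (∀ j, A j) → ℝ) (z : Profile A),
      ‖G.grad l R z - G.grad l R' z‖ ≤ c' * ‖R - R'‖) {β : ℝ} (hβ : 0 ≤ β) (hβ1 : β ≤ 1)
    (hβm : β * m ≤ 1) (h4 : 4 * β * (c * (1 + ‖Q‖)) ^ 2 ≤ m) (z : S → Profile A)
    {w : S → Profile A} (hw : ∀ s, G.IsEq (stage Q' s) (w s)) :
    ‖embAll (G.actor l β z Q) - embAll w‖ ^ 2 ≤
      (1 - β * m) * ‖embAll z - embAll w‖ ^ 2 + β * ((2 / m + 2) * c' ^ 2) * ‖Q - Q'‖ ^ 2 := by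
  have hβm' : 0 ≤ 1 - β * m := by linarith
  have key : ∀ s, ‖(embAll (G.actor l β z Q) - embAll w) s‖ ^ 2 ≤
      (1 - β * m) * ‖embAll z - embAll w‖ ^ 2 +
        β * ((2 / m + 2) * c' ^ 2) * ‖Q - Q'‖ ^ 2 := fun s => by
    have h5 : 4 * β * (c * (1 + ‖stage Q s‖)) ^ 2 ≤ m := by
      refine le_trans ?_ h4
      have := norm_stage_le Q s
      gcongr
    have h := (hmono Q s).norm_step_sub_sq_le hm hc hc' hβ h5 (stage Q' s) (z s) (w s)
    rw [(hw s).step_eq hl hβ] at h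
    refine h.trans (add_le_add ?_ ?_)
    · refine mul_le_mul_of_nonneg_left (pow_le_pow_left₀ (norm_nonneg _) ?_ 2) hβm'
      exact norm_le_pi_norm (embAll z - embAll w) s
    · have h6 := norm_stage_sub_le Q Q' s
      calc β * (2 / m + 2 * β) * (c' * ‖stage Q s - stage Q' s‖) ^ 2
          ≤ β * (2 / m + 2 * 1) * (c' * ‖Q - Q'‖) ^ 2 := by gcongr
        _ = _ := by ring
  have hnn : 0 ≤ (1 - β * m) * ‖embAll z - embAll w‖ ^ 2 +
      β * ((2 / m + 2) * c' ^ 2) * ‖Q - Q'‖ ^ 2 := by positivity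
  have h7 : ‖embAll (G.actor l β z Q) - embAll w‖ ≤ Real.sqrt _ :=
    (pi_norm_le_iff_of_nonneg (Real.sqrt_nonneg _)).2 fun s => Real.le_sqrt_of_sq_le (key s)
  calc _ ≤ _ := pow_le_pow_left₀ (norm_nonneg _) h7 2
    _ = _ := Real.sq_sqrt hnn

end Episode

section Recursion

variable {S : Type u} [Fintype S] {A : Fin 2 → Type v} [∀ i, Fintype (A i)] {QS N H T Q : QFun S A}

/-- The noiseless part `Q - N` of the critic after an episode with expected visit frequencies `W`
and expected targets `H`. -/
def meanUpdate (α : ℝ) (W : S → (∀ j, A j) → ℝ) (H Q N : QFun S A) : QFun S A :=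
  (Q - N) + α • ((fun i s a => W s a * (H i s a - Q i s a)) + N)

theorem norm_meanUpdate_sub_le {α ω γ₀ d : ℝ} {W : S → (∀ j, A j) → ℝ} (hα : 0 ≤ α) (hα1 : α ≤ 1)
    (hW0 : ∀ s a, 0 ≤ W s a)
    (hW1 : ∀ s a, W s a ≤ 1) (hω : ∀ s a, ω ≤ W s a * (1 - γ₀))
    (hd0 : ‖H - T‖ ≤ d)
    (hT : ‖T - QS‖ ≤ γ₀ * ‖(Q - N) - QS‖) (hω1 : ω ≤ 1) :
    ‖meanUpdate α W H Q N - QS‖ ≤ (1 - α * ω) * ‖(Q - N) - QS‖ + α * (d + 2 * ‖N‖) := by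
  have hd : 0 ≤ d := (norm_nonneg _).trans hd0
  set e := ‖(Q - N) - QS‖ with he
  have he0 : 0 ≤ e := norm_nonneg _
  have hαω : 0 ≤ 1 - α * ω := by nlinarith
  refine QFun.norm_le (by positivity) fun i s a => ?_
  have h1 := abs_apply_le ((Q - N) - QS) i s a
  have h2 := (abs_apply_le (T - QS) i s a).trans hT
  have h3 := (abs_apply_le (H - T) i s a).trans hd0
  have h4 := abs_apply_le N i s a
  simp only [Pi.sub_apply] at h1 h2 h3
  have hw0 := hW0 s a
  have hw1 := hW1 s a
  set w := W s a
  have e1 : (meanUpdate α W H Q N - QS) i s a = (1 - α * w) * (Q i s a - N i s a - QS i s a) +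
      (α * w) * (T i s a - QS i s a) + (α * w) * (H i s a - T i s a) + (α * (1 - w)) * N i s a := by
    simp only [meanUpdate, Pi.sub_apply, Pi.add_apply, Pi.smul_apply, smul_eq_mul]; ring
  have hαw : 0 ≤ 1 - α * w := by nlinarith
  have hαw0 : 0 ≤ α * w := mul_nonneg hα hw0
  have hα1w : 0 ≤ α * (1 - w) := mul_nonneg hα (by linarith)
  rw [e1]
  calc _ ≤ (1 - α * w) * e + α * w * (γ₀ * e) + α * w * d + α * (1 - w) * ‖N‖ := by
        refine (abs_add_le _ _).trans (add_le_add ((abs_add_le _ _).trans (add_le_add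
          ((abs_add_le _ _).trans (add_le_add ?_ ?_)) ?_)) ?_)
        · rw [abs_mul, abs_of_nonneg hαw]; gcongr
        · rw [abs_mul, abs_of_nonneg hαw0]; gcongr
        · rw [abs_mul, abs_of_nonneg hαw0]; gcongr
        · rw [abs_mul, abs_of_nonneg hα1w]; gcongr
    _ ≤ _ := by
        have h5 := mul_le_mul_of_nonneg_right (mul_le_mul_of_nonneg_left (hω s a) hα) he0
        have h6 := mul_le_mul_of_nonneg_right (mul_le_mul_of_nonneg_left hw1 hα) hd
        have h7 : α * (1 - w) * ‖N‖ ≤ α * (2 * ‖N‖) := by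
          rw [mul_assoc]
          refine mul_le_mul_of_nonneg_left ?_ hα
          nlinarith [norm_nonneg N]
        change α * ω * e ≤ α * (w * (1 - γ₀)) * e at h5
        linarith

theorem norm_meanUpdate_sub_self_le {α γ₀ d : ℝ} {W : S → (∀ j, A j) → ℝ} (hα : 0 ≤ α)
    (hW0 : ∀ s a, 0 ≤ W s a) (hW1 : ∀ s a, W s a ≤ 1) (hγ₀ : γ₀ ≤ 1)
    (hd0 : ‖H - T‖ ≤ d) (hT : ‖T - QS‖ ≤ γ₀ * ‖(Q - N) - QS‖) :
    ‖meanUpdate α W H Q N - (Q - N)‖ ≤ α * (d + 2 * ‖(Q - N) - QS‖ + 2 * ‖N‖) := by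
  have h1 : ‖H - Q‖ ≤ d + 2 * ‖(Q - N) - QS‖ + ‖N‖ := by
    have e : H - Q = (H - T) + (T - QS) - ((Q - N) - QS) - N := by abel
    rw [e]
    have h2 := norm_sub_le ((H - T) + (T - QS) - ((Q - N) - QS)) N
    have h3 := norm_sub_le ((H - T) + (T - QS)) ((Q - N) - QS)
    have h4 := norm_add_le (H - T) (T - QS)
    have h5 := mul_le_mul_of_nonneg_right hγ₀ (norm_nonneg ((Q - N) - QS))
    linarith
  rw [meanUpdate, add_sub_cancel_left, norm_smul, Real.norm_of_nonneg hα]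
  refine mul_le_mul_of_nonneg_left ((norm_add_le _ _).trans ?_) hα
  have h2 : ‖(fun i s a => W s a * (H i s a - Q i s a) : QFun S A)‖ ≤ ‖H - Q‖ := by
    refine QFun.norm_le (norm_nonneg _) fun i s a => ?_
    rw [abs_mul, abs_of_nonneg (hW0 s a)]
    exact (mul_le_of_le_one_left (abs_nonneg _) (hW1 s a)).trans (abs_apply_le (H - Q) i s a)
  linarith

end Recursion

end RiskGame

/-! ### The two-timescale Lyapunov function -/

namespace RiskGame

universe u v

/-- `(1 - t) x + t y` squared, by convexity. -/
theorem sq_add_mul_le {x y t : ℝ} (ht : 0 ≤ t) (ht1 : t ≤ 1) :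
    ((1 - t) * x + t * y) ^ 2 ≤ (1 - t) * x ^ 2 + t * y ^ 2 := by
  nlinarith [mul_nonneg (mul_nonneg ht (sub_nonneg.2 ht1)) (sq_nonneg (x - y))]

/-- Tracking error of the actor. Here `ζ`, `ζ'`, `ζ₁` are the distances to the moving equilibrium
before the actor step, after it, and after the equilibrium has moved by `Δ`. -/
theorem tracking_sq_le {m C₁ C₂ c α β e n ζ ζ' ζ₁ Δ : ℝ} (hm : 0 < m) (hC₁ : 0 ≤ C₁)
    (hc : 0 ≤ c) (hα : 0 < α) (hβ : 0 < β) (hβm : β * m ≤ 1)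
    (hr : 9 * (c * C₂) ^ 2 / m * (α / β) ^ 2 ≤ m / 8) (hζ₁ : 0 ≤ ζ₁)
    (hΔ : 0 ≤ Δ)
    (F1 : ζ' ^ 2 ≤ (1 - β * m) * ζ ^ 2 + β * C₁ * n ^ 2)
    (F2 : Δ ≤ α * (C₂ * (ζ' + e + n))) (F3 : ζ₁ ≤ ζ' + c * Δ) :
    ζ₁ ^ 2 ≤ (1 - 3 / 8 * (β * m)) * ζ ^ 2 + β * (2 * C₁ + m / 8) * n ^ 2 +
      9 * (c * C₂) ^ 2 / m * (α / β) * α * e ^ 2 := by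
  set K := 9 * (c * C₂) ^ 2 / m with hK
  have hK0 : 0 ≤ K := by positivity
  have hβm0 : 0 < β * m := mul_pos hβ hm
  have h1 : (c * Δ) ^ 2 ≤ (c * C₂) ^ 2 * α ^ 2 * (3 * (ζ' ^ 2 + e ^ 2 + n ^ 2)) := by
    have h2 : c * Δ ≤ c * (α * (C₂ * (ζ' + e + n))) := mul_le_mul_of_nonneg_left F2 hc
    have h3 := pow_le_pow_left₀ (mul_nonneg hc hΔ) h2 2
    have h4 : (ζ' + e + n) ^ 2 ≤ 3 * (ζ' ^ 2 + e ^ 2 + n ^ 2) := by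
      nlinarith [sq_nonneg (ζ' - e), sq_nonneg (ζ' - n), sq_nonneg (e - n)]
    calc _ ≤ _ := h3
      _ = (c * C₂) ^ 2 * α ^ 2 * (ζ' + e + n) ^ 2 := by ring
      _ ≤ _ := mul_le_mul_of_nonneg_left h4 (by positivity)
  -- Young's inequality with weight `β * m / 2` gives up half of the contraction of the actor
  have h2 : ζ₁ ^ 2 ≤ (1 + β * m / 2) * ζ' ^ 2 + 3 / (β * m) * (c * Δ) ^ 2 := by
    have h3 := pow_le_pow_left₀ hζ₁ F3 2
    have h4 : 2 * (ζ' * (c * Δ)) ≤ β * m / 2 * ζ' ^ 2 + 2 / (β * m) * (c * Δ) ^ 2 := by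
      have h5 : 0 ≤ 2 / (β * m) * (β * m / 2 * ζ' - c * Δ) ^ 2 := by positivity
      have h6 : 2 / (β * m) * (β * m / 2 * ζ' - c * Δ) ^ 2 =
          β * m / 2 * ζ' ^ 2 + 2 / (β * m) * (c * Δ) ^ 2 - 2 * (ζ' * (c * Δ)) := by
        field_simp; ring
      linarith
    have h5 : (c * Δ) ^ 2 ≤ 1 / (β * m) * (c * Δ) ^ 2 :=
      le_mul_of_one_le_left (sq_nonneg _) ((one_le_div hβm0).2 hβm)
    have h6 : 3 / (β * m) * (c * Δ) ^ 2 = 1 / (β * m) * (c * Δ) ^ 2 +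
      2 / (β * m) * (c * Δ) ^ 2 := by ring
    nlinarith
  have h3 : 3 / (β * m) * (c * Δ) ^ 2 ≤ K * (α / β) * α * (ζ' ^ 2 + e ^ 2 + n ^ 2) := by
    calc _ ≤ 3 / (β * m) * ((c * C₂) ^ 2 * α ^ 2 * (3 * (ζ' ^ 2 + e ^ 2 + n ^ 2))) :=
          mul_le_mul_of_nonneg_left h1 (by positivity)
      _ = _ := by rw [hK]; field_simp; ring
  have h4 : K * (α / β) * α ≤ m / 8 * β := by
    have e1 : K * (α / β) * α = K * (α / β) ^ 2 * β := by field_simp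
    rw [e1]
    exact mul_le_mul_of_nonneg_right hr hβ.le
  have h5 : ζ₁ ^ 2 ≤ (1 + 5 / 8 * (β * m)) * ζ' ^ 2 + m / 8 * β * n ^ 2 +
      K * (α / β) * α * e ^ 2 := by
    have := mul_le_mul_of_nonneg_right h4 (sq_nonneg ζ')
    have := mul_le_mul_of_nonneg_right h4 (sq_nonneg n)
    nlinarith
  have h6 := mul_le_mul_of_nonneg_left F1 (by positivity : 0 ≤ 1 + 5 / 8 * (β * m))
  have h7 : 0 ≤ β * C₁ * n ^ 2 := by positivity
  have h8 := mul_le_mul_of_nonneg_right hβm h7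
  have h9 : 0 ≤ (β * m) ^ 2 * ζ ^ 2 := by positivity
  nlinarith

/-- Error of the critic, perturbed by the tracking error of the actor and by the noise. -/
theorem slow_sq_le {m ω C₁ C₅ α β e n ζ ζ' e₁ : ℝ} (hω : 0 < ω) (hm : 0 < m) (hC₁ : 0 ≤ C₁)
    (hα : 0 ≤ α) (hαω : α * ω ≤ 1) (hβ : 0 ≤ β) (hβ1 : β ≤ 1) (he₁ : 0 ≤ e₁)
    (F1 : ζ' ^ 2 ≤ (1 - β * m) * ζ ^ 2 + β * C₁ * n ^ 2)
    (F4 : e₁ ≤ (1 - α * ω) * e + α * (C₅ * (ζ' + n))) :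
    e₁ ^ 2 ≤ (1 - α * ω) * e ^ 2 + α * (2 * C₅ ^ 2 / ω * (1 + C₁)) * (ζ ^ 2 + n ^ 2) := by
  -- a convex combination with weights `1 - α * ω` and `α * ω`
  have h1 : e₁ ^ 2 ≤ ((1 - α * ω) * e + α * ω * (C₅ / ω * (ζ' + n))) ^ 2 := by
    refine pow_le_pow_left₀ he₁ (F4.trans_eq ?_) 2
    field_simp
  have h2 := h1.trans (sq_add_mul_le (x := e) (y := C₅ / ω * (ζ' + n)) (by positivity) hαω)
  have h3 : (ζ' + n) ^ 2 ≤ 2 * (ζ' ^ 2 + n ^ 2) := by nlinarith [sq_nonneg (ζ' - n)]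
  have h4 : ζ' ^ 2 ≤ ζ ^ 2 + C₁ * n ^ 2 := by
    have h5 : 0 ≤ β * m * ζ ^ 2 := by positivity
    have h6 : β * (C₁ * n ^ 2) ≤ 1 * (C₁ * n ^ 2) :=
      mul_le_mul_of_nonneg_right hβ1 (by positivity)
    linarith
  have h5 : (ζ' + n) ^ 2 ≤ 2 * (1 + C₁) * (ζ ^ 2 + n ^ 2) := by
    have : 0 ≤ C₁ * ζ ^ 2 := by positivity
    linarith
  have h6 : α * ω * (C₅ / ω * (ζ' + n)) ^ 2 ≤
      α * (2 * C₅ ^ 2 / ω * (1 + C₁)) * (ζ ^ 2 + n ^ 2) := by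
    calc _ = α * (C₅ ^ 2 / ω) * (ζ' + n) ^ 2 := by field_simp
      _ ≤ α * (C₅ ^ 2 / ω) * (2 * (1 + C₁) * (ζ ^ 2 + n ^ 2)) :=
          mul_le_mul_of_nonneg_left h5 (by positivity)
      _ = _ := by ring
  linarith

/-- The slow error and the weighted tracking error decrease together. -/
theorem lyapunov_sq_le {m ω g K C₆ C₈ a α β e n ζ ζ₁ e₁ : ℝ} (hm : 0 < m)
    (hC₆ : 0 ≤ C₆) (ha : a = 8 * C₆ / m) (hα : 0 < α) (hβ : 0 < β) (hgα : g * α ≤ β * m / 8)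
    (h2 : a * (K * (α / β) ^ 2) ≤ ω - g)
    (hZ : ζ₁ ^ 2 ≤ (1 - 3 / 8 * (β * m)) * ζ ^ 2 + β * C₈ * n ^ 2 + K * (α / β) * α * e ^ 2)
    (hE : e₁ ^ 2 ≤ (1 - α * ω) * e ^ 2 + α * C₆ * (ζ ^ 2 + n ^ 2)) :
    e₁ ^ 2 + a * (α / β) * ζ₁ ^ 2 ≤
      (1 - g * α) * (e ^ 2 + a * (α / β) * ζ ^ 2) + α * (C₆ + a * C₈) * n ^ 2 := by
  have ha0 : 0 ≤ a := by rw [ha]; positivity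
  have hr0 : 0 < α / β := div_pos hα hβ
  have h1 := mul_le_mul_of_nonneg_left hZ (mul_nonneg ha0 hr0.le)
  have e1 : a * (α / β) * (β * C₈ * n ^ 2) = α * (a * C₈) * n ^ 2 := by field_simp
  -- `a` is such that the decay of the weighted tracking error outweighs its effect on `e₁ ^ 2`
  have e2 : a * (α / β) * (3 / 8 * (β * m) * ζ ^ 2) = 3 * (α * C₆) * ζ ^ 2 := by
    rw [ha]; field_simp
  have e3 : a * (α / β) * (K * (α / β) * α * e ^ 2) = α * (a * (K * (α / β) ^ 2)) * e ^ 2 := by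
    ring
  have h3 := mul_le_mul_of_nonneg_right (mul_le_mul_of_nonneg_left h2 hα.le) (sq_nonneg e)
  have h4 : a * (α / β) * (g * α * ζ ^ 2) ≤ α * C₆ * ζ ^ 2 := by
    have h5 : a * (α / β) * (g * α * ζ ^ 2) ≤ a * (α / β) * (β * m / 8 * ζ ^ 2) := by gcongr
    refine h5.trans_eq ?_
    rw [ha]; field_simp
  have h6 : 0 ≤ α * C₆ * ζ ^ 2 := by positivity
  linarith

/-- The Lyapunov function weighs the tracking error with the ratio of the step sizes, because the
noise `n` enters the tracking error at the fast rate `β` but decays at the slow rate `α` only. -/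
theorem exists_lyapunov_step {m ω g C₁ C₂ C₅ c : ℝ} (hm : 0 < m) (hg : 0 < g) (hω : g < ω)
    (hω1 : ω ≤ 1) (hC₁ : 0 ≤ C₁) (hc : 0 ≤ c) :
    ∃ κ > 0, ∃ a ≥ 0, ∃ C₇ ≥ 0, ∃ C₈ ≥ 0, κ ≤ 1 ∧ ∀ α β : ℝ, 0 < α → α ≤ κ * β → β ≤ 1 →
      β * m ≤ 1 → g * α ≤ β * m / 8 ∧ ∀ e n ζ ζ' ζ₁ Δ e₁ : ℝ, 0 ≤ n → 0 ≤ ζ' → 0 ≤ ζ₁ → 0 ≤ Δ →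
        0 ≤ e₁ →
        ζ' ^ 2 ≤ (1 - β * m) * ζ ^ 2 + β * C₁ * n ^ 2 →
        Δ ≤ α * (C₂ * (ζ' + e + n)) → ζ₁ ≤ ζ' + c * Δ →
        e₁ ≤ (1 - α * ω) * e + α * (C₅ * (ζ' + n)) →
        e₁ ^ 2 + a * (α / β) * ζ₁ ^ 2 ≤
          (1 - g * α) * (e ^ 2 + a * (α / β) * ζ ^ 2) + α * C₇ * n ^ 2 ∧
        ζ₁ ^ 2 ≤ (1 - β * m / 4) * ζ ^ 2 + β * C₈ * (e ^ 2 + n ^ 2) := by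
  have hω0 : 0 < ω := hg.trans hω
  set K := 9 * (c * C₂) ^ 2 / m with hK
  have hK0 : 0 ≤ K := by positivity
  set C₆ := 2 * C₅ ^ 2 / ω * (1 + C₁) with hC₆
  have hC₆0 : 0 ≤ C₆ := by positivity
  set a := 8 * C₆ / m with ha
  have ha0 : 0 ≤ a := by positivity
  set C₈ := 2 * C₁ + m / 8 with hC₈
  have hC₈0 : 0 ≤ C₈ := by positivity
  -- besides `κ ≤ 1`, the bounds on `κ` serve `hr` of `tracking_sq_le` and then `hgα` and `h2` of
  -- `lyapunov_sq_le`
  set κ := min (min 1 (m / (8 * (K + 1)))) (min (m / (8 * (g + 1))) ((ω - g) / (a * K + 1))) with hκ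
  have hκ0 : 0 < κ := by
    have := sub_pos.2 hω
    refine lt_min (lt_min one_pos (by positivity)) (lt_min (by positivity) (by positivity))
  have hκ1 : κ ≤ 1 := (min_le_left _ _).trans (min_le_left _ _)
  have hκ2 : κ * (8 * (K + 1)) ≤ m :=
    (le_div_iff₀ (by positivity)).1 ((min_le_left _ _).trans (min_le_right _ _))
  have hκ3 : κ * (8 * (g + 1)) ≤ m :=
    (le_div_iff₀ (by positivity)).1 ((min_le_right _ _).trans (min_le_left _ _))
  have hκ4 : κ * (a * K + 1) ≤ ω - g :=
    (le_div_iff₀ (by positivity)).1 ((min_le_right _ _).trans (min_le_right _ _))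
  clear_value κ a C₈ C₆ K
  refine ⟨κ, hκ0, a, ha0, C₆ + a * C₈, by positivity, C₈, hC₈0, hκ1, fun α β hα hαβ hβ1 hβm => ?_⟩
  have hβ : 0 < β := by
    by_contra hneg
    push Not at hneg
    nlinarith
  have hr : α / β ≤ κ := (div_le_iff₀ hβ).2 hαβ
  have hr0 : 0 < α / β := div_pos hα hβ
  have hα1 : α ≤ 1 := hαβ.trans ((mul_le_of_le_one_left hβ.le hκ1).trans hβ1)
  have hgα : g * α ≤ β * m / 8 := by
    have h1 := mul_le_mul_of_nonneg_left hαβ hg.le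
    have h2 := mul_le_mul_of_nonneg_right hκ3 hβ.le
    have h3 : 0 ≤ κ * β := by positivity
    linarith
  have hr2 : K * (α / β) ^ 2 ≤ κ * K := by
    have h1 : (α / β) ^ 2 ≤ κ ^ 2 := pow_le_pow_left₀ hr0.le hr 2
    have h2 : κ ^ 2 ≤ κ := pow_le_of_le_one hκ0.le hκ1 two_ne_zero
    rw [mul_comm κ]
    exact mul_le_mul_of_nonneg_left (h1.trans h2) hK0
  refine ⟨hgα, fun e n ζ ζ' ζ₁ Δ e₁ hn hζ' hζ₁ hΔ he₁ F1 F2 F3 F4 => ?_⟩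
  have hZ := tracking_sq_le hm hC₁ hc hα hβ hβm (by rw [← hK]; linarith) hζ₁ hΔ F1 F2 F3
  rw [← hK, ← hC₈] at hZ
  have hKr : K * (α / β) * α = K * (α / β) ^ 2 * β := by field_simp
  have hαω : α * ω ≤ 1 := mul_le_one₀ hα1 hω0.le hω1
  have hE := slow_sq_le hω0 hm hC₁ hα.le hαω hβ.le hβ1 he₁ F1 F4
  rw [← hC₆] at hE
  constructor
  · refine lyapunov_sq_le hm hC₆0 ha hα hβ hgα ?_ hZ hE
    have := mul_le_mul_of_nonneg_left hr2 ha0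
    have : a * (κ * K) = κ * (a * K) := by ring
    linarith
  · have h1 : K * (α / β) * α * e ^ 2 ≤ β * C₈ * e ^ 2 := by
      refine mul_le_mul_of_nonneg_right ?_ (sq_nonneg e)
      rw [hKr, mul_comm β]
      refine mul_le_mul_of_nonneg_right ?_ hβ.le
      linarith
    have h2 : 0 ≤ β * m * ζ ^ 2 := by positivity
    clear F1 F2 F3 F4 hE hκ2 hκ3 hκ4 hr2 hKr hgα hC₆ ha hK hC₈
    linarith

end RiskGame

/-! ### Lyapunov bounds for one episode -/

namespace RiskGame

universe u v

section Bounds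

variable {S : Type u} [Fintype S] {A : Fin 2 → Type v} [∀ i, Fintype (A i)]

/-- The squared error of the noiseless part `Q - N` of the critic. -/
noncomputable def slowError (QS Q N : QFun S A) : ℝ := ‖(Q - N) - QS‖ ^ 2

/-- The squared distance of `z` from the stage equilibria `zt (Q - N)` of the noiseless part of the
critic. -/
noncomputable def trackError (zt : QFun S A → S → Profile A) (z : S → Profile A)
    (Q N : QFun S A) : ℝ := ‖embAll z - embAll (zt (Q - N))‖ ^ 2

variable {M : MarkovGame S A} {G : Risk A} {L m : ℝ} {l : Fin 2 → ℝ}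
  [∀ i, DecidableEq (A i)] [∀ i, Nonempty (A i)]

/-- One episode decreases the Lyapunov function, up to the noise, and the tracking error obeys a
recursion of its own, with constants that do not depend on the ratio of the step sizes. -/
theorem MarkovGame.exists_episode_bounds (hm : 0 < m) (hl : ∀ i, 0 < l i)
    (hmono : ∀ (Q : QFun S A) (s : S), G.StronglyMonotone m l (stage Q s))
    (hL : 0 ≤ L) (hs : G.Smooth L) {γ₀ : ℝ} (hγ₀ : γ₀ ∈ Set.Ico (0 : ℝ) 1)
    (hcontr : ∀ Q Q' : QFun S A, ‖M.bellman G Q - M.bellman G Q'‖ ≤ γ₀ * ‖Q - Q'‖)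
    {QS : QFun S A} (hQS : M.bellman G QS = QS) {zt : QFun S A → S → Profile A}
    (hzt : ∀ Q s, G.IsEq (stage Q s) (zt Q s)) {q : ℝ} (hq : 0 ≤ q) {w g : ℝ} (hw : 0 < w)
    (hg : 0 < g) (hgw : g < w * (1 - γ₀)) (hw1 : w ≤ 1) :
    ∃ κ > 0, ∃ b > 0, ∃ a ≥ 0, ∃ C₇ ≥ 0, ∃ C₈ ≥ 0, ∀ α β : ℝ, 0 < α → α ≤ κ * β → β ≤ b →
      0 < β ∧ α ≤ 1 ∧ g * α ≤ β * m / 8 ∧ β * m ≤ 1 ∧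
      ∀ (z : S → Profile A) (Q N : QFun S A) (W : S → (∀ j, A j) → ℝ) (n : ℝ), ‖Q‖ ≤ q →
        (∀ s a, w ≤ W s a) → (∀ s a, W s a ≤ 1) → ‖N‖ ≤ n →
        ∀ Q' N' : QFun S A, Q' - N' = meanUpdate α W (M.lookahead G (G.actor l β z Q) Q) Q N →
        slowError QS Q' N' + a * (α / β) * trackError zt (G.actor l β z Q) Q' N' ≤
          (1 - g * α) * (slowError QS Q N + a * (α / β) * trackError zt z Q N) +
            α * C₇ * n ^ 2 ∧
        trackError zt (G.actor l β z Q) Q' N' ≤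
          (1 - β * m / 4) * trackError zt z Q N + β * C₈ * (slowError QS Q N + n ^ 2) := by
  obtain ⟨c, hc0, hc⟩ := exists_norm_grad_sub_le hL hs hl
  obtain ⟨c', hc0', hc'⟩ := exists_norm_grad_sub_payoff_le G hl
  obtain ⟨k, hk0, hk⟩ := hs.exists_abs_cost_sub_le hL
  have hk1 : 0 ≤ k * (1 + q) := by positivity
  have h1γ : 0 < 1 - γ₀ := sub_pos.2 hγ₀.2
  have hω1 : w * (1 - γ₀) ≤ 1 := mul_le_one₀ hw1 h1γ.le (by linarith [hγ₀.1])
  have hC₁ : 0 ≤ (2 / m + 2) * c' ^ 2 := by positivity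
  obtain ⟨κ, hκ, a, ha, C₇, hC₇, C₈, hC₈, hκ1, key⟩ := exists_lyapunov_step
    (C₂ := k * (1 + q) + 3) (C₅ := k * (1 + q) + 3) hm hg hgw hω1 hC₁
    (div_nonneg hc0' hm.le)
  -- the bound `q` on the critic makes the Lipschitz constants of the stage gradients uniform
  set Λ := 4 * (c * (1 + q)) ^ 2 with hΛ
  have hΛ0 : 0 ≤ Λ := by positivity
  refine ⟨κ, hκ, min (min 1 (1 / m)) (m / (Λ + 1)), by positivity, a, ha, C₇, hC₇, C₈, hC₈,
    fun α β hα hαβ hβb => ?_⟩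
  have hβ1 : β ≤ 1 := hβb.trans ((min_le_left _ _).trans (min_le_left _ _))
  have hβm : β * m ≤ 1 :=
    (le_div_iff₀ hm).1 (hβb.trans ((min_le_left _ _).trans (min_le_right _ _)))
  have hβ : 0 < β := by
    by_contra hneg
    push Not at hneg
    nlinarith
  have hβΛ : β * Λ ≤ m := by
    have h1 : β * (Λ + 1) ≤ m := (le_div_iff₀ (by positivity)).1 (hβb.trans (min_le_right _ _))
    linarith
  have hα1 : α ≤ 1 := hαβ.trans ((mul_le_of_le_one_left hβ.le hκ1).trans hβ1)
  obtain ⟨hgα, key⟩ := key α β hα hαβ hβ1 hβm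
  refine ⟨hβ, hα1, hgα, hβm, fun z Q N W n hQ hW hW1 hn Q' N' hQ' => ?_⟩
  set z' := G.actor l β z Q with hz'
  have hW0 : ∀ s a, 0 ≤ W s a := fun s a => hw.le.trans (hW s a)
  have hn0 : 0 ≤ n := (norm_nonneg N).trans hn
  have hNn : ‖Q - (Q - N)‖ ≤ n := by rwa [sub_sub_cancel]
  -- the lookahead with the new profile is close to the Bellman update of `Q - N`
  have hd : ‖M.lookahead G z' Q - M.bellman G (Q - N)‖ ≤
      k * (1 + q) * ‖embAll z' - embAll (zt (Q - N))‖ + n := by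
    rw [M.bellman_eq_lookahead hm hl hs hmono (hzt (Q - N))]
    refine (M.norm_lookahead_sub_le hk0 hk z' (zt (Q - N)) Q (Q - N)).trans (add_le_add ?_ hNn)
    gcongr
  have hT : ‖M.bellman G (Q - N) - QS‖ ≤ γ₀ * ‖(Q - N) - QS‖ := by
    have := hcontr (Q - N) QS
    rwa [hQS] at this
  rw [slowError, slowError, trackError, trackError, hQ']
  refine key ‖(Q - N) - QS‖ n ‖embAll z - embAll (zt (Q - N))‖
    ‖embAll z' - embAll (zt (Q - N))‖ _ ‖meanUpdate α W (M.lookahead G z' Q) Q N - (Q - N)‖ _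
    hn0 (norm_nonneg _) (norm_nonneg _) (norm_nonneg _) (norm_nonneg _) ?_ ?_ ?_ ?_
  · have h4 : 4 * β * (c * (1 + ‖Q‖)) ^ 2 ≤ m := by
      have : 4 * β * (c * (1 + ‖Q‖)) ^ 2 ≤ 4 * β * (c * (1 + q)) ^ 2 := by gcongr
      linarith
    refine (norm_actor_sub_sq_le hc0 hm hl hmono hc hc0' hc' hβ.le hβ1 hβm h4 z
      (hzt (Q - N))).trans ?_
    gcongr
  · refine (norm_meanUpdate_sub_self_le hα.le hW0 hW1 hγ₀.2.le hd hT).trans ?_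
    refine mul_le_mul_of_nonneg_left ?_ hα.le
    have := mul_nonneg hk1 hn0
    have := mul_nonneg hk1 (norm_nonneg ((Q - N) - QS))
    have := norm_nonneg ((Q - N) - QS)
    have := norm_nonneg (embAll z' - embAll (zt (Q - N)))
    linarith
  · have h5 := norm_embAll_sub_le_of_isEq hm hl hc0' hc' hmono (hzt (Q - N))
      (hzt (meanUpdate α W (M.lookahead G z' Q) Q N))
    rw [norm_sub_rev (Q - N)] at h5
    refine (norm_sub_le_norm_sub_add_norm_sub _ (embAll (zt (Q - N))) _).trans ?_
    linarith
  · refine (norm_meanUpdate_sub_le hα.le hα1 hW0 hW1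
      (fun s a => mul_le_mul_of_nonneg_right (hW s a) h1γ.le) hd hT hω1).trans ?_
    refine add_le_add le_rfl (mul_le_mul_of_nonneg_left ?_ hα.le)
    have := mul_nonneg hk1 hn0
    have := norm_nonneg (embAll z' - embAll (zt (Q - N)))
    linarith

end Bounds

end RiskGame

/-! ### Expectations and sampled trajectories -/

namespace RiskGame

universe u v w

section Expectation

variable {X : Type u} {Y : Type v}

/-- The expectation of a real function under a law on a finite type. -/
noncomputable def fmean [Fintype X] (p : PMF X) (g : X → ℝ) : ℝ := ∑ x, (p x).toReal * g x

theorem fmean_add [Fintype X] (p : PMF X) (f g : X → ℝ) :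
    fmean p (fun x => f x + g x) = fmean p f + fmean p g := by
  simp only [fmean, mul_add, Finset.sum_add_distrib]

theorem fmean_const_mul [Fintype X] (p : PMF X) (r : ℝ) (g : X → ℝ) :
    fmean p (fun x => r * g x) = r * fmean p g := by
  simp only [fmean, Finset.mul_sum]
  exact Finset.sum_congr rfl fun x _ => by ring

theorem fmean_const [Fintype X] (p : PMF X) (r : ℝ) : fmean p (fun _ => r) = r := by
  rw [fmean, ← Finset.sum_mul, sum_toReal_eq_one, one_mul]

theorem fmean_mono [Fintype X] (p : PMF X) {f g : X → ℝ} (h : ∀ x, f x ≤ g x) :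
    fmean p f ≤ fmean p g :=
  Finset.sum_le_sum fun x _ => mul_le_mul_of_nonneg_left (h x) ENNReal.toReal_nonneg

theorem fmean_sum [Fintype X] {ι : Type*} (s : Finset ι) (p : PMF X) (f : ι → X → ℝ) :
    fmean p (fun x => ∑ i ∈ s, f i x) = ∑ i ∈ s, fmean p (f i) := by
  simp only [fmean, Finset.mul_sum]
  exact Finset.sum_comm

theorem fmean_pure [Fintype X] (x : X) (g : X → ℝ) : fmean (PMF.pure x) g = g x := by
  classical
  rw [fmean, Finset.sum_eq_single x (fun y _ hy => by simp [PMF.pure_apply, hy]) (by simp)]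
  simp

theorem fmean_bind [Fintype X] [Fintype Y] (p : PMF X) (f : X → PMF Y) (g : Y → ℝ) :
    fmean (p.bind f) g = fmean p fun x => fmean (f x) g := by
  simp only [fmean, PMF.bind_apply, tsum_fintype, Finset.mul_sum]
  rw [Finset.sum_comm]
  refine Finset.sum_congr rfl fun y _ => ?_
  rw [ENNReal.toReal_sum fun x _ => ENNReal.mul_ne_top (p.apply_ne_top x) ((f x).apply_ne_top y),
    Finset.sum_mul]
  exact Finset.sum_congr rfl fun x _ => by rw [ENNReal.toReal_mul, mul_assoc]

theorem fmean_map [Fintype X] [Fintype Y] (p : PMF X) (f : X → Y) (g : Y → ℝ) :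
    fmean (p.map f) g = fmean p fun x => g (f x) := by
  rw [← PMF.bind_pure_comp, fmean_bind]
  simp only [Function.comp, fmean_pure]

theorem expect_bind (p : PMF X) (f : X → PMF Y) (g : Y → ℝ≥0∞) :
    expect (p.bind f) g = expect p fun x => expect (f x) g := by
  simp only [expect, PMF.bind_apply, ← ENNReal.tsum_mul_right, ← ENNReal.tsum_mul_left, mul_assoc]
  exact ENNReal.tsum_comm

theorem expect_pure (x : X) (g : X → ℝ≥0∞) : expect (PMF.pure x) g = g x := by
  classical
  rw [expect, tsum_eq_single x (fun y hy => by simp [PMF.pure_apply, hy])]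
  simp

theorem expect_map (p : PMF X) (f : X → Y) (g : Y → ℝ≥0∞) :
    expect (p.map f) g = expect p fun x => g (f x) := by
  rw [← PMF.bind_pure_comp, expect_bind]
  simp only [Function.comp, expect_pure]

theorem expect_mono (p : PMF X) {f g : X → ℝ≥0∞} (h : ∀ x ∈ p.support, f x ≤ g x) :
    expect p f ≤ expect p g := by
  refine ENNReal.tsum_le_tsum fun x => ?_
  by_cases hx : x ∈ p.support
  · exact mul_le_mul_right (h x hx) _
  · rw [p.apply_eq_zero_iff x |>.2 hx, zero_mul, zero_mul]

theorem expect_add (p : PMF X) (f g : X → ℝ≥0∞) :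
    expect p (fun x => f x + g x) = expect p f + expect p g := by
  simp only [expect, mul_add]
  exact ENNReal.tsum_add

theorem expect_const_mul (p : PMF X) (r : ℝ≥0∞) (g : X → ℝ≥0∞) :
    expect p (fun x => r * g x) = r * expect p g := by
  simp only [expect, ← ENNReal.tsum_mul_left]
  exact tsum_congr fun x => by ring

theorem expect_const (p : PMF X) (r : ℝ≥0∞) : expect p (fun _ => r) = r := by
  rw [expect, ENNReal.tsum_mul_right, p.tsum_coe, one_mul]

theorem expect_ofReal [Fintype X] (p : PMF X) {g : X → ℝ} (hg : ∀ x, 0 ≤ g x) :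
    expect p (fun x => ENNReal.ofReal (g x)) = ENNReal.ofReal (fmean p g) := by
  rw [expect, tsum_fintype, fmean,
    ENNReal.ofReal_sum_of_nonneg fun x _ => mul_nonneg ENNReal.toReal_nonneg (hg x)]
  refine Finset.sum_congr rfl fun x _ => ?_
  rw [ENNReal.ofReal_mul ENNReal.toReal_nonneg, ENNReal.ofReal_toReal (p.apply_ne_top x)]

/-- Second moment of a damped variable after adding centred noise. -/
theorem fmean_sq_le [Fintype X] (p : PMF X) {δ : X → ℝ} {b α N : ℝ} (hb : ∀ x, |δ x| ≤ b)
    (hα : 0 ≤ α) (hα1 : α ≤ 1) :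
    fmean p (fun x => ((1 - α) * N + α * (δ x - fmean p δ)) ^ 2) ≤
      (1 - α) * N ^ 2 + α ^ 2 * b ^ 2 := by
  set μ := fmean p δ with hμ
  have e : (fun x => ((1 - α) * N + α * (δ x - μ)) ^ 2) = fun x =>
      (((1 - α) * N - α * μ) ^ 2 + (2 * α * ((1 - α) * N - α * μ)) * δ x) + α ^ 2 * δ x ^ 2 := by
    funext x; ring
  have h2 : fmean p (fun x => δ x ^ 2) ≤ b ^ 2 := by
    refine (fmean_mono p fun x => ?_).trans_eq (fmean_const p (b ^ 2))
    exact sq_le_sq' (abs_le.1 (hb x)).1 (abs_le.1 (hb x)).2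
  rw [e, fmean_add, fmean_add, fmean_const, fmean_const_mul, fmean_const_mul, ← hμ]
  have h3 := mul_le_mul_of_nonneg_left h2 (sq_nonneg α)
  have h4 : (1 - α) ^ 2 * N ^ 2 ≤ (1 - α) * N ^ 2 := by
    refine mul_le_mul_of_nonneg_right ?_ (sq_nonneg N)
    nlinarith
  nlinarith [mul_nonneg (sq_nonneg α) (sq_nonneg μ)]

end Expectation

section Rollout

variable {S : Type u} {A : Fin 2 → Type v} [∀ i, Fintype (A i)]

theorem actProb_nonneg (x : Policy S A) (s : S) (a : ∀ j, A j) : 0 ≤ actProb x s a :=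
  Finset.prod_nonneg fun i _ => (x s i).2.1 _

theorem toReal_jointLaw (x : Policy S A) (s : S) (a : ∀ j, A j) :
    (jointLaw (x s) a).toReal = actProb x s a := by
  rw [jointLaw, PMF.ofFintype_apply, ENNReal.toReal_prod]
  exact Finset.prod_congr rfl fun i _ => ENNReal.toReal_ofReal ((x s i).2.1 _)

theorem sum_actProb (x : Policy S A) (s : S) : ∑ a, actProb x s a = 1 := by
  simp only [← toReal_jointLaw]
  exact sum_toReal_eq_one _

theorem actProb_le_one (x : Policy S A) (s : S) (a : ∀ j, A j) : actProb x s a ≤ 1 :=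
  sum_actProb x s ▸ Finset.single_le_sum (fun a _ => actProb_nonneg x s a) (Finset.mem_univ a)

variable [Fintype S] [DecidableEq S] (M : MarkovGame S A)

theorem MarkovGame.trans_actProb_mem (x : Policy S A) :
    M.trans (actProb x) ∈ Matrix.rowStochastic ℝ S :=
  M.trans_mem (actProb_nonneg x) (sum_actProb x)

/-- The expectation of an additive functional of a sampled trajectory. -/
theorem MarkovGame.fmean_rollout_sum (x : Policy S A) (φ : S × (∀ j, A j) × S → ℝ) (n : ℕ) (s : S) :
    fmean (M.rollout x n s) (fun w => ∑ k, φ (w.1 k)) =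
      ∑ k ∈ Finset.range n, ∑ s', (M.trans (actProb x) ^ k) s s' *
        ∑ a, actProb x s' a * ∑ s'', (M.P s' a s'').toReal * φ (s', a, s'') := by
  induction n generalizing s with
  | zero => simp [fmean]
  | succ n ih =>
    set Φ : S → ℝ := fun s' =>
      ∑ a, actProb x s' a * ∑ s'', (M.P s' a s'').toReal * φ (s', a, s'') with hΦ
    have h1 : ∀ a s', fmean ((M.rollout x n s').map fun w =>
        ((Fin.cons (s, a, s') w.1, w.2) : (Fin (n + 1) → S × (∀ j, A j) × S) × S))
        (fun w => ∑ k, φ (w.1 k)) = φ (s, a, s') +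
          ∑ k ∈ Finset.range n, ∑ s'', (M.trans (actProb x) ^ k) s' s'' * Φ s'' := fun a s' => by
      rw [fmean_map]
      simp only [Fin.sum_univ_succ, Fin.cons_zero, Fin.cons_succ]
      rw [fmean_add, fmean_const, ih]
    rw [MarkovGame.rollout, fmean_bind]
    simp only [fmean_bind, h1, fmean_add]
    rw [Finset.sum_range_succ', add_comm]
    congr 1
    · simp only [fmean, toReal_jointLaw, pow_succ', Matrix.mul_apply]
      have e : ∀ k, ∑ s', (∑ j, M.trans (actProb x) s j * (M.trans (actProb x) ^ k) j s') * Φ s' =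
          ∑ a, actProb x s a * ∑ j, (M.P s a j).toReal *
            ∑ s', (M.trans (actProb x) ^ k) j s' * Φ s' := fun k => by
        rw [← M.sum_trans_mul]
        simp only [Finset.sum_mul, Finset.mul_sum, mul_assoc]
        exact Finset.sum_comm
      rw [Finset.sum_congr rfl fun k _ => e k, Finset.sum_comm]
      refine Finset.sum_congr rfl fun a _ => ?_
      simp only [Finset.mul_sum]
      rw [Finset.sum_comm]
    · simp only [fmean, toReal_jointLaw, pow_zero, Matrix.one_apply, ite_mul, one_mul, zero_mul,
        Finset.sum_ite_eq, Finset.mem_univ, if_true]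

/-- The expected frequency of the pair `(s, a)` among `K` transitions from `s₀`. -/
noncomputable def MarkovGame.visitFreq (x : Policy S A) (K : ℕ) (s₀ s : S) (a : ∀ j, A j) : ℝ :=
  (1 / (K : ℝ)) * ∑ k ∈ Finset.range K, (M.trans (actProb x) ^ k) s₀ s * actProb x s a

theorem MarkovGame.visitFreq_le_one (x : Policy S A) {K : ℕ} (hK : 1 ≤ K) (s₀ s : S)
    (a : ∀ j, A j) : M.visitFreq x K s₀ s a ≤ 1 := by
  have hK' : (0 : ℝ) < K := by exact_mod_cast hK
  rw [MarkovGame.visitFreq, one_div_mul_eq_div, div_le_one hK']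
  have h : ∑ k ∈ Finset.range K, (M.trans (actProb x) ^ k) s₀ s * actProb x s a ≤
      ∑ k ∈ Finset.range K, (1 : ℝ) := Finset.sum_le_sum fun k _ =>
    mul_le_one₀ (Matrix.le_one_of_mem_rowStochastic (pow_mem (M.trans_actProb_mem x) k))
      (actProb_nonneg x s a) (actProb_le_one x s a)
  simpa using h

variable {M}

/-- By ergodicity, long episodes visit all pairs with frequency bounded below, whatever the initial
state; the episode length is such that the mixing error takes less than `2 / 5` of the bound. -/
theorem MarkovGame.Ergodic.le_visitFreq {low C ρ γ₀ piLow : ℝ} (h : M.Ergodic low C ρ)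
    (hlow : 0 < low) (hρ : ρ ∈ Set.Ioo (0 : ℝ) 1) (hγ₀ : γ₀ ∈ Set.Ico (0 : ℝ) 1) (hpi : 0 < piLow)
    (hpi1 : piLow ≤ 1) {K : ℕ} (hK : 1 ≤ K)
    (hKC : 4 * Real.sqrt 2 * C / ((1 - ρ) * (1 - γ₀) * (low * piLow)) ≤ K) (x : Policy S A)
    (s₀ s : S) (a : ∀ j, A j) (hx : piLow ≤ actProb x s a) :
    3 / 5 * (low * piLow) ≤ M.visitFreq x K s₀ s a := by
  have hK' : (0 : ℝ) < K := by exact_mod_cast hK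
  obtain ⟨d, hd, -, hconv⟩ := h x
  have hρ1 : 0 < 1 - ρ := sub_pos.2 hρ.2
  have hγ1 : 0 < 1 - γ₀ := sub_pos.2 hγ₀.2
  have h1 : ∀ k, low - 2 * C * ρ ^ k ≤ (M.trans (actProb x) ^ k) s₀ s := fun k => by
    have h2 := hconv k s₀
    have h3 := Finset.single_le_sum
      (f := fun s' => |(M.trans (actProb x) ^ k) s₀ s' - d s'|) (fun s' _ => abs_nonneg _)
      (Finset.mem_univ s)
    have h4 := neg_le_of_abs_le (h3.trans (by linarith :
      ∑ s', |(M.trans (actProb x) ^ k) s₀ s' - d s'| ≤ 2 * C * ρ ^ k))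
    linarith [hd s]
  have hC : 0 ≤ C := by
    have h2 := hconv 0 s₀
    have h3 : 0 ≤ ∑ s', |(M.trans (actProb x) ^ 0) s₀ s' - d s'| :=
      Finset.sum_nonneg fun _ _ => abs_nonneg _
    rw [pow_zero ρ] at h2
    linarith
  have hgeom : ∑ k ∈ Finset.range K, ρ ^ k ≤ 1 / (1 - ρ) := by
    rw [one_div, ← tsum_geometric_of_lt_one hρ.1.le hρ.2]
    exact (summable_geometric_of_lt_one hρ.1.le hρ.2).sum_le_tsum _
      fun k _ => pow_nonneg hρ.1.le k
  have hsum : (K : ℝ) * low - 2 * C * (1 / (1 - ρ)) ≤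
      ∑ k ∈ Finset.range K, (M.trans (actProb x) ^ k) s₀ s := by
    refine le_trans ?_ (Finset.sum_le_sum fun k _ => h1 k)
    rw [Finset.sum_sub_distrib, ← Finset.mul_sum, Finset.sum_const, Finset.card_range,
      nsmul_eq_mul]
    have := mul_le_mul_of_nonneg_left hgeom (by positivity : 0 ≤ 2 * C)
    linarith
  have hbias : 2 * C * (1 / (1 - ρ)) ≤ 2 / 5 * (K * low) := by
    rw [div_le_iff₀ (by positivity)] at hKC
    -- `5 * C ≤ 4 * √2 * C ≤ K * low * (1 - ρ)`
    have h2 : (5 / 4 : ℝ) ≤ Real.sqrt 2 := Real.le_sqrt_of_sq_le (by norm_num)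
    have h3 : (1 - γ₀) * piLow ≤ 1 := mul_le_one₀ (by linarith [hγ₀.1]) hpi.le hpi1
    have h4 : (K : ℝ) * low * (1 - ρ) * ((1 - γ₀) * piLow) ≤ K * low * (1 - ρ) * 1 :=
      mul_le_mul_of_nonneg_left h3 (by positivity)
    have h5 : 4 * (5 / 4) * C ≤ 4 * Real.sqrt 2 * C := by gcongr
    rw [mul_one_div, div_le_iff₀ hρ1]
    linarith
  have hlow' : 3 / 5 * (K * low) ≤ ∑ k ∈ Finset.range K, (M.trans (actProb x) ^ k) s₀ s := by
    linarith
  rw [MarkovGame.visitFreq, ← Finset.sum_mul, one_div_mul_eq_div, le_div_iff₀ hK']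
  calc 3 / 5 * (low * piLow) * K = 3 / 5 * (K * low) * piLow := by ring
    _ ≤ _ := mul_le_mul hlow' hx hpi.le (le_trans (by positivity) hlow')

variable (M) [∀ i, DecidableEq (A i)]

/-- The temporal-difference update has no bias beyond the visit frequencies: given a visited pair,
the target has the right conditional mean whatever the law of the visits. -/
theorem MarkovGame.fmean_delta (G : Risk A) (x : Policy S A) (K : ℕ) (s₀ : S) (z : S → Profile A)
    (Q : QFun S A) (i : Fin 2) (s : S) (a : ∀ j, A j) :
    fmean (M.rollout x K s₀) (fun w => M.delta G z Q w.1 i s a) =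
      M.visitFreq x K s₀ s a * (M.lookahead G z Q i s a - Q i s a) := by
  simp only [MarkovGame.delta]
  rw [fmean_const_mul, M.fmean_rollout_sum x (fun v => if v.1 = s ∧ v.2.1 = a then
    M.target G z Q i v - Q i s a else 0)]
  have h1 : ∀ s', ∑ b, actProb x s' b * ∑ s'', (M.P s' b s'').toReal *
      (if s' = s ∧ b = a then M.target G z Q i (s', b, s'') - Q i s a else 0) =
      if s' = s then actProb x s a * (M.lookahead G z Q i s a - Q i s a) else 0 := fun s' => by
    split_ifs with h
    · subst h
      rw [Finset.sum_eq_single a (fun b _ hb => by simp [hb]) (by simp)]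
      congr 1
      simp only [and_self, if_true, M.target_eq, mul_sub, mul_add, Finset.sum_sub_distrib,
        Finset.sum_add_distrib, ← Finset.sum_mul, sum_toReal_eq_one, one_mul,
        MarkovGame.lookahead]
      rw [Finset.mul_sum]
      congr 2
      exact Finset.sum_congr rfl fun s'' _ => by ring
    · simp [h]
  simp only [h1]
  simp only [mul_ite, mul_zero, Finset.sum_ite_eq', Finset.mem_univ, if_true]
  rw [MarkovGame.visitFreq, mul_assoc, Finset.sum_mul]
  congr 1
  exact Finset.sum_congr rfl fun k _ => by ring

end Rollout

end RiskGame

/-! ### The algorithm with its accumulated noise -/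

namespace RiskGame

universe u v

section Noise

variable {S : Type u} [Fintype S] {A : Fin 2 → Type v} [∀ i, Fintype (A i)]

/-- The squared Euclidean norm of a pair of Q functions. -/
def sumSq (N : QFun S A) : ℝ := ∑ i, ∑ s, ∑ a, N i s a ^ 2

theorem sumSq_nonneg (N : QFun S A) : 0 ≤ sumSq N :=
  Finset.sum_nonneg fun _ _ => Finset.sum_nonneg fun _ _ => Finset.sum_nonneg fun _ _ => sq_nonneg _

theorem sq_le_sumSq (N : QFun S A) (i : Fin 2) (s : S) (a : ∀ j, A j) : N i s a ^ 2 ≤ sumSq N := by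
  have h1 := Finset.single_le_sum (f := fun a => N i s a ^ 2) (fun _ _ => sq_nonneg _)
    (Finset.mem_univ a)
  have h2 := Finset.single_le_sum (f := fun s => ∑ a, N i s a ^ 2)
    (fun _ _ => Finset.sum_nonneg fun _ _ => sq_nonneg _) (Finset.mem_univ s)
  have h3 := Finset.single_le_sum (f := fun i => ∑ s, ∑ a, N i s a ^ 2)
    (fun _ _ => Finset.sum_nonneg fun _ _ => Finset.sum_nonneg fun _ _ => sq_nonneg _)
    (Finset.mem_univ i)
  exact h1.trans (h2.trans h3)

theorem norm_le_sqrt_sumSq (N : QFun S A) : ‖N‖ ≤ Real.sqrt (sumSq N) :=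
  QFun.norm_le (Real.sqrt_nonneg _) fun i s a => Real.abs_le_sqrt (sq_le_sumSq N i s a)

theorem fmean_sumSq_le {X : Type*} [Fintype X] (p : PMF X) {δ : X → QFun S A} {b α : ℝ}
    (hb : ∀ x i s a, |δ x i s a| ≤ b) (hα : 0 ≤ α) (hα1 : α ≤ 1) (N : QFun S A) :
    fmean p (fun x => sumSq ((1 - α) • N +
      α • (δ x - fun i s a => fmean p fun x => δ x i s a))) ≤
      (1 - α) * sumSq N + α ^ 2 * sumSq (fun _ _ _ => b : QFun S A) := by
  simp only [sumSq, Pi.add_apply, Pi.smul_apply, Pi.sub_apply, smul_eq_mul, fmean_sum,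
    Finset.mul_sum, ← Finset.sum_add_distrib]
  exact Finset.sum_le_sum fun i _ => Finset.sum_le_sum fun s _ => Finset.sum_le_sum fun a _ =>
    fmean_sq_le p (fun x => hb x i s a) hα hα1

end Noise

section Augmented

variable {S : Type u} [DecidableEq S] {A : Fin 2 → Type v} [∀ i, Fintype (A i)]
  [∀ i, DecidableEq (A i)]

theorem MarkovGame.abs_delta_le (M : MarkovGame S A) (G : Risk A) {z : S → Profile A} {Q : QFun S A}
    {q : ℝ} (hq : 0 ≤ q) (hQ : ∀ i s a, |Q i s a| ≤ q) (ht : ∀ i w, |M.target G z Q i w| ≤ q)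
    {K : ℕ} (w : Fin K → S × (∀ j, A j) × S) (i : Fin 2) (s : S) (a : ∀ j, A j) :
    |M.delta G z Q w i s a| ≤ 2 * q := by
  rw [MarkovGame.delta, abs_mul, abs_of_nonneg (by positivity : (0 : ℝ) ≤ 1 / K)]
  have h : |∑ k, if (w k).1 = s ∧ (w k).2.1 = a then M.target G z Q i (w k) - Q i s a else 0| ≤
      ∑ _k : Fin K, 2 * q := by
    refine (Finset.abs_sum_le_sum_abs _ _).trans (Finset.sum_le_sum fun k _ => ?_)
    split_ifs
    · refine (abs_sub _ _).trans ?_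
      linarith [hQ i s a, ht i (w k)]
    · rw [abs_zero]; positivity
  refine (mul_le_mul_of_nonneg_left h (by positivity)).trans ?_
  rw [Finset.sum_const, Finset.card_univ, Fintype.card_fin, nsmul_eq_mul, ← mul_assoc]
  refine mul_le_of_le_one_left (by positivity) ?_
  rw [one_div]
  exact inv_mul_le_one

/-- The critic update is a convex combination of old values and targets. -/
theorem MarkovGame.abs_add_smul_delta_le (M : MarkovGame S A) (G : Risk A) {z : S → Profile A}
    {Q : QFun S A} {q : ℝ} (hQ : ∀ i s a, |Q i s a| ≤ q)
    (ht : ∀ i w, |M.target G z Q i w| ≤ q) {α : ℝ} (hα : 0 ≤ α) (hα1 : α ≤ 1) {K : ℕ} (hK : 1 ≤ K)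
    (w : Fin K → S × (∀ j, A j) × S) (i : Fin 2) (s : S) (a : ∀ j, A j) :
    |(Q + α • M.delta G z Q w) i s a| ≤ q := by
  have hK' : (0 : ℝ) < K := by exact_mod_cast hK
  have e : (Q + α • M.delta G z Q w) i s a = (1 / (K : ℝ)) * ∑ k : Fin K,
      (Q i s a + α * if (w k).1 = s ∧ (w k).2.1 = a then M.target G z Q i (w k) - Q i s a
        else 0) := by
    simp only [Pi.add_apply, Pi.smul_apply, smul_eq_mul, MarkovGame.delta, Finset.sum_add_distrib,
      Finset.sum_const, Finset.card_univ, Fintype.card_fin, nsmul_eq_mul, ← Finset.mul_sum]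
    field_simp
  rw [e, abs_mul, abs_of_nonneg (by positivity : (0 : ℝ) ≤ 1 / K), one_div_mul_eq_div,
    div_le_iff₀ hK']
  refine (Finset.abs_sum_le_sum_abs _ _).trans ?_
  have h : ∀ k : Fin K, |Q i s a + α * if (w k).1 = s ∧ (w k).2.1 = a then
      M.target G z Q i (w k) - Q i s a else 0| ≤ q := fun k => by
    split_ifs
    · have e2 : Q i s a + α * (M.target G z Q i (w k) - Q i s a) =
          (1 - α) * Q i s a + α * M.target G z Q i (w k) := by ring
      rw [e2]
      refine (abs_add_le _ _).trans ?_
      rw [abs_mul, abs_mul, abs_of_nonneg hα, abs_of_nonneg (sub_nonneg.2 hα1)]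
      have h1 := mul_le_mul_of_nonneg_left (hQ i s a) (sub_nonneg.2 hα1)
      have h2 := mul_le_mul_of_nonneg_left (ht i (w k)) hα
      linarith
    · rw [mul_zero, add_zero]; exact hQ i s a
  refine (Finset.sum_le_sum fun k _ => h k).trans_eq ?_
  rw [Finset.sum_const, Finset.card_univ, Fintype.card_fin, nsmul_eq_mul, mul_comm]

variable [Fintype S] [∀ i, Nonempty (A i)] (M : MarkovGame S A) (G : Risk A) (l : Fin 2 → ℝ)
  (K : ℕ) (m : Sampling S A)

/-- The state after an episode in which the trajectory `w` is sampled. -/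
noncomputable def MarkovGame.next (α β : ℝ) {K : ℕ} (x : AlgState S A)
    (w : (Fin K → S × (∀ j, A j) × S) × S) : AlgState S A where
  env := w.2
  z := G.actor l β x.z x.Q
  Q := x.Q + α • M.delta G (G.actor l β x.z x.Q) x.Q w.1

/-- The law of the trajectory sampled in an episode. -/
noncomputable def MarkovGame.sample (x : AlgState S A) :
    PMF ((Fin K → S × (∀ j, A j) × S) × S) := M.rollout (m.policy x.z) K x.env

/-- The conditional mean of the temporal-difference update. -/
noncomputable def MarkovGame.meanDelta (β : ℝ) (x : AlgState S A) : QFun S A := fun i s a =>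
  fmean (M.sample K m x) fun w => M.delta G (G.actor l β x.z x.Q) x.Q w.1 i s a

/-- One episode for the state of the algorithm together with the exponentially discounted sum `N` of
the centred noise of the critic. -/
noncomputable def MarkovGame.noisyNext (α β : ℝ) (y : AlgState S A × QFun S A)
    (w : (Fin K → S × (∀ j, A j) × S) × S) : AlgState S A × QFun S A :=
  (M.next G l α β y.1 w, (1 - α) • y.2 +
    α • (M.delta G (G.actor l β y.1.z y.1.Q) y.1.Q w.1 - M.meanDelta G l K m β y.1))

/-- The joint law of the state of the algorithm and its discounted noise. -/
noncomputable def MarkovGame.noisyLaw (α β : ℕ → ℝ) : ℕ → PMF (AlgState S A × QFun S A)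
  | 0 => (M.algLaw G l K m α β 0).map fun x => (x, 0)
  | t + 1 => (MarkovGame.noisyLaw α β t).bind fun y =>
      (M.sample K m y.1).map (M.noisyNext G l K m (α t) (β t) y)

theorem MarkovGame.map_fst_noisyLaw (α β : ℕ → ℝ) (t : ℕ) :
    (M.noisyLaw G l K m α β t).map Prod.fst = M.algLaw G l K m α β t := by
  induction t with
  | zero =>
    rw [MarkovGame.noisyLaw, PMF.map_comp]
    exact PMF.map_id _
  | succ t ih =>
    rw [MarkovGame.noisyLaw, PMF.map_bind, MarkovGame.algLaw, ← ih, PMF.bind_map]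
    congr 1
    funext y
    rw [PMF.map_comp]
    rfl

variable {M G l K m}

/-- The values stay bounded along the run. -/
theorem MarkovGame.norm_Q_le_of_mem_support {α β : ℕ → ℝ} {q c : ℝ} (hq : 0 ≤ q)
    (hc : ∀ (i : Fin 2) (x : simplex (A i)) (y q : simplex (A (opp i))) (M : (∀ j, A j) → ℝ),
      |G.J i x y q M| ≤ ‖M‖ + c) (hqc : 1 + M.γ * (q + c) ≤ q) (hα : ∀ t, 0 ≤ α t)
    (hα1 : ∀ t, α t ≤ 1) (hK : 1 ≤ K) (t : ℕ) :
    ∀ x ∈ (M.algLaw G l K m α β t).support, ‖x.Q‖ ≤ q := by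
  induction t with
  | zero =>
    intro x hx
    rw [MarkovGame.algLaw, PMF.mem_support_map_iff] at hx
    obtain ⟨s, -, rfl⟩ := hx
    simpa using hq
  | succ t ih =>
    intro x hx
    rw [MarkovGame.algLaw, PMF.mem_support_bind_iff] at hx
    obtain ⟨x₀, hx₀, hx⟩ := hx
    rw [MarkovGame.episode, PMF.mem_support_map_iff] at hx
    obtain ⟨w, -, rfl⟩ := hx
    have h := ih x₀ hx₀
    refine QFun.norm_le hq fun i s a => M.abs_add_smul_delta_le G
      (fun i s a => (abs_apply_le x₀.Q i s a).trans h) (fun i w => ?_) (hα t) (hα1 t) hK w.1 i s a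
    refine (M.abs_target_le hc _ x₀.Q i w).trans (le_trans ?_ hqc)
    have := M.γ_nonneg
    gcongr

theorem MarkovGame.expect_noisyLaw_succ {α β : ℕ → ℝ} {t : ℕ} {f : AlgState S A × QFun S A → ℝ}
    (hf : ∀ y, 0 ≤ f y) :
    expect (M.noisyLaw G l K m α β (t + 1)) (fun y => ENNReal.ofReal (f y)) =
      expect (M.noisyLaw G l K m α β t) fun y => ENNReal.ofReal
        (fmean (M.sample K m y.1) fun w => f (M.noisyNext G l K m (α t) (β t) y w)) := by
  rw [MarkovGame.noisyLaw, expect_bind]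
  congr 1
  funext y
  rw [expect_map, expect_ofReal _ fun w => hf _]

/-- Subtracting the noise turns the critic update into its conditional mean. -/
theorem MarkovGame.noisyNext_sub (α β : ℝ) (y : AlgState S A × QFun S A)
    (w : (Fin K → S × (∀ j, A j) × S) × S) :
    (M.noisyNext G l K m α β y w).1.Q - (M.noisyNext G l K m α β y w).2 =
      meanUpdate α (M.visitFreq (m.policy y.1.z) K y.1.env)
        (M.lookahead G (G.actor l β y.1.z y.1.Q) y.1.Q) y.1.Q y.2 := by
  funext i s a
  have h : M.meanDelta G l K m β y.1 i s a = M.visitFreq (m.policy y.1.z) K y.1.env s a *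
      (M.lookahead G (G.actor l β y.1.z y.1.Q) y.1.Q i s a - y.1.Q i s a) :=
    M.fmean_delta G (m.policy y.1.z) K y.1.env _ _ i s a
  simp only [MarkovGame.noisyNext, MarkovGame.next, meanUpdate, Pi.add_apply, Pi.sub_apply,
    Pi.smul_apply, smul_eq_mul, h]
  ring

end Augmented

end RiskGame

namespace RiskGame

universe u v

/-! ### The mean squared error -/

section Recursion

variable {S : Type u} [Fintype S] [DecidableEq S] {A : Fin 2 → Type v} [∀ i, Fintype (A i)]
  [∀ i, DecidableEq (A i)] [∀ i, Nonempty (A i)] {M : MarkovGame S A} {G : Risk A}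
  {l : Fin 2 → ℝ} {K : ℕ} {m : Sampling S A}

/-- An affine one-step bound on conditional expectations propagates to expectations. -/
theorem MarkovGame.expect_noisyLaw_succ_le {α β : ℕ → ℝ} {t : ℕ}
    {f h : AlgState S A × QFun S A → ℝ} (hf : ∀ y, 0 ≤ f y) {p r u v : ℝ}
    (hp : 0 ≤ p) (hu : 0 ≤ u) (hv : 0 ≤ v)
    (hstep : ∀ y : AlgState S A × QFun S A, y.1 ∈ (M.algLaw G l K m α β t).support →
      fmean (M.sample K m y.1) (fun w => f (M.noisyNext G l K m (α t) (β t) y w)) ≤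
        p * f y + h y)
    (hfu : expect (M.noisyLaw G l K m α β t) (fun y => ENNReal.ofReal (f y)) ≤ ENNReal.ofReal u)
    (hhv : expect (M.noisyLaw G l K m α β t) (fun y => ENNReal.ofReal (h y)) ≤ ENNReal.ofReal v)
    (hr' : p * u + v ≤ r) :
    expect (M.noisyLaw G l K m α β (t + 1)) (fun y => ENNReal.ofReal (f y)) ≤ ENNReal.ofReal r := by
  rw [M.expect_noisyLaw_succ hf]
  calc _ ≤ expect (M.noisyLaw G l K m α β t)
          (fun y => ENNReal.ofReal p * ENNReal.ofReal (f y) + ENNReal.ofReal (h y)) := by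
        refine expect_mono _ fun y hy => ?_
        have hy' : y.1 ∈ (M.algLaw G l K m α β t).support := by
          rw [← M.map_fst_noisyLaw, PMF.mem_support_map_iff]
          exact ⟨y, hy, rfl⟩
        refine (ENNReal.ofReal_le_ofReal (hstep y hy')).trans ?_
        rw [← ENNReal.ofReal_mul hp]
        exact ENNReal.ofReal_add_le
    _ = ENNReal.ofReal p * expect (M.noisyLaw G l K m α β t) (fun y => ENNReal.ofReal (f y)) +
          expect (M.noisyLaw G l K m α β t) (fun y => ENNReal.ofReal (h y)) := by
        rw [expect_add, expect_const_mul]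
    _ ≤ ENNReal.ofReal p * ENNReal.ofReal u + ENNReal.ofReal v := by gcongr
    _ = ENNReal.ofReal (p * u + v) := by
        rw [← ENNReal.ofReal_mul hp, ← ENNReal.ofReal_add (mul_nonneg hp hu) hv]
    _ ≤ _ := ENNReal.ofReal_le_ofReal hr'

/-- Every sequence that dominates the Lyapunov recursion bounds the mean squared error, provided
that the ratio of the step sizes is constant. -/
theorem MarkovGame.exists_mse_le {L mu : ℝ} (hmu : 0 < mu) (hl : ∀ i, 0 < l i)
    (hmono : ∀ (Q : QFun S A) (s : S), G.StronglyMonotone mu l (stage Q s))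
    (hL : 0 ≤ L) (hs : G.Smooth L) {muLow C rho : ℝ} (hmuLow : 0 < muLow) (hmuLow1 : muLow ≤ 1)
    (hrho : rho ∈ Set.Ioo (0 : ℝ) 1) (herg : M.Ergodic muLow C rho) {piLow : ℝ} (hpi : 0 < piLow)
    (hpi1 : piLow ≤ 1) {γ₀ : ℝ} (hγ₀ : γ₀ ∈ Set.Ico (0 : ℝ) 1)
    (hcontr : ∀ Q Q' : QFun S A, ‖M.bellman G Q - M.bellman G Q'‖ ≤ γ₀ * ‖Q - Q'‖)
    {zstar : S → Profile A} (hz : M.IsNash G zstar) :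
    ∃ κ > 0, ∃ b > 0, ∃ c ≥ 0, ∃ U ≥ 0, ∃ D ≥ 0, ∀ (K : ℕ) (m : Sampling S A) (α β : ℕ → ℝ),
      1 ≤ K → 4 * Real.sqrt 2 * C / ((1 - rho) * (1 - γ₀) * (muLow * piLow)) ≤ K →
      StepSizes κ b α β → M.SamplingBoundedBelow G l K m α β piLow →
      (∃ r, ∀ t, α t / β t = r) → ∀ u : ℕ → ℝ, U ≤ u 0 →
      (∀ t, (1 - (1 - γ₀) / 2 * (muLow * piLow) * α t) * u t + c * α t ^ 2 ≤ u (t + 1)) →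
      ∀ t s, M.mse G l K m α β zstar t s ≤ ENNReal.ofReal (D * u t) := by
  have h1γ : 0 < 1 - γ₀ := sub_pos.2 hγ₀.2
  have hd : 0 < muLow * piLow := mul_pos hmuLow hpi
  have hd1 : muLow * piLow ≤ 1 := mul_le_one₀ hmuLow1 hpi.le hpi1
  set g := (1 - γ₀) / 2 * (muLow * piLow) with hg
  have hg0 : 0 < g := by positivity
  have hg1 : g ≤ 1 / 2 := by
    have : (1 - γ₀) / 2 ≤ 1 / 2 := by linarith [hγ₀.1]
    calc g ≤ 1 / 2 * 1 := mul_le_mul this hd1 hd.le (by norm_num)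
      _ = 1 / 2 := mul_one _
  choose zt hzt using fun (Q : QFun S A) (s : S) => (hmono Q s).exists_isEq hmu hl hL hs
  -- the targets are bounded by `1 + γ (q + c₀)` as long as the critic is bounded by `q`
  obtain ⟨c₀, hc₀0, hc₀⟩ := hs.exists_abs_J_le hL
  have hγ := M.γ_nonneg
  have hγ1 : 0 < 1 - M.γ := sub_pos.2 M.γ_lt_one
  set q := (1 + M.γ * c₀) / (1 - M.γ) with hq
  have hq0 : 0 ≤ q := by positivity
  have hqc : 1 + M.γ * (q + c₀) ≤ q := by
    have : q * (1 - M.γ) = 1 + M.γ * c₀ := by rw [hq]; field_simp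
    linarith
  have hQS := hz.bellman_eq hmu hl hs hmono
  set QS := M.qValue G zstar with hQSdef
  obtain ⟨κ, hκ, b, hb, a, ha, C₇, hC₇, C₈, hC₈, key⟩ :=
    MarkovGame.exists_episode_bounds (M := M) (w := 3 / 5 * (muLow * piLow)) hmu hl hmono hL hs hγ₀
      hcontr hQS hzt hq0 (by positivity) hg0 (by rw [hg]; nlinarith [mul_pos h1γ hd]) (by linarith)
  obtain ⟨c', hc'0, hc'⟩ := exists_norm_grad_sub_payoff_le G hl
  -- the noise, weighted by `D`, decays fast enough to absorb its effect `C₇` on the other errors,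
  -- because `1 - g ≥ 1 / 2`; `B` bounds the tracking error in units of the dominating sequence
  set D := 2 * C₇ + 1 with hD
  have hD1 : 1 ≤ D := by linarith
  set σ := sumSq (fun _ _ _ => 2 * q : QFun S A) with hσ
  have hσ0 : 0 ≤ σ := sumSq_nonneg _
  set B := 16 * C₈ / mu + 1 with hB
  have hB1 : 1 ≤ B := by rw [hB]; have : 0 ≤ 16 * C₈ / mu := by positivity
                         linarith
  have hBC : 16 * C₈ ≤ B * mu := by rw [hB]; field_simp; linarith
  clear_value D B
  refine ⟨κ, hκ, b, hb, D * σ, by positivity, ‖QS‖ ^ 2 + a * κ * 16 + 16, by positivity,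
    2 * B + 2 * (c' / mu) ^ 2, by positivity, ?_⟩
  rintro K m α β hK hKC hstep hsamp ⟨r, hr⟩ u hU hu t s
  have hr' : ∀ t, 0 < β t ∧ α t ≤ 1 ∧ g * α t ≤ β t * mu / 8 ∧ β t * mu ≤ 1 := fun t =>
    let h := key (α t) (β t) (hstep t).1 (hstep t).2.1 (hstep t).2.2
    ⟨h.1, h.2.1, h.2.2.1, h.2.2.2.1⟩
  have hr0 : 0 ≤ r := by rw [← hr 0]; exact div_nonneg (hstep 0).1.le (hr' 0).1.le
  have hrκ : r ≤ κ := by rw [← hr 0]; exact (div_le_iff₀ (hr' 0).1).2 (hstep 0).2.1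
  have hgα : ∀ t, 0 ≤ 1 - g * α t := fun t => by
    obtain ⟨-, -, h3, h4⟩ := hr' t
    linarith
  have hu0 : ∀ t, 0 ≤ u t := fun t => by
    induction t with
    | zero => exact le_trans (by positivity) hU
    | succ t ih =>
      refine le_trans ?_ (hu t)
      have := mul_nonneg (hgα t) ih
      positivity
  -- the noisy state, its noise and its errors
  let slow : AlgState S A × QFun S A → ℝ := fun y => slowError QS y.1.Q y.2
  let track : AlgState S A × QFun S A → ℝ := fun y => trackError zt y.1.z y.1.Q y.2
  let Λ : AlgState S A × QFun S A → ℝ := fun y => slow y + a * r * track y + D * sumSq y.2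
  have hslow0 : ∀ y, 0 ≤ slow y := fun y => sq_nonneg _
  have htrack0 : ∀ y, 0 ≤ track y := fun y => sq_nonneg _
  have hΛ0 : ∀ y, 0 ≤ Λ y := fun y => by
    have := hslow0 y; have := htrack0 y; have := sumSq_nonneg y.2; positivity
  have step : ∀ t (y : AlgState S A × QFun S A), y.1 ∈ (M.algLaw G l K m α β t).support →
      (∀ w, slow (M.noisyNext G l K m (α t) (β t) y w) +
          a * r * track (M.noisyNext G l K m (α t) (β t) y w) ≤
        (1 - g * α t) * (slow y + a * r * track y) + α t * C₇ * sumSq y.2) ∧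
      (∀ w, track (M.noisyNext G l K m (α t) (β t) y w) ≤
        (1 - β t * mu / 4) * track y + β t * C₈ * (slow y + sumSq y.2)) := fun t y hy => by
    obtain ⟨-, -, -, -, h⟩ := key (α t) (β t) (hstep t).1 (hstep t).2.1 (hstep t).2.2
    have hQ := MarkovGame.norm_Q_le_of_mem_support hq0 hc₀ hqc (fun t => (hstep t).1.le)
      (fun t => (hr' t).2.1) hK t y.1 hy
    have hw : ∀ s a, 3 / 5 * (muLow * piLow) ≤
        M.visitFreq (m.policy y.1.z) K y.1.env s a := fun s a =>
      herg.le_visitFreq hmuLow hrho hγ₀ hpi hpi1 hK hKC _ _ s a (hsamp t y.1 hy s a)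
    have hw1 : ∀ s a, M.visitFreq (m.policy y.1.z) K y.1.env s a ≤ 1 := fun s a =>
      M.visitFreq_le_one _ hK _ s a
    rw [← hr t]
    have h2 := fun w => h y.1.z y.1.Q y.2 (M.visitFreq (m.policy y.1.z) K y.1.env)
      (Real.sqrt (sumSq y.2)) hQ hw hw1 (norm_le_sqrt_sumSq y.2) _ _
      (MarkovGame.noisyNext_sub (l := l) (α t) (β t) y w)
    simp only [Real.sq_sqrt (sumSq_nonneg y.2)] at h2
    exact ⟨fun w => (h2 w).1, fun w => (h2 w).2⟩
  have stepN : ∀ t (y : AlgState S A × QFun S A), y.1 ∈ (M.algLaw G l K m α β t).support →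
      fmean (M.sample K m y.1) (fun w => sumSq (M.noisyNext G l K m (α t) (β t) y w).2) ≤
        (1 - α t) * sumSq y.2 + α t ^ 2 * σ := fun t y hy => by
    have hQ := MarkovGame.norm_Q_le_of_mem_support hq0 hc₀ hqc (fun t => (hstep t).1.le)
      (fun t => (hr' t).2.1) hK t y.1 hy
    refine fmean_sumSq_le (M.sample K m y.1) (fun w i s a => ?_) (hstep t).1.le (hr' t).2.1 y.2
    refine M.abs_delta_le G hq0 (fun i s a => (abs_apply_le _ i s a).trans hQ) (fun i v => ?_)
      w.1 i s a
    refine (M.abs_target_le hc₀ _ _ i v).trans (le_trans ?_ hqc)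
    gcongr
  have main : ∀ t, expect (M.noisyLaw G l K m α β t) (fun y => ENNReal.ofReal (Λ y)) ≤
        ENNReal.ofReal (u t) ∧
      expect (M.noisyLaw G l K m α β t) (fun y => ENNReal.ofReal (track y)) ≤
        ENNReal.ofReal (B * u t) := fun t => by
    induction t with
    | zero =>
      simp only [MarkovGame.noisyLaw, MarkovGame.algLaw, expect_map]
      have htr : ∀ s, track (⟨s, fun _ => ⟨fun i => uniform (A i), fun i => uniform (A (opp i))⟩,
          0⟩, 0) ≤ 16 := fun s => by
        have h4 : ∀ z w : S → Profile A, ‖embAll z - embAll w‖ ≤ 4 := fun z w =>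
          (pi_norm_le_iff_of_nonneg (by norm_num)).2 fun s => (norm_sub_le _ _).trans (by
            have h1 : ‖embAll z s‖ ≤ 2 := (z s).norm_emb_le
            have h2 : ‖embAll w s‖ ≤ 2 := (w s).norm_emb_le
            linarith)
        calc _ ≤ (4 : ℝ) ^ 2 := pow_le_pow_left₀ (norm_nonneg _) (h4 _ _) 2
          _ = 16 := by norm_num
      constructor
      · refine (expect_mono _ fun s _ => ENNReal.ofReal_le_ofReal (?_ : _ ≤ u 0)).trans
          (expect_const _ _).le
        have h1 : slow (⟨s, fun _ => ⟨fun i => uniform (A i), fun i => uniform (A (opp i))⟩,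
          0⟩, 0) = ‖QS‖ ^ 2 := by simp [slow, slowError]
        have h2 : sumSq (0 : QFun S A) = 0 := by simp [sumSq]
        have h3 : a * r * track (⟨s, fun _ => ⟨fun i => uniform (A i),
            fun i => uniform (A (opp i))⟩, 0⟩, 0) ≤ a * κ * 16 :=
          mul_le_mul (mul_le_mul_of_nonneg_left hrκ ha) (htr s) (htrack0 _) (by positivity)
        simp only [Λ, h1, h2]
        linarith
      · refine (expect_mono _ fun s _ => ENNReal.ofReal_le_ofReal (?_ : _ ≤ B * u 0)).trans
          (expect_const _ _).le
        have h1 : 0 ≤ ‖QS‖ ^ 2 + a * κ * 16 := by positivity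
        have h2 : 1 * u 0 ≤ B * u 0 := mul_le_mul_of_nonneg_right hB1 (hu0 0)
        linarith [htr s]
    | succ t ih =>
      obtain ⟨hβ, hα1, hgαβ, hβm⟩ := hr' t
      have hα := (hstep t).1
      constructor
      · refine MarkovGame.expect_noisyLaw_succ_le (h := fun _ => D * σ * α t ^ 2) hΛ0 (hgα t)
          (hu0 t) (v := D * σ * α t ^ 2) (by positivity) (fun y hy => ?_) ih.1
          (expect_const _ _).le (hu t)
        obtain ⟨h1, -⟩ := step t y hy
        have h2 := stepN t y hy
        have h3 := fmean_mono (M.sample K m y.1) h1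
        rw [fmean_const] at h3
        simp only [Λ]
        rw [fmean_add, fmean_const_mul]
        have h4 := mul_le_mul_of_nonneg_left h2 (by linarith : 0 ≤ D)
        have h5 : C₇ ≤ D * (1 - g) := by
          have := mul_le_mul_of_nonneg_left (by linarith : 1 / 2 ≤ 1 - g) (by linarith : 0 ≤ D)
          linarith
        have h6 := mul_le_mul_of_nonneg_right (mul_le_mul_of_nonneg_left h5 hα.le)
          (sumSq_nonneg y.2)
        linarith
      · have hp : 0 ≤ 1 - β t * mu / 4 := by linarith
        have hBu := mul_nonneg (by linarith : 0 ≤ B) (hu0 t)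
        refine MarkovGame.expect_noisyLaw_succ_le
          (h := fun y => β t * C₈ * (slow y + sumSq y.2)) htrack0 hp
          hBu (v := β t * C₈ * u t)
          (mul_nonneg (by positivity) (hu0 t)) (fun y hy => ?_) ih.2 ?_ ?_
        · obtain ⟨-, h1⟩ := step t y hy
          have h3 := fmean_mono (M.sample K m y.1) h1
          rwa [fmean_const] at h3
        · rw [ENNReal.ofReal_mul (by positivity)]
          refine le_trans ?_ (mul_le_mul_right ih.1 _)
          rw [← expect_const_mul]
          refine expect_mono _ fun y _ => ?_
          rw [← ENNReal.ofReal_mul (by positivity)]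
          refine ENNReal.ofReal_le_ofReal (mul_le_mul_of_nonneg_left ?_ (by positivity))
          have h1 : 0 ≤ a * r * track y := mul_nonneg (mul_nonneg ha hr0) (htrack0 y)
          have h2 : 1 * sumSq y.2 ≤ D * sumSq y.2 :=
            mul_le_mul_of_nonneg_right hD1 (sumSq_nonneg _)
          simp only [Λ]
          linarith
        · have h1 : (1 - g * α t) * u t ≤ u (t + 1) :=
            le_trans (le_add_of_nonneg_right (by positivity)) (hu t)
          have h2 := mul_le_mul_of_nonneg_left h1 (by linarith : 0 ≤ B)
          have h3 := mul_le_mul_of_nonneg_right hgαβ hBu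
          have h4 := mul_le_mul_of_nonneg_right (mul_le_mul_of_nonneg_left hBC hβ.le) (hu0 t)
          have h5 := mul_nonneg (mul_pos hβ hmu).le hBu
          linarith
  -- from the tracking error and the slow error to the mean squared error
  have hzs : ∀ y : AlgState S A × QFun S A, (y.1.z s).sqDist (zstar s) ≤
      2 * track y + 2 * (c' / mu) ^ 2 * slow y := fun y => by
    have h1 := norm_embAll_sub_le_of_isEq hmu hl hc'0 hc' hmono (hzt (y.1.Q - y.2))
      (hz.isEq hs)
    have h2 : ‖(y.1.z s).emb - (zstar s).emb‖ ≤ ‖embAll y.1.z - embAll zstar‖ :=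
      norm_le_pi_norm (embAll y.1.z - embAll zstar) s
    have h3 := norm_sub_le_norm_sub_add_norm_sub (embAll y.1.z) (embAll (zt (y.1.Q - y.2)))
      (embAll zstar)
    rw [Profile.sqDist_eq]
    have h4 := pow_le_pow_left₀ (norm_nonneg _) (h2.trans (h3.trans (add_le_add_right h1 _))) 2
    refine h4.trans (add_sq_le.trans_eq ?_)
    simp only [track, slow, trackError, slowError]
    ring
  have hslowΛ : ∀ y, slow y ≤ Λ y := fun y => by
    have h1 : 0 ≤ a * r * track y := mul_nonneg (mul_nonneg ha hr0) (htrack0 y)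
    have h2 : 0 ≤ D * sumSq y.2 := mul_nonneg (by linarith) (sumSq_nonneg _)
    simp only [Λ]
    linarith
  rw [MarkovGame.mse, ← M.map_fst_noisyLaw, expect_map]
  calc _ ≤ expect (M.noisyLaw G l K m α β t) (fun y => ENNReal.ofReal 2 * ENNReal.ofReal (track y) +
          ENNReal.ofReal (2 * (c' / mu) ^ 2) * ENNReal.ofReal (Λ y)) := by
        refine expect_mono _ fun y _ => ?_
        rw [← ENNReal.ofReal_mul (by norm_num), ← ENNReal.ofReal_mul (by positivity),
          ← ENNReal.ofReal_add (by have := htrack0 y; positivity)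
            (by have := hΛ0 y; positivity)]
        refine ENNReal.ofReal_le_ofReal ((hzs y).trans (add_le_add le_rfl ?_))
        exact mul_le_mul_of_nonneg_left (hslowΛ y) (by positivity)
    _ ≤ ENNReal.ofReal 2 * ENNReal.ofReal (B * u t) +
          ENNReal.ofReal (2 * (c' / mu) ^ 2) * ENNReal.ofReal (u t) := by
        rw [expect_add, expect_const_mul, expect_const_mul]
        gcongr
        · exact (main t).2
        · exact (main t).1
    _ = _ := by
        have h1 := hu0 t
        have h2 : 0 ≤ B * u t := mul_nonneg (by linarith) h1
        rw [← ENNReal.ofReal_mul (by norm_num), ← ENNReal.ofReal_mul (by positivity),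
          ← ENNReal.ofReal_add (by positivity) (by positivity)]
        congr 1
        ring

end Recursion

/-! ### Diminishing step sizes -/

section Diminishing

/-- A recursion with contraction factors `1 - e / (t + h)` and perturbations `c / (t + h) ^ 2` is
dominated by a multiple of `(t + h) ^ (-e)` when `e < 1`, since the perturbations, divided by that
rate, are summable. -/
theorem exists_dominating_sequence {e h c U : ℝ} (he : 0 < e) (he1 : e < 1) (hh : 1 ≤ h)
    (hc : 0 ≤ c) (hU : 0 ≤ U) :
    ∃ (u : ℕ → ℝ) (B : ℝ), U ≤ u 0 ∧
      (∀ t : ℕ, (1 - e / (t + h)) * u t + c / (t + h) ^ 2 ≤ u (t + 1)) ∧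
      ∀ t : ℕ, u t ≤ B * ((h + 1) / (h + t)) ^ e := by
  have hx : ∀ t : ℕ, 1 ≤ (t : ℝ) + h := fun t => by
    have : (0 : ℝ) ≤ t := Nat.cast_nonneg t
    linarith
  -- the perturbation at time `t` divided by the rate at time `t + 1`
  set ψ : ℕ → ℝ := fun t => c / (t + h) ^ 2 * (t + h + 1) ^ e with hψ
  have hψ0 : ∀ t, 0 ≤ ψ t := fun t => by have := hx t; positivity
  have hsum : Summable ψ := by
    have h1 : Summable fun t : ℕ => 1 / |(t : ℝ) + 1| ^ (2 - e) :=
      (Real.summable_one_div_nat_add_rpow 1 (2 - e)).2 (by linarith)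
    refine Summable.of_nonneg_of_le hψ0 (fun t => ?_) (h1.mul_left (2 * c))
    have hxt := hx t
    set x : ℝ := t + h with hxdef
    have hx0 : 0 < x := by linarith
    have ht1 : (0 : ℝ) < t + 1 := by positivity
    have h2 : (x + 1) ^ e ≤ 2 * x ^ e := by
      calc (x + 1) ^ e ≤ (2 * x) ^ e := Real.rpow_le_rpow (by linarith) (by linarith) he.le
        _ = 2 ^ e * x ^ e := Real.mul_rpow (by norm_num) hx0.le
        _ ≤ 2 ^ (1 : ℝ) * x ^ e := by
            exact mul_le_mul_of_nonneg_right
              (Real.rpow_le_rpow_of_exponent_le (by norm_num) he1.le) (Real.rpow_nonneg hx0.le e)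
        _ = 2 * x ^ e := by rw [Real.rpow_one]
    have h3 : x ^ e / x ^ 2 = 1 / x ^ (2 - e) := by
      rw [Real.rpow_sub hx0, one_div_div, Real.rpow_two]
    have h4 : 1 / x ^ (2 - e) ≤ 1 / |(t : ℝ) + 1| ^ (2 - e) := by
      rw [abs_of_pos ht1]
      refine one_div_le_one_div_of_le (Real.rpow_pos_of_pos ht1 _) ?_
      exact Real.rpow_le_rpow ht1.le (by linarith) (by linarith)
    calc c / x ^ 2 * (x + 1) ^ e ≤ c / x ^ 2 * (2 * x ^ e) :=
          mul_le_mul_of_nonneg_left h2 (by positivity)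
      _ = 2 * c * (x ^ e / x ^ 2) := by ring
      _ ≤ _ := by rw [h3]; exact mul_le_mul_of_nonneg_left h4 (by positivity)
  have hS : ∀ t : ℕ, ∑ j ∈ Finset.range t, ψ j ≤ ∑' j, ψ j := fun t =>
    hsum.sum_le_tsum _ fun j _ => hψ0 j
  generalize ∑' j, ψ j = p at hS
  clear_value ψ
  refine ⟨fun t => (U * h ^ e + ∑ j ∈ Finset.range t, ψ j) / (t + h) ^ e,
    (U * h ^ e + p) / (h + 1) ^ e, ?_, fun t => ?_, fun t => ?_⟩
  · have : 0 < h ^ e := Real.rpow_pos_of_pos (by linarith) e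
    simp only [Nat.cast_zero, zero_add, Finset.range_zero, Finset.sum_empty, add_zero]
    rw [mul_div_cancel_right₀ _ this.ne']
  · have hxt := hx t
    have hcast : ((t + 1 : ℕ) : ℝ) + h = t + h + 1 := by push_cast; ring
    simp only [hcast]
    set x : ℝ := t + h with hxdef
    have hx0 : 0 < x := by linarith
    have hs0 : 0 ≤ U * h ^ e + ∑ j ∈ Finset.range t, ψ j :=
      add_nonneg (mul_nonneg hU (Real.rpow_nonneg (by linarith) e))
        (Finset.sum_nonneg fun j _ => hψ0 j)
    set s := U * h ^ e + ∑ j ∈ Finset.range t, ψ j with hs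
    have hxe : 0 < x ^ e := Real.rpow_pos_of_pos hx0 e
    have hx1e : 0 < (x + 1) ^ e := Real.rpow_pos_of_pos (by linarith) e
    rw [Finset.sum_range_succ, ← add_assoc, ← hs, le_div_iff₀ hx1e]
    have h1 : ψ t = c / x ^ 2 * (x + 1) ^ e := congrFun hψ t
    -- Bernoulli's inequality compares the two rates
    have h2 : (1 - e / x) * (x + 1) ^ e ≤ x ^ e := by
      have h3 : (x + 1) ^ e ≤ x ^ e * (1 + e / x) := by
        have h4 : x + 1 = x * (1 + 1 / x) := by field_simp
        rw [h4, Real.mul_rpow hx0.le (by positivity)]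
        refine mul_le_mul_of_nonneg_left ?_ hxe.le
        have := rpow_one_add_le_one_add_mul_self (s := 1 / x) (p := e)
          (by have : 0 ≤ 1 / x := by positivity
              linarith) he.le he1.le
        rwa [mul_one_div] at this
      have h5 : 0 ≤ 1 - e / x := by
        rw [sub_nonneg, div_le_one hx0]; linarith
      calc _ ≤ (1 - e / x) * (x ^ e * (1 + e / x)) := mul_le_mul_of_nonneg_left h3 h5
        _ = x ^ e * (1 - (e / x) ^ 2) := by ring
        _ ≤ x ^ e * 1 := mul_le_mul_of_nonneg_left (by nlinarith [sq_nonneg (e / x)]) hxe.le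
        _ = x ^ e := mul_one _
    rw [h1, add_mul]
    refine add_le_add ?_ le_rfl
    calc (1 - e / x) * (s / x ^ e) * (x + 1) ^ e = s / x ^ e * ((1 - e / x) * (x + 1) ^ e) := by
          ring
      _ ≤ s / x ^ e * x ^ e := mul_le_mul_of_nonneg_left h2 (by positivity)
      _ = s := div_mul_cancel₀ _ hxe.ne'
  · have hxt := hx t
    have hx0 : 0 < (t : ℝ) + h := by linarith
    have hxe : 0 < ((t : ℝ) + h) ^ e := Real.rpow_pos_of_pos hx0 e
    have hh1 : 0 < (h + 1) ^ e := Real.rpow_pos_of_pos (by linarith) e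
    have e1 : (U * h ^ e + p) / (h + 1) ^ e * ((h + 1) / (h + t)) ^ e =
        (U * h ^ e + p) / (t + h) ^ e := by
      rw [Real.div_rpow (by linarith) (by linarith), add_comm h (t : ℝ), div_mul_div_comm,
        mul_comm ((h + 1) ^ e), mul_div_mul_right _ _ hh1.ne']
    rw [e1]
    exact div_le_div_of_nonneg_right (add_le_add le_rfl (hS t)) hxe.le

end Diminishing

theorem MarkovGame.Ergodic.low_le_one {S : Type u} [Fintype S] [DecidableEq S] [Nonempty S]
    {A : Fin 2 → Type v} [∀ i, Fintype (A i)] [∀ i, Nonempty (A i)]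
    {M : MarkovGame S A} {low C ρ : ℝ} (h : M.Ergodic low C ρ) (hlow : 0 ≤ low) : low ≤ 1 := by
  obtain ⟨d, hd, hd1, -⟩ := h fun _ i => uniform (A i)
  obtain ⟨s⟩ := ‹Nonempty S›
  rw [← hd1]
  exact (hd s).trans (Finset.single_le_sum (f := d) (fun s _ => hlow.trans (hd s))
    (Finset.mem_univ s))

theorem MarkovGame.SamplingBoundedBelow.low_le_one {S : Type u} [Fintype S] [DecidableEq S]
    {A : Fin 2 → Type v} [∀ i, Fintype (A i)] [∀ i, DecidableEq (A i)] [∀ i, Nonempty (A i)]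
    {M : MarkovGame S A} {G : Risk A} {l : Fin 2 → ℝ} {K : ℕ} {m : Sampling S A} {α β : ℕ → ℝ}
    {low : ℝ} (h : M.SamplingBoundedBelow G l K m α β low) : low ≤ 1 := by
  obtain ⟨x, hx⟩ := (M.algLaw G l K m α β 0).support_nonempty
  exact (h 0 x hx x.env fun i => Classical.arbitrary (A i)).trans (actProb_le_one _ _ _)

end RiskGame

theorem mainTheorem6 {S : Type*} [Fintype S] [DecidableEq S] [Nonempty S]
    {A : Fin 2 → Type*} [∀ i, Fintype (A i)] [∀ i, DecidableEq (A i)] [∀ i, Nonempty (A i)]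
    (M : RiskGame.MarkovGame S A) (G : RiskGame.Risk A)
    -- strong monotonicity of all stage games
    (mu : ℝ) (hmu : 0 < mu) (l : Fin 2 → ℝ) (hl : ∀ i, 0 < l i)
    (hmono : ∀ (Q : RiskGame.QFun S A) (s : S), G.StronglyMonotone mu l (RiskGame.stage Q s))
    -- smoothness of the regularizers
    (L : ℝ) (hL : 0 < L) (hsmooth : G.Smooth L)
    -- uniform geometric ergodicity
    (muLow C rho : ℝ) (hmuLow : 0 < muLow) (hrho : rho ∈ Set.Ioo (0 : ℝ) 1)
    (herg : M.Ergodic muLow C rho)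
    -- the lower bound for the sampling policies
    (piLow : ℝ) (hpiLow : 0 < piLow)
    -- the Bellman optimality operator is a contraction in the max-norm
    (γ₀ : ℝ) (hγ₀ : γ₀ ∈ Set.Ico (0 : ℝ) 1)
    (hcontr : ∀ Q Q' : RiskGame.QFun S A, ‖M.bellman G Q - M.bellman G Q'‖ ≤ γ₀ * ‖Q - Q'‖)
    -- the Nash equilibrium of the four-player Markov game
    (zstar : S → RiskGame.Profile A) (hz : M.IsNash G zstar) :
    M.IsRQE G (fun s => (zstar s).π) ∧
    ∃ κ > 0, ∃ b > 0, ∃ D₃ D₄ : ℝ,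
      -- constant step sizes
      (∀ (K : ℕ) (m : RiskGame.Sampling S A) (α β : ℝ), 1 ≤ K →
        4 * Real.sqrt 2 * C / ((1 - rho) * (1 - γ₀) * (muLow * piLow)) ≤ K →
        RiskGame.StepSizes κ b (fun _ => α) (fun _ => β) →
        M.SamplingBoundedBelow G l K m (fun _ => α) (fun _ => β) piLow →
        ∀ (t : ℕ) (s : S),
          M.mse G l K m (fun _ => α) (fun _ => β) zstar t s ≤
            ENNReal.ofReal
              ((1 - (1 - γ₀) / 2 * (muLow * piLow) * α) ^ t * D₃ + α * D₄)) ∧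
      -- diminishing step sizes
      (∀ α h : ℝ, 0 < α → 1 ≤ h → (1 - γ₀) / 2 * (muLow * piLow) * α < 1 →
        ∃ D₅ : ℝ, ∀ (K : ℕ) (m : RiskGame.Sampling S A) (β : ℝ), 1 ≤ K →
          4 * Real.sqrt 2 * C / ((1 - rho) * (1 - γ₀) * (muLow * piLow)) ≤ K →
          RiskGame.StepSizes κ b (fun t => α / (t + h)) (fun t => β / (t + h)) →
          M.SamplingBoundedBelow G l K m (fun t => α / (t + h)) (fun t => β / (t + h)) piLow →
          ∀ (t : ℕ) (s : S),
            M.mse G l K m (fun t => α / (t + h)) (fun t => β / (t + h)) zstar t s ≤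
              ENNReal.ofReal
                (D₅ * ((h + 1) / (h + t)) ^ ((1 - γ₀) / 2 * (muLow * piLow) * α))) := by
  refine ⟨hz.isRQE hL.le hsmooth, ?_⟩
  by_cases hp : piLow ≤ 1
  · obtain ⟨κ, hκ, b, hb, c, hc, U, hU, D, hD, key⟩ :=
      RiskGame.MarkovGame.exists_mse_le hmu hl hmono hL.le hsmooth hmuLow
        (herg.low_le_one hmuLow.le) hrho herg hpiLow hp hγ₀ hcontr hz
    have hg : 0 < (1 - γ₀) / 2 * (muLow * piLow) := by
      have := sub_pos.2 hγ₀.2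
      positivity
    generalize (1 - γ₀) / 2 * (muLow * piLow) = g at key hg ⊢
    refine ⟨κ, hκ, b, hb, D * U, D * (c / g), fun K m α β hK hKC hstep hsamp t s => ?_,
      fun α h hα hh hα1 => ?_⟩
    · have hα := (hstep 0).1
      -- `α * c / g` is the fixed point of the recursion with constant steps
      refine (key K m _ _ hK hKC hstep hsamp ⟨α / β, fun _ => rfl⟩
        (fun t => (1 - g * α) ^ t * U + α * (c / g)) ?_ (fun t => le_of_eq ?_) t s).trans_eq ?_
      · have : 0 ≤ α * (c / g) := by positivity
        simpa using this
      · have h1 : g * α * (α * (c / g)) = c * α ^ 2 := by field_simp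
        rw [pow_succ]
        linear_combination -h1
      · congr 1
        ring
    · obtain ⟨u, B, hu0, hu, hB⟩ := RiskGame.exists_dominating_sequence (mul_pos hg hα) hα1 hh
        (mul_nonneg hc (sq_nonneg α)) hU
      refine ⟨D * B, fun K m β hK hKC hstep hsamp t s => ?_⟩
      have hne : ∀ t : ℕ, (t : ℝ) + h ≠ 0 := fun t =>
        (add_pos_of_nonneg_of_pos t.cast_nonneg (zero_lt_one.trans_le hh)).ne'
      refine (key K m _ _ hK hKC hstep hsamp
        ⟨α / β, fun t => div_div_div_cancel_right₀ (hne t) α β⟩ u hu0 (fun t => ?_) t s).trans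
        (ENNReal.ofReal_le_ofReal ?_)
      · rw [← mul_div_assoc, div_pow, ← mul_div_assoc]
        exact hu t
      · rw [mul_assoc]
        exact mul_le_mul_of_nonneg_left (hB t) hD
  -- no policy has all probabilities above `1`, so no run satisfies the sampling assumption
  · refine ⟨1, one_pos, 1, one_pos, 0, 0, fun K m α β _ _ _ hsamp => absurd hsamp.low_le_one hp,
      fun α h _ _ _ => ⟨0, fun K m β _ _ _ hsamp => absurd hsamp.low_le_one hp⟩⟩
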